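/- In this statement a digraph is a finite directed graph with no loops, no multiple edges and no pair of antiparallel edges (that is, an orientation of a finite simple graph), and $|H|$ denotes the number of vertices of $H$. A tournament is a digraph in which any two distinct vertices are joined by exactly one directed edge. A copy of $H$ in a tournament $K$ is a subgraph of $K$ (a set of vertices and a set of edges of $K$ between them) that is isomorphic to $H$. A digraph $H$ is called impartial if for some integer $n \ge |H|$ all $n$-vertex tournaments contain the same number of copies of $H$. The recursively bridge-mirrored digraphs are, up to isomorphism, those obtained as follows: the one-vertex digraph is recursively bridge-mirrored; and if $T$ is recursively bridge-mirrored and $r$ is any vertex of $T$, then the digraph formed by two disjoint copies of $T$ and one new directed edge from the vertex $r$ of one copy to the vertex $r$ of the other copy is recursively bridge-mirrored. **Theorem.** A digraph is impartial if and only if it is a disjoint union of (finitely many, possibly zero) recursively bridge-mirrored digraphs. -/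

import Mathlib

universe u v

namespace Digraph

/-- A digraph is oriented if it has no loops and no pair of antiparallel arcs, i.e. it arises from
a simple graph by directing every edge (taking `x = y` excludes loops). -/
def IsOriented {V : Type u} (H : Digraph V) : Prop :=
  ∀ x y : V, H.Adj x y → ¬ H.Adj y x

/-- A tournament: no loops, and exactly one of the two arcs between any two distinct vertices. -/
def IsTournament {V : Type u} (K : Digraph V) : Prop :=
  (∀ x : V, ¬ K.Adj x x) ∧ ∀ x y : V, x ≠ y → Xor (K.Adj x y) (K.Adj y x)

/-- Two digraphs are isomorphic. -/
def Isomorphic {V : Type u} {W : Type v} (G : Digraph V) (H : Digraph W) : Prop :=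
  Nonempty (G.Adj ≃r H.Adj)

/-- A subgraph of a digraph `K`: a set of vertices of `K` together with a set of arcs of `K`
both of whose ends lie in that set of vertices. -/
@[ext]
structure Subgraph {V : Type u} (K : Digraph V) where
  /-- The vertices of the subgraph. -/
  verts : Set V
  /-- The arcs of the subgraph. -/
  Adj : V → V → Prop
  adj_sub : ∀ {x y : V}, Adj x y → K.Adj x y
  fst_mem : ∀ {x y : V}, Adj x y → x ∈ verts
  snd_mem : ∀ {x y : V}, Adj x y → y ∈ verts

/-- A subgraph regarded as a digraph on its own set of vertices. -/
def Subgraph.coe {V : Type u} {K : Digraph V} (S : K.Subgraph) : Digraph S.verts where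
  Adj x y := S.Adj x y

/-- The number of (unlabelled) copies of `H` in `K`: the number of subgraphs of `K`
that are isomorphic to `H`. It is used only for digraphs `K` with finitely many vertices,
where the set of subgraphs is finite. -/
noncomputable def copyCount {V : Type u} {W : Type v} (H : Digraph V) (K : Digraph W) : ℕ :=
  Nat.card {S : K.Subgraph // H.Isomorphic S.coe}

/-- `H` is impartial if for some `n ≥ |H|` all `n`-vertex tournaments contain the same number
of copies of `H`. -/
def IsImpartial {V : Type u} (H : Digraph V) : Prop :=
  ∃ n : ℕ, Nat.card V ≤ n ∧
    ∀ K L : Digraph (Fin n), K.IsTournament → L.IsTournament → H.copyCount K = H.copyCount L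

/-- Two disjoint copies of `T` together with one new arc, from the vertex `r` of the first copy
to the same vertex `r` of the second copy. -/
def bridgeMirror {V : Type u} (T : Digraph V) (r : V) : Digraph (V ⊕ V) where
  Adj
    | .inl x, .inl y => T.Adj x y
    | .inr x, .inr y => T.Adj x y
    | .inl x, .inr y => x = r ∧ y = r
    | .inr _, .inl _ => False

/-- Recursively bridge-mirrored digraphs. The last clause says that the notion is invariant
under isomorphism. -/
inductive IsRecursivelyBridgeMirrored : ∀ {V : Type u}, Digraph V → Prop
  | single {V : Type u} [Unique V] : IsRecursivelyBridgeMirrored (⊥ : Digraph V)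
  | mirror {V : Type u} {T : Digraph V} (r : V) :
      IsRecursivelyBridgeMirrored T → IsRecursivelyBridgeMirrored (T.bridgeMirror r)
  | iso {V W : Type u} {T : Digraph V} {T' : Digraph W} :
      T.Isomorphic T' → IsRecursivelyBridgeMirrored T → IsRecursivelyBridgeMirrored T'

/-- The disjoint union of a family of digraphs. -/
def disjointUnion {ι : Type v} {W : ι → Type u} (G : ∀ i, Digraph (W i)) :
    Digraph (Σ i, W i) where
  Adj x y := ∃ (i : ι) (a b : W i), x = ⟨i, a⟩ ∧ y = ⟨i, b⟩ ∧ (G i).Adj a b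

/-- `H` is (isomorphic to) a disjoint union of finitely many recursively bridge-mirrored
digraphs. The empty union is allowed; it is the digraph without vertices. -/
def IsDisjointUnionOfRBM {V : Type u} (H : Digraph V) : Prop :=
  ∃ (k : ℕ) (W : Fin k → Type u) (G : ∀ i, Digraph (W i)),
    (∀ i, (G i).IsRecursivelyBridgeMirrored) ∧ H.Isomorphic (disjointUnion G)

end Digraph

/-!
Replacing a tournament by its sign function `f i j = ± 1`, the number of copies of `H` becomes, up
to the number of automorphisms, a sum over injections of products of `1 + f`. Each such sum is
affine in every single value of `f`, so impartiality says that `H` is balanced: the sum over all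
maps of the same products takes the same value for every antisymmetric weight. Balance is
multiplicative over components, and bridge-mirroring squares the homomorphism sum because
`1 + f (x r) (y r)` and `1 + f (y r) (x r)` add up to `2`. It remains to see that a connected
balanced digraph is a bridge mirror of a smaller balanced one.

Averaging products of signs over all relabellings shows that `2 ^ |E|` divides `|V|!`, hence
`|E| < |V|` and the digraph is a tree; and that the signed count of the copies of `F` in it vanishes
whenever `F` has an edge and no automorphism exchanging the ends of an edge, so that the number of
such copies is even. A tree with more than one vertex therefore has an automorphism flipping an
edge, and is the mirror of a smaller tree `K` as an undirected graph. If the orientations of the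
two halves differed, delete each mismatched edge from `K` and cancel flips as long as possible: one
of the resulting graphs has an odd number of copies in all of these deletions together, which
contradicts the vanishing of its signed count in `H` modulo 4.
-/

namespace ImpartialDigraph

open Finset Digraph SimpleGraph

/-! ### Weighted homomorphism sums -/

section HomSum

variable {V : Type*} {X : Type*} {R : Type*} [CommRing R]

open Classical in
/-- The weight of a map `x` from the vertices of `H` to `X`: the product of `1 + f (x a) (x b)`
over the arcs `a → b` of `H`. -/
noncomputable def homWeight (H : Digraph V) (f : X → X → R) (x : V → X) : R :=
  ∏ᶠ a : V, ∏ᶠ b : V, if H.Adj a b then 1 + f (x a) (x b) else 1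

/-- The weighted homomorphism sum: the sum of the weights of all maps from the vertices of `H`
to `X`. -/
noncomputable def homSum (H : Digraph V) (f : X → X → R) : R :=
  ∑ᶠ x : V → X, homWeight H f x

/-- `H` is balanced if its homomorphism sum is the same for all antisymmetric integer weights on
a given finite set, hence equal to that of the zero weight. -/
def Balanced (H : Digraph V) : Prop :=
  ∀ (N : ℕ) (f : Fin N → Fin N → ℤ), (∀ i j, f i j = -f j i) →
    homSum H f = (N : ℤ) ^ Nat.card V

open Classical in
lemma homWeight_eq_prod [Fintype V] (H : Digraph V) (f : X → X → R) (x : V → X) :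
    homWeight H f x = ∏ a : V, ∏ b : V, if H.Adj a b then 1 + f (x a) (x b) else 1 := by
  simp only [homWeight, finprod_eq_prod_of_fintype]

lemma homSum_eq_sum [Fintype V] [DecidableEq V] [Fintype X] (H : Digraph V) (f : X → X → R) :
    homSum H f = ∑ x : V → X, homWeight H f x := by
  simp only [homSum, finsum_eq_sum_of_fintype]

lemma homSum_comp_equiv {Y : Type*} (H : Digraph V) (f : Y → Y → R) (e : X ≃ Y) :
    homSum H (fun a b => f (e a) (e b)) = homSum H f := by
  unfold homSum
  rw [← finsum_comp_equiv (Equiv.arrowCongr (Equiv.refl V) e)]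
  rfl

open Classical in
lemma homWeight_comp_iso {W : Type*} {H : Digraph V} {G : Digraph W} (e : H.Adj ≃r G.Adj)
    (f : X → X → R) (x : W → X) : homWeight H f (x ∘ e) = homWeight G f x := by
  unfold homWeight
  rw [← finprod_comp_equiv e.toEquiv]
  refine finprod_congr fun a => ?_
  rw [← finprod_comp_equiv e.toEquiv]
  refine finprod_congr fun b => ?_
  have h : G.Adj (e a) (e b) ↔ H.Adj a b := e.map_rel_iff
  exact if_congr h.symm rfl rfl

lemma homSum_eq_of_iso {W : Type*} {H : Digraph V} {G : Digraph W} (e : H.Adj ≃r G.Adj)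
    (f : X → X → R) : homSum H f = homSum G f := by
  unfold homSum
  rw [← finsum_comp_equiv (Equiv.arrowCongr e.toEquiv (Equiv.refl X))]
  refine finsum_congr fun x => ?_
  rw [← homWeight_comp_iso e]
  congr 1
  ext a
  exact congrArg x (e.symm_apply_apply a).symm

lemma Balanced.of_iso {W : Type*} {H : Digraph V} {G : Digraph W} (e : H.Adj ≃r G.Adj)
    (h : Balanced H) : Balanced G := fun N f hf => by
  rw [← homSum_eq_of_iso e, h N f hf, Nat.card_congr e.toEquiv]

lemma Balanced.homSum_eq [Finite X] {H : Digraph V} (h : Balanced H) (f : X → X → ℤ)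
    (hf : ∀ i j, f i j = -f j i) : homSum H f = (Nat.card X : ℤ) ^ Nat.card V := by
  rw [← homSum_comp_equiv H f (Finite.equivFin X).symm]
  exact h _ _ fun i j => hf _ _

lemma map_homSum {S : Type*} [CommRing S] [Finite V] [Finite X] (φ : R →+* S) (H : Digraph V)
    (f : X → X → R) : φ (homSum H f) = homSum H (fun a b => φ (f a b)) := by
  classical
  have := Fintype.ofFinite V
  have := Fintype.ofFinite X
  simp only [homSum_eq_sum, homWeight_eq_prod, map_sum, map_prod, apply_ite φ, map_add, map_one]

lemma homSum_zero [Finite V] [Finite X] (H : Digraph V) :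
    homSum H (fun _ _ : X => (0 : R)) = (Nat.card X : R) ^ Nat.card V := by
  classical
  have := Fintype.ofFinite V
  have := Fintype.ofFinite X
  simp [homSum_eq_sum, homWeight_eq_prod]

/-- The polynomial in `t` whose values are the homomorphism sums of the weights `t * f`. Passing to
it allows us to compare degrees when the homomorphism sum factors. -/
noncomputable def homPoly (H : Digraph V) (f : X → X → ℤ) : Polynomial ℤ :=
  homSum H fun a b => Polynomial.X * Polynomial.C (f a b)

lemma homPoly_eval [Finite V] [Finite X] (H : Digraph V) (f : X → X → ℤ) (z : ℤ) :
    (homPoly H f).eval z = homSum H fun a b => z * f a b := by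
  have := map_homSum (Polynomial.evalRingHom z) H
    (fun a b => Polynomial.X * Polynomial.C (f a b))
  simpa [homPoly] using this

lemma Balanced.homPoly_eq [Finite V] [Finite X] {H : Digraph V} (h : Balanced H)
    (f : X → X → ℤ) (hf : ∀ i j, f i j = -f j i) :
    homPoly H f = Polynomial.C ((Nat.card X : ℤ) ^ Nat.card V) := by
  refine Polynomial.funext fun z => ?_
  rw [homPoly_eval, Polynomial.eval_C, h.homSum_eq]
  intro i j
  rw [hf i j]
  ring

lemma balanced_of_natDegree_homPoly [Finite V] {H : Digraph V}
    (h : ∀ N ≠ 0, ∀ f : Fin N → Fin N → ℤ, (∀ i j, f i j = -f j i) →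
      (homPoly H f).natDegree = 0) : Balanced H := by
  intro N f hf
  obtain ⟨c, hc⟩ : ∃ c, homPoly H f = Polynomial.C c := by
    rcases eq_or_ne N 0 with rfl | hN
    · refine ⟨homSum H f, Polynomial.funext fun z => ?_⟩
      rw [homPoly_eval, Polynomial.eval_C, Subsingleton.elim (fun a b => z * f a b) f]
    · exact ⟨_, Polynomial.eq_C_of_natDegree_eq_zero (h N hN f hf)⟩
  have h_one := homPoly_eval H f 1
  have h_zero := homPoly_eval H f 0
  simp only [hc, Polynomial.eval_C, zero_mul, one_mul, homSum_zero, Nat.card_eq_fintype_card,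
    Fintype.card_fin] at h_one h_zero
  rw [← h_one, h_zero]

end HomSum

section Constructions

variable {ι X R : Type*} [CommRing R] {V : Type u} {W : ι → Type u}

lemma disjointUnion_adj_same (G : ∀ i, Digraph (W i)) (i : ι) (a b : W i) :
    (disjointUnion G).Adj ⟨i, a⟩ ⟨i, b⟩ ↔ (G i).Adj a b := by
  constructor
  · rintro ⟨j, a', b', h_left, h_right, h⟩
    cases h_left
    cases h_right
    exact h
  · intro h
    exact ⟨i, a, b, rfl, rfl, h⟩

lemma disjointUnion_not_adj (G : ∀ i, Digraph (W i)) {i j : ι} (hij : i ≠ j) (a : W i)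
    (b : W j) : ¬ (disjointUnion G).Adj ⟨i, a⟩ ⟨j, b⟩ := by
  rintro ⟨k, a', b', h_left, h_right, h⟩
  cases h_left
  cases h_right
  exact hij rfl

lemma homWeight_disjointUnion [Fintype ι] [∀ i, Finite (W i)] (G : ∀ i, Digraph (W i))
    (f : X → X → R) (x : (Σ i, W i) → X) :
    homWeight (disjointUnion G) f x = ∏ i, homWeight (G i) f (fun a => x ⟨i, a⟩) := by
  classical
  have := fun i => Fintype.ofFinite (W i)
  simp only [homWeight_eq_prod, Fintype.prod_sigma]
  refine prod_congr rfl fun i _ => prod_congr rfl fun a _ => ?_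
  rw [Fintype.prod_eq_single i]
  · simp only [disjointUnion_adj_same]
  · exact fun j hj => prod_eq_one fun b _ => if_neg (disjointUnion_not_adj G hj.symm a b)

lemma homSum_disjointUnion [Fintype ι] [∀ i, Finite (W i)] [Finite X] (G : ∀ i, Digraph (W i))
    (f : X → X → R) : homSum (disjointUnion G) f = ∏ i, homSum (G i) f := by
  classical
  have := fun i => Fintype.ofFinite (W i)
  have := Fintype.ofFinite X
  simp only [homSum_eq_sum, homWeight_disjointUnion]
  rw [Finset.prod_univ_sum, Fintype.piFinset_univ,
    ← (Equiv.piCurry (fun (i : ι) (_ : W i) => X)).sum_comp]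
  rfl

lemma balanced_of_balanced_disjointUnion [Finite ι] [∀ i, Finite (W i)] {G : ∀ i, Digraph (W i)}
    (h : Balanced (disjointUnion G)) (i : ι) : Balanced (G i) := by
  have := Fintype.ofFinite ι
  refine balanced_of_natDegree_homPoly fun N hN f hf => ?_
  have h_prod : ∏ i, homPoly (G i) f = homPoly (disjointUnion G) f :=
    (homSum_disjointUnion G _).symm
  rw [h.homPoly_eq f hf] at h_prod
  have h_ne : ∏ i, homPoly (G i) f ≠ 0 := by
    rw [h_prod, Ne, Polynomial.C_eq_zero]
    simp [hN]
  have h_deg : ∑ i, (homPoly (G i) f).natDegree = 0 := by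
    rw [← Polynomial.natDegree_prod _ _ (prod_ne_zero_iff.1 h_ne), h_prod, Polynomial.natDegree_C]
  exact sum_eq_zero_iff.1 h_deg i (mem_univ i)

lemma balanced_disjointUnion [Finite ι] [∀ i, Finite (W i)] {G : ∀ i, Digraph (W i)} :
    Balanced (disjointUnion G) ↔ ∀ i, Balanced (G i) := by
  have := Fintype.ofFinite ι
  refine ⟨balanced_of_balanced_disjointUnion, fun h N f hf => ?_⟩
  rw [homSum_disjointUnion, Finset.prod_congr rfl fun i _ => h i N f hf,
    Finset.prod_pow_eq_pow_sum, Nat.card_sigma]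

lemma homWeight_bridgeMirror [Finite V] (T : Digraph V) (r : V) (f : X → X → R) (x y : V → X) :
    homWeight (T.bridgeMirror r) f (Sum.elim x y) =
      homWeight T f x * homWeight T f y * (1 + f (x r) (y r)) := by
  classical
  have := Fintype.ofFinite V
  have h_ll (a b : V) : (T.bridgeMirror r).Adj (.inl a) (.inl b) ↔ T.Adj a b := Iff.rfl
  have h_rr (a b : V) : (T.bridgeMirror r).Adj (.inr a) (.inr b) ↔ T.Adj a b := Iff.rfl
  have h_lr (a b : V) : (T.bridgeMirror r).Adj (.inl a) (.inr b) ↔ a = r ∧ b = r := Iff.rfl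
  have h_rl (a b : V) : (T.bridgeMirror r).Adj (.inr a) (.inl b) ↔ False := Iff.rfl
  have h_bridge : (∏ a : V, ∏ b : V, if a = r ∧ b = r then 1 + f (x a) (y b) else 1) =
      1 + f (x r) (y r) := by
    rw [Fintype.prod_eq_single r, Fintype.prod_eq_single r]
    · simp
    · intro b hb
      simp [hb]
    · intro a ha
      simp [ha]
  simp only [homWeight_eq_prod, Fintype.prod_sum_type, h_ll, h_rr, h_lr, h_rl, if_false,
    prod_const_one, Finset.prod_mul_distrib, Sum.elim_inl, Sum.elim_inr, h_bridge]
  ring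

/-- Exchanging the two copies changes the sign of the contribution of the bridge. -/
lemma homSum_bridgeMirror [IsAddTorsionFree R] [Finite V] [Finite X] (T : Digraph V) (r : V)
    (f : X → X → R) (hf : ∀ i j, f i j = -f j i) :
    homSum (T.bridgeMirror r) f = homSum T f ^ 2 := by
  classical
  have := Fintype.ofFinite V
  have := Fintype.ofFinite X
  have h_bridge : ∑ x : V → X, ∑ y : V → X,
      homWeight T f x * homWeight T f y * f (x r) (y r) = 0 := by
    refine self_eq_neg.1 ?_
    conv_lhs => rw [sum_comm]
    simp only [← sum_neg_distrib]
    refine sum_congr rfl fun x _ => sum_congr rfl fun y _ => ?_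
    rw [hf (y r)]
    ring
  calc homSum (T.bridgeMirror r) f
      = ∑ x : V → X, ∑ y : V → X, homWeight (T.bridgeMirror r) f (Sum.elim x y) := by
        rw [homSum_eq_sum, ← (Equiv.sumArrowEquivProdArrow V V X).symm.sum_comp,
          Fintype.sum_prod_type]
        rfl
    _ = ∑ x : V → X, ∑ y : V → X, homWeight T f x * homWeight T f y := by
        simp only [homWeight_bridgeMirror, mul_add, mul_one, sum_add_distrib, h_bridge, add_zero]
    _ = homSum T f ^ 2 := by rw [homSum_eq_sum, sq, sum_mul_sum]

lemma Balanced.bridgeMirror [Finite V] {T : Digraph V} (h : Balanced T) (r : V) :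
    Balanced (T.bridgeMirror r) := by
  intro N f hf
  rw [homSum_bridgeMirror T r f hf, h N f hf, Nat.card_sum]
  ring

lemma Balanced.of_bridgeMirror [Finite V] {T : Digraph V} {r : V}
    (h : Balanced (T.bridgeMirror r)) : Balanced T := by
  refine balanced_of_natDegree_homPoly fun N _ f hf => ?_
  have h_sq : homPoly (T.bridgeMirror r) f = homPoly T f ^ 2 :=
    homSum_bridgeMirror T r _ fun i j => by rw [hf i j, map_neg, mul_neg]
  have h_deg : (homPoly T f ^ 2).natDegree = 0 := by
    rw [← h_sq, h.homPoly_eq f hf, Polynomial.natDegree_C]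
  rw [Polynomial.natDegree_pow] at h_deg
  omega

lemma balanced_of_unique [Unique V] : Balanced (⊥ : Digraph V) := by
  classical
  intro N f _
  have h_weight (x : V → Fin N) : homWeight (⊥ : Digraph V) f x = 1 := by
    simp [homWeight_eq_prod]
  simp [homSum_eq_sum, h_weight]

lemma balanced_of_isRecursivelyBridgeMirrored {H : Digraph V}
    (h : H.IsRecursivelyBridgeMirrored) : Finite V ∧ Balanced H := by
  induction h with
  | single => exact ⟨inferInstance, balanced_of_unique⟩
  | mirror r _ ih =>
    have := ih.1
    exact ⟨inferInstance, ih.2.bridgeMirror r⟩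
  | iso e _ ih =>
    obtain ⟨e⟩ := e
    have := ih.1
    exact ⟨Finite.of_equiv _ e.toEquiv, ih.2.of_iso e⟩

end Constructions

/-! ### Impartial digraphs are the balanced ones -/

section Arcs

variable {V X : Type*}

open Classical in
/-- The finite set of arcs of a digraph. -/
noncomputable def arcs [Fintype V] (H : Digraph V) : Finset (V × V) :=
  univ.filter fun p => H.Adj p.1 p.2

lemma mem_arcs [Fintype V] {H : Digraph V} {p : V × V} : p ∈ arcs H ↔ H.Adj p.1 p.2 := by
  simp [arcs]

lemma ne_of_adj {H : Digraph V} (hH : H.IsOriented) {a b : V} (h : H.Adj a b) : a ≠ b := by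
  rintro rfl
  exact hH a a h h

lemma adj_swap_iff_not_adj {K : Digraph X} (hK : K.IsTournament) {i j : X} (hij : i ≠ j) :
    K.Adj j i ↔ ¬ K.Adj i j := by
  have := hK.2 i j hij
  rw [xor_def] at this
  tauto

lemma injOn_arcs_sym2_mk [Fintype V] {H : Digraph V} (hH : H.IsOriented) (x : V ↪ X) :
    Set.InjOn (fun q : V × V => s(x q.1, x q.2)) (arcs H) := by
  intro p hp q hq hpq
  rw [mem_coe, mem_arcs] at hp hq
  rcases Sym2.eq_iff.1 hpq with ⟨h_fst, h_snd⟩ | ⟨h_fst, h_snd⟩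
  · exact Prod.ext (x.injective h_fst) (x.injective h_snd)
  · rw [x.injective h_fst, x.injective h_snd] at hp
    exact absurd hp (hH _ _ hq)

lemma homWeight_eq_prod_arcs {R : Type*} [CommRing R] [Fintype V] (H : Digraph V)
    (f : X → X → R) (x : V → X) :
    homWeight H f x = ∏ p ∈ arcs H, (1 + f (x p.1) (x p.2)) := by
  classical
  rw [homWeight_eq_prod, arcs, prod_filter, Fintype.prod_prod_type]

open Classical in
/-- The sign of an ordered pair of vertices: `1` on arcs, `-1` on reversed arcs, and `0` on other
pairs. -/
noncomputable def arcSign (K : Digraph X) (i j : X) : ℤ :=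
  (if K.Adj i j then 1 else 0) - if K.Adj j i then 1 else 0

lemma arcSign_antisymm (K : Digraph X) (i j : X) : arcSign K i j = -arcSign K j i :=
  (neg_sub _ _).symm

lemma arcSign_of_isTournament {K : Digraph X} (hK : K.IsTournament) {i j : X} (hij : i ≠ j)
    [Decidable (K.Adj i j)] : arcSign K i j = if K.Adj i j then 1 else -1 := by
  rw [arcSign]
  by_cases h : K.Adj i j <;> simp [adj_swap_iff_not_adj hK hij, h]

lemma homWeight_arcSign [Fintype V] {H : Digraph V} (hH : H.IsOriented) {K : Digraph X}
    (hK : K.IsTournament) (x : V ↪ X) [Decidable (∀ a b, H.Adj a b → K.Adj (x a) (x b))] :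
    homWeight H (arcSign K) x =
      if ∀ a b, H.Adj a b → K.Adj (x a) (x b) then 2 ^ #(arcs H) else 0 := by
  classical
  have h_sign {a b : V} (h : H.Adj a b) :
      1 + arcSign K (x a) (x b) = if K.Adj (x a) (x b) then 2 else 0 := by
    rw [arcSign_of_isTournament hK (x.injective.ne (ne_of_adj hH h))]
    split_ifs <;> norm_num
  rw [homWeight_eq_prod_arcs, prod_congr rfl fun p hp => h_sign (mem_arcs.1 hp)]
  split_ifs with h
  · rw [prod_congr rfl fun p hp => if_pos (h _ _ (mem_arcs.1 hp)), prod_const]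
  · push Not at h
    obtain ⟨a, b, hab, h⟩ := h
    exact prod_eq_zero (i := (a, b)) (mem_arcs.2 hab) (if_neg h)

end Arcs

section InjHom

variable {V X : Type*} {H : Digraph V} {K : Digraph X}

/-- The injective homomorphisms from `H` to `K`. -/
def InjHom (H : Digraph V) (K : Digraph X) : Type _ :=
  {x : V ↪ X // ∀ a b, H.Adj a b → K.Adj (x a) (x b)}

/-- The image of a digraph under an injective homomorphism. -/
def InjHom.image (x : InjHom H K) : K.Subgraph where
  verts := Set.range x.1
  Adj i j := ∃ a b, H.Adj a b ∧ x.1 a = i ∧ x.1 b = j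
  adj_sub := by
    rintro _ _ ⟨a, b, h, rfl, rfl⟩
    exact x.2 a b h
  fst_mem := by
    rintro _ _ ⟨a, b, -, rfl, rfl⟩
    exact ⟨a, rfl⟩
  snd_mem := by
    rintro _ _ ⟨a, b, -, rfl, rfl⟩
    exact ⟨b, rfl⟩

/-- The isomorphism from a digraph to its image under an injective homomorphism. -/
noncomputable def InjHom.isoImage (x : InjHom H K) : H.Adj ≃r x.image.coe.Adj where
  toEquiv := Equiv.ofInjective x.1 x.1.injective
  map_rel_iff' := by
    intro a b
    constructor
    · rintro ⟨a', b', h, ha, hb⟩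
      rw [← x.1.injective ha, ← x.1.injective hb]
      exact h
    · intro h
      exact ⟨a, b, h, rfl, rfl⟩

/-- The injective homomorphism given by an isomorphism onto a subgraph. -/
def InjHom.ofIso {S : K.Subgraph} (e : H.Adj ≃r S.coe.Adj) : InjHom H K :=
  ⟨⟨fun a => (e a).1, fun _ _ h => e.injective (Subtype.ext h)⟩, fun _ _ h =>
    S.adj_sub (e.map_rel_iff.2 h)⟩

lemma InjHom.image_ofIso {S : K.Subgraph} (e : H.Adj ≃r S.coe.Adj) :
    (InjHom.ofIso e).image = S := by
  have h_adj : ∀ a b, H.Adj a b ↔ S.Adj (e a).1 (e b).1 := fun a b => e.map_rel_iff.symm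
  have h_symm : ∀ i (hi : i ∈ S.verts), (e (e.symm ⟨i, hi⟩)).1 = i := fun i hi =>
    congrArg Subtype.val (e.apply_symm_apply ⟨i, hi⟩)
  ext i j
  · constructor
    · rintro ⟨a, rfl⟩
      exact (e a).2
    · intro hi
      exact ⟨e.symm ⟨i, hi⟩, h_symm i hi⟩
  · constructor
    · rintro ⟨a, b, h, rfl, rfl⟩
      exact (h_adj a b).1 h
    · intro h
      refine ⟨e.symm ⟨i, S.fst_mem h⟩, e.symm ⟨j, S.snd_mem h⟩, ?_, h_symm i _, h_symm j _⟩
      rw [h_adj]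
      simpa using h

/-- An injective homomorphism amounts to a copy together with an isomorphism onto it. -/
noncomputable def InjHom.equivSigma (H : Digraph V) (K : Digraph X) :
    InjHom H K ≃ Σ S : {S : K.Subgraph // H.Isomorphic S.coe}, (H.Adj ≃r S.1.coe.Adj) where
  toFun x := ⟨⟨x.image, ⟨x.isoImage⟩⟩, x.isoImage⟩
  invFun p := InjHom.ofIso p.2
  left_inv x := rfl
  right_inv := by
    rintro ⟨⟨S, hS⟩, e⟩
    have h_ext : ∀ (S' : K.Subgraph) (hS' : H.Isomorphic S'.coe) (e' : H.Adj ≃r S'.coe.Adj),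
        S' = S → (∀ a, (e' a).1 = (e a).1) →
        (⟨⟨S', hS'⟩, e'⟩ : Σ S : {S : K.Subgraph // H.Isomorphic S.coe},
          (H.Adj ≃r S.1.coe.Adj)) = ⟨⟨S, hS⟩, e⟩ := by
      rintro S' hS' e' rfl h
      congr 1
      ext a
      exact h a
    exact h_ext _ _ _ (InjHom.image_ofIso e) fun a => rfl

lemma card_injHom (H : Digraph V) (K : Digraph X) :
    Nat.card (InjHom H K) = H.copyCount K * Nat.card (H.Adj ≃r H.Adj) := by
  have h_iso : ∀ S : {S : K.Subgraph // H.Isomorphic S.coe},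
      Nonempty ((H.Adj ≃r S.1.coe.Adj) ≃ (H.Adj ≃r H.Adj)) := by
    rintro ⟨S, ⟨e⟩⟩
    exact ⟨⟨fun g => g.trans e.symm, fun g => g.trans e,
      fun g => by ext; simp, fun g => by ext; simp⟩⟩
  rw [Nat.card_congr (InjHom.equivSigma H K),
    Nat.card_congr (Equiv.sigmaEquivProdOfEquiv fun S => (h_iso S).some), Nat.card_prod,
    Digraph.copyCount]

end InjHom

section InjSum

variable {V X : Type*} {H : Digraph V}

/-- The sum of the weights of all injective maps from the vertices of `H` to `X`. -/
noncomputable def injSum (H : Digraph V) (f : X → X → ℤ) : ℤ :=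
  ∑ᶠ x : V ↪ X, homWeight H f x

lemma injSum_eq_sum [Fintype (V ↪ X)] (H : Digraph V) (f : X → X → ℤ) :
    injSum H f = ∑ x : V ↪ X, homWeight H f x :=
  finsum_eq_sum_of_fintype _

lemma injSum_arcSign [Fintype V] [Finite X] (hH : H.IsOriented) {K : Digraph X}
    (hK : K.IsTournament) :
    injSum H (arcSign K) = H.copyCount K * Nat.card (H.Adj ≃r H.Adj) * 2 ^ #(arcs H) := by
  classical
  have := Fintype.ofFinite X
  have h_card := card_injHom H K
  rw [InjHom, Nat.card_eq_fintype_card, Fintype.card_subtype] at h_card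
  rw [injSum_eq_sum, sum_congr rfl fun x _ => homWeight_arcSign hH hK x, ← sum_filter, sum_const,
    h_card, nsmul_eq_mul, Nat.cast_mul]

/-- The weight `f` with its value at `(i₀, j₀)` replaced by `a` and its value at `(j₀, i₀)` replaced
by `-a`. -/
def updatePair [DecidableEq X] (f : X → X → ℤ) (i₀ j₀ : X) (a : ℤ) : X → X → ℤ :=
  fun i j => if i = i₀ ∧ j = j₀ then a else if i = j₀ ∧ j = i₀ then -a else f i j

lemma updatePair_of_sym2_ne [DecidableEq X] (f : X → X → ℤ) {i₀ j₀ i j : X} (a : ℤ)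
    (h : s(i, j) ≠ s(i₀, j₀)) : updatePair f i₀ j₀ a i j = f i j := by
  rw [Ne, Sym2.eq_iff, not_or] at h
  rw [updatePair, if_neg h.1, if_neg h.2]

lemma updatePair_self [DecidableEq X] {f : X → X → ℤ} (hf : ∀ i j, f i j = -f j i) (i₀ j₀ : X) :
    updatePair f i₀ j₀ (f i₀ j₀) = f := by
  funext i j
  unfold updatePair
  split_ifs with h h
  · rw [h.1, h.2]
  · rw [h.1, h.2, ← hf]
  · rfl

lemma updatePair_antisymm [DecidableEq X] {f : X → X → ℤ} (hf : ∀ i j, f i j = -f j i)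
    {i₀ j₀ : X} (h_ne : i₀ ≠ j₀) (a : ℤ) (i j : X) :
    updatePair f i₀ j₀ a i j = -updatePair f i₀ j₀ a j i := by
  have := hf i j
  unfold updatePair
  split_ifs <;> grind

lemma homWeight_updatePair [Finite V] [DecidableEq X] (hH : H.IsOriented) (f : X → X → ℤ)
    {i₀ j₀ : X} (h_ne : i₀ ≠ j₀) (x : V ↪ X) :
    ∃ c d : ℤ, ∀ a, homWeight H (updatePair f i₀ j₀ a) x = c + d * a := by
  classical
  have := Fintype.ofFinite V
  simp only [homWeight_eq_prod_arcs]
  by_cases h : ∃ q ∈ arcs H, s(x q.1, x q.2) = s(i₀, j₀)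
  · obtain ⟨q, hq, h_eq⟩ := h
    have h_rest (a : ℤ) : ∏ p ∈ (arcs H).erase q, (1 + updatePair f i₀ j₀ a (x p.1) (x p.2)) =
        ∏ p ∈ (arcs H).erase q, (1 + f (x p.1) (x p.2)) := by
      refine prod_congr rfl fun p hp => ?_
      rw [updatePair_of_sym2_ne f a fun hp_eq => (mem_erase.1 hp).1 ?_]
      exact injOn_arcs_sym2_mk hH x (mem_of_mem_erase hp) hq (hp_eq.trans h_eq.symm)
    set P := ∏ p ∈ (arcs H).erase q, (1 + f (x p.1) (x p.2))
    rcases Sym2.eq_iff.1 h_eq with ⟨h_fst, h_snd⟩ | ⟨h_fst, h_snd⟩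
    · refine ⟨P, P, fun a => ?_⟩
      rw [← mul_prod_erase _ _ hq, h_rest, updatePair, if_pos ⟨h_fst, h_snd⟩]
      ring
    · refine ⟨P, -P, fun a => ?_⟩
      rw [← mul_prod_erase _ _ hq, h_rest, updatePair, if_neg fun h => h_ne (h.1.symm.trans h_fst),
        if_pos ⟨h_fst, h_snd⟩]
      ring
  · push Not at h
    refine ⟨∏ p ∈ arcs H, (1 + f (x p.1) (x p.2)), 0, fun a => ?_⟩
    rw [zero_mul, add_zero]
    exact prod_congr rfl fun p hp => by rw [updatePair_of_sym2_ne f a (h p hp)]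

lemma injSum_updatePair [Finite V] [Finite X] [DecidableEq X] (hH : H.IsOriented)
    (f : X → X → ℤ) {i₀ j₀ : X} (h_ne : i₀ ≠ j₀) :
    ∃ c d : ℤ, ∀ a, injSum H (updatePair f i₀ j₀ a) = c + d * a := by
  have := Fintype.ofFinite (V ↪ X)
  choose c d h using fun x : V ↪ X => homWeight_updatePair hH f h_ne x
  refine ⟨∑ x, c x, ∑ x, d x, fun a => ?_⟩
  rw [injSum_eq_sum, sum_mul, ← sum_add_distrib]
  exact sum_congr rfl fun x _ => h x a

lemma exists_isTournament_arcSign_eq {f : X → X → ℤ} (hf : ∀ i j, f i j = -f j i)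
    (h : ∀ i j, i ≠ j → f i j = 1 ∨ f i j = -1) :
    ∃ K : Digraph X, K.IsTournament ∧ arcSign K = f := by
  refine ⟨⟨fun i j => f i j = 1⟩, ⟨fun i hi => ?_, fun i j hij => ?_⟩, ?_⟩
  · have := hf i i
    simp only at hi
    omega
  · have := hf i j
    have := h i j hij
    simp only [xor_def]
    omega
  · funext i j
    have := hf i j
    rcases eq_or_ne i j with rfl | hij
    · rw [arcSign, sub_self]
      omega
    · have := h i j hij
      rw [arcSign]
      split_ifs <;> omega

/-- A function that is affine in each value of the weight is determined by the weights with
values `±1`, which are the sign patterns of tournaments. -/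
lemma injSum_eq_of_forall_isTournament [Finite V] [Finite X] (hH : H.IsOriented) {c : ℤ}
    (hc : ∀ K : Digraph X, K.IsTournament → injSum H (arcSign K) = c) (f : X → X → ℤ)
    (hf : ∀ i j, f i j = -f j i) : injSum H f = c := by
  classical
  have := Fintype.ofFinite X
  suffices h_ind : ∀ (D : Finset (X × X)) (f : X → X → ℤ), (∀ i j, f i j = -f j i) →
      (∀ i j, i ≠ j → (i, j) ∉ D → f i j = 1 ∨ f i j = -1) → injSum H f = c from
    h_ind univ f hf fun i j _ h => absurd (mem_univ _) h
  intro D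
  induction D using Finset.induction_on with
  | empty =>
    intro f hf h
    obtain ⟨K, hK, rfl⟩ := exists_isTournament_arcSign_eq hf fun i j hij => h i j hij (by simp)
    exact hc K hK
  | insert p D hp ih =>
    obtain ⟨i₀, j₀⟩ := p
    intro f hf h
    rcases eq_or_ne i₀ j₀ with rfl | h_ne
    · refine ih f hf fun i j hij hD => h i j hij ?_
      grind
    · have h_sign (a : ℤ) (ha : a = 1 ∨ a = -1) : injSum H (updatePair f i₀ j₀ a) = c := by
        refine ih _ (updatePair_antisymm hf h_ne a) fun i j hij hD => ?_
        unfold updatePair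
        split_ifs <;> grind
      obtain ⟨c', d, h_affine⟩ := injSum_updatePair hH f h_ne
      have h_pos := h_affine 1
      have h_neg := h_affine (-1)
      rw [h_sign 1 (.inl rfl)] at h_pos
      rw [h_sign (-1) (.inr rfl)] at h_neg
      obtain rfl : d = 0 := by linarith
      have h_self := h_affine (f i₀ j₀)
      rw [updatePair_self hf] at h_self
      linarith

lemma sum_comp_embedding {Y : Type*} [Fintype V] [DecidableEq V] [Fintype X] [DecidableEq X]
    [Fintype Y] (x : V ↪ X) (g : (V → Y) → ℤ) :
    ∑ y : X → Y, g (y ∘ x) =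
      (Fintype.card Y : ℤ) ^ (Fintype.card X - Fintype.card V) * ∑ z : V → Y, g z := by
  classical
  let e := Equiv.ofInjective x x.injective
  let split := Equiv.piEquivPiSubtypeProd (fun i => i ∈ Set.range x) (fun _ => Y)
  have h_comp (z : V → Y) (b : {i // i ∉ Set.range x} → Y) :
      split.symm (e.arrowCongr (.refl Y) z, b) ∘ x = z := by
    funext v
    simp [split, e, Equiv.piEquivPiSubtypeProd, Equiv.arrowCongr]
  have h_card : Fintype.card {i // i ∉ Set.range x} = Fintype.card X - Fintype.card V := by
    rw [Fintype.card_subtype_compl]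
    exact congrArg _ (Fintype.card_congr e).symm
  rw [← split.symm.sum_comp, Fintype.sum_prod_type, ← (e.arrowCongr (.refl Y)).sum_comp, mul_sum]
  refine sum_congr rfl fun z _ => ?_
  simp only [h_comp, sum_const, card_univ, Fintype.card_fun, h_card, nsmul_eq_mul, Nat.cast_pow]

lemma sum_injSum_comp {Y : Type*} [Fintype V] [Fintype X] [Fintype Y] [DecidableEq X]
    [Fintype (V ↪ X)] (H : Digraph V) (f : Y → Y → ℤ) :
    ∑ y : X → Y, injSum H (fun i j => f (y i) (y j)) = Fintype.card (V ↪ X) *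
      ((Fintype.card Y : ℤ) ^ (Fintype.card X - Fintype.card V) * homSum H f) := by
  classical
  simp only [injSum_eq_sum]
  rw [sum_comm, homSum_eq_sum, ← nsmul_eq_mul, ← card_univ, ← sum_const]
  exact sum_congr rfl fun x _ => sum_comp_embedding x (homWeight H f)

end InjSum

section Impartial

variable {V X : Type*} {H : Digraph V}

lemma exists_injSum_eq_zero_weight [Finite V] (hH : H.IsOriented) (h : H.IsImpartial) :
    ∃ n : ℕ, Nat.card V ≤ n ∧ ∀ f : Fin n → Fin n → ℤ, (∀ i j, f i j = -f j i) →
      injSum H f = injSum H (0 : Fin n → Fin n → ℤ) := by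
  have := Fintype.ofFinite V
  obtain ⟨n, hn, h⟩ := h
  obtain ⟨K, hK⟩ : ∃ K : Digraph (Fin n), K.IsTournament :=
    ⟨⟨fun i j => i < j⟩, fun i => lt_irrefl i, fun i j hij => by simp only [xor_def]; omega⟩
  have h_const (f : Fin n → Fin n → ℤ) := injSum_eq_of_forall_isTournament (X := Fin n) hH
    (fun L hL => by rw [injSum_arcSign hH hL, h L K hL hK]) f
  exact ⟨n, hn, fun f hf => (h_const f hf).trans (h_const 0 (by simp)).symm⟩

theorem balanced_of_isImpartial [Finite V] (hH : H.IsOriented) (h : H.IsImpartial) :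
    Balanced H := by
  classical
  have := Fintype.ofFinite V
  obtain ⟨n, hn, h_inj⟩ := exists_injSum_eq_zero_weight hH h
  have : Nonempty (V ↪ Fin n) := Function.Embedding.nonempty_of_card_le (by
    rwa [Fintype.card_fin, ← Nat.card_eq_fintype_card])
  intro N f hf
  rcases eq_or_ne N 0 with rfl | hN
  · rw [Subsingleton.elim f fun _ _ => 0, homSum_zero, Nat.card_eq_fintype_card, Fintype.card_fin]
  have h_sum := sum_injSum_comp (X := Fin n) H f
  rw [sum_congr rfl fun y _ => h_inj _ fun i j => hf _ _] at h_sum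
  have h_sum_zero := sum_injSum_comp (X := Fin n) (Y := Fin N) H fun _ _ => 0
  have h_ne : (Fintype.card (V ↪ Fin n) : ℤ) ≠ 0 := Nat.cast_ne_zero.2 Fintype.card_ne_zero
  have h_ne' : (Fintype.card (Fin N) : ℤ) ^ (Fintype.card (Fin n) - Fintype.card V) ≠ 0 := by
    simp [hN]
  have h_eq := mul_left_cancel₀ h_ne' (mul_left_cancel₀ h_ne (h_sum.symm.trans h_sum_zero))
  rwa [homSum_zero, Nat.card_eq_fintype_card, Fintype.card_fin] at h_eq

lemma Balanced.sum_avoiding [Fintype V] [DecidableEq V] [Fintype X] [DecidableEq X]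
    (h : Balanced H) {f : X → X → ℤ} (hf : ∀ i j, f i j = -f j i) (Z : Finset X) :
    ∑ x : V → X with ∀ a, x a ∉ Z, homWeight H f x =
      (Nat.card {i // i ∉ Z} : ℤ) ^ Nat.card V := by
  rw [← h.homSum_eq (fun i j : {i // i ∉ Z} => f i j) fun i j => hf _ _, homSum_eq_sum]
  exact sum_bij' (fun x hx a => ⟨x a, (mem_filter.1 hx).2 a⟩) (fun x _ a => (x a).1)
    (fun _ _ => mem_univ _) (fun x _ => mem_filter.2 ⟨mem_univ _, fun a => (x a).2⟩)
    (fun _ _ => rfl) (fun _ _ => rfl) (fun _ _ => rfl)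

open Classical in
lemma sum_surjective_eq_sum_avoiding [Fintype V] [Fintype X] (g : (V → X) → ℤ) :
    ∑ x : V → X with Function.Surjective x, g x =
      ∑ Z : Finset X, (-1) ^ #Z * ∑ x : V → X with ∀ a, x a ∉ Z, g x := by
  have h := inclusion_exclusion_sum_inf_compl univ
    (fun i => univ.filter fun x : V → X => ∀ a, x a ≠ i) g
  simp only [powerset_univ, zsmul_eq_mul, Int.cast_pow, Int.cast_neg, Int.cast_one] at h
  convert h using 3 with Z
  · ext x
    simp only [mem_inf, mem_filter, mem_compl, mem_univ, true_and, forall_const, not_forall,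
      not_not]
    rfl
  · refine congrArg₂ _ ?_ rfl
    ext x
    simp only [mem_inf, mem_filter, mem_univ, true_and]
    grind

lemma Balanced.injSum_eq [Fintype V] [Fintype X] (h_card : Fintype.card V = Fintype.card X)
    (h : Balanced H) {f : X → X → ℤ} (hf : ∀ i j, f i j = -f j i) :
    injSum H f = injSum H (0 : X → X → ℤ) := by
  classical
  have h_surj (f : X → X → ℤ) :
      injSum H f = ∑ x : V → X with Function.Surjective x, homWeight H f x := by
    rw [injSum_eq_sum]
    refine sum_bij (fun x _ => x) (fun x _ => ?_) (fun x _ y _ hxy => DFunLike.coe_injective hxy)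
      (fun x hx => ?_) fun _ _ => rfl
    · rw [mem_filter]
      exact ⟨mem_univ _, ((Fintype.bijective_iff_injective_and_card x).2
        ⟨x.injective, h_card⟩).surjective⟩
    · exact ⟨⟨x, ((Fintype.bijective_iff_surjective_and_card x).2
        ⟨(mem_filter.1 hx).2, h_card⟩).injective⟩, mem_univ _, rfl⟩
  rw [h_surj, h_surj, sum_surjective_eq_sum_avoiding, sum_surjective_eq_sum_avoiding]
  refine sum_congr rfl fun Z _ => ?_
  rw [h.sum_avoiding hf, h.sum_avoiding (by simp)]

lemma Balanced.sum_perm [Fintype V] [DecidableEq V] (h : Balanced H) {f : V → V → ℤ}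
    (hf : ∀ i j, f i j = -f j i) :
    ∑ π : Equiv.Perm V, homWeight H f π = (Fintype.card V).factorial := by
  have h_inj (f : V → V → ℤ) : injSum H f = ∑ π : Equiv.Perm V, homWeight H f π := by
    rw [injSum_eq_sum, ← (Equiv.embeddingEquivOfFinite V).symm.sum_comp]
    rfl
  rw [← h_inj, h.injSum_eq rfl hf, h_inj]
  simp [homWeight_eq_prod_arcs, Fintype.card_perm]

theorem Balanced.isImpartial [Finite V] (hH : H.IsOriented) (h : Balanced H) : H.IsImpartial := by
  have := Fintype.ofFinite V
  refine ⟨Nat.card V, le_rfl, fun K L hK hL => ?_⟩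
  have h_card : Fintype.card V = Fintype.card (Fin (Nat.card V)) := by
    rw [Fintype.card_fin, Nat.card_eq_fintype_card]
  have : Finite (H.Adj ≃r H.Adj) :=
    Finite.of_injective (fun e : H.Adj ≃r H.Adj => e.toEquiv) RelIso.toEquiv_injective
  have : Nonempty (H.Adj ≃r H.Adj) := ⟨RelIso.refl _⟩
  have h_aut : (Nat.card (H.Adj ≃r H.Adj) : ℤ) ≠ 0 := by exact_mod_cast Nat.card_pos.ne'
  have h_inj : injSum H (arcSign K) = injSum H (arcSign L) :=
    (h.injSum_eq h_card (arcSign_antisymm K)).trans (h.injSum_eq h_card (arcSign_antisymm L)).symm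
  rw [injSum_arcSign hH hK, injSum_arcSign hH hL] at h_inj
  exact_mod_cast mul_right_cancel₀ h_aut (mul_right_cancel₀ (by positivity) h_inj)

theorem isImpartial_iff_balanced [Finite V] (hH : H.IsOriented) : H.IsImpartial ↔ Balanced H :=
  ⟨balanced_of_isImpartial hH, fun h => h.isImpartial hH⟩

end Impartial

/-! ### Connected components -/

section Components

/-- The restriction of `H` to the fibre of `c` over `i`. -/
def fiberDigraph {V ι : Type*} (H : Digraph V) (c : V → ι) (i : ι) : Digraph {v // c v = i} where
  Adj a b := H.Adj a b

lemma isomorphic_disjointUnion_fiberDigraph {V : Type u} {ι : Type v} {H : Digraph V} {c : V → ι}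
    (hc : ∀ a b, H.Adj a b → c a = c b) :
    H.Isomorphic (disjointUnion (fiberDigraph H c)) := by
  refine ⟨⟨(Equiv.sigmaFiberEquiv c).symm, fun {a b} => ⟨?_, fun h => ?_⟩⟩⟩
  · rintro ⟨i, a', b', ha, hb, h⟩
    have ha' : a = a' := congrArg (fun p => (p.2 : V)) ha
    have hb' : b = b' := congrArg (fun p => (p.2 : V)) hb
    rwa [ha', hb']
  · have hb : (Equiv.sigmaFiberEquiv c).symm b = ⟨c a, b, (hc a b h).symm⟩ :=
      (Equiv.symm_apply_eq _).2 rfl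
    exact ⟨c a, ⟨a, rfl⟩, ⟨b, (hc a b h).symm⟩, rfl, hb, h⟩

lemma toSimpleGraphInclusive_adj {V : Type*} {H : Digraph V} {a b : V} :
    H.toSimpleGraphInclusive.Adj a b ↔ a ≠ b ∧ (H.Adj a b ∨ H.Adj b a) :=
  SimpleGraph.fromRel_adj _ _ _

lemma exists_isomorphic_disjointUnion {V : Type u} [Finite V] {H : Digraph V}
    (hH : H.IsOriented) : ∃ (k : ℕ) (W : Fin k → Type u) (G : ∀ i, Digraph (W i)),
      (∀ i, Finite (W i)) ∧ (∀ i, (G i).toSimpleGraphInclusive.Connected) ∧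
      (∀ i, (G i).IsOriented) ∧ H.Isomorphic (disjointUnion G) := by
  have : Finite H.toSimpleGraphInclusive.ConnectedComponent := Quot.finite _
  let e := Finite.equivFin H.toSimpleGraphInclusive.ConnectedComponent
  let c : V → Fin _ := fun v => e (H.toSimpleGraphInclusive.connectedComponentMk v)
  refine ⟨_, fun i => {v // c v = i}, fiberDigraph H c, fun i => inferInstance, fun i => ?_,
    fun i a b => hH a b, isomorphic_disjointUnion_fiberDigraph fun a b h => ?_⟩
  · let φ : (e.symm i).toSimpleGraph ≃g (fiberDigraph H c i).toSimpleGraphInclusive :=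
      { toEquiv := Equiv.subtypeEquivRight fun v => (Equiv.eq_symm_apply e)
        map_rel_iff' := by
          intro a b
          have h_ind : (e.symm i).toSimpleGraph.Adj a b ↔ H.toSimpleGraphInclusive.Adj a b :=
            Iff.rfl
          rw [h_ind, toSimpleGraphInclusive_adj, toSimpleGraphInclusive_adj]
          exact and_congr_left' (not_congr Subtype.ext_iff) }
    exact (Iso.connected_iff φ).1 (e.symm i).connected_toSimpleGraph
  · have hab := toSimpleGraphInclusive_adj.2 ⟨ne_of_adj hH h, Or.inl h⟩
    exact congrArg e (ConnectedComponent.sound hab.reachable)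

lemma isImpartial_iff_of_connected {V : Type u} [Finite V] {H : Digraph V} (hH : H.IsOriented)
    (h_conn : ∀ {W : Type u} [Finite W] {G : Digraph W}, G.IsOriented →
      G.toSimpleGraphInclusive.Connected → Balanced G → G.IsRecursivelyBridgeMirrored) :
    H.IsImpartial ↔ H.IsDisjointUnionOfRBM := by
  rw [isImpartial_iff_balanced hH]
  constructor
  · intro h
    obtain ⟨k, W, G, _, hG_conn, hG, ⟨e⟩⟩ := exists_isomorphic_disjointUnion hH
    exact ⟨k, W, G, fun i => h_conn (hG i) (hG_conn i) (balanced_disjointUnion.1 (h.of_iso e) i),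
      ⟨e⟩⟩
  · rintro ⟨k, W, G, hG, ⟨e⟩⟩
    have := fun i => (balanced_of_isRecursivelyBridgeMirrored (hG i)).1
    exact (balanced_disjointUnion.2 fun i =>
      (balanced_of_isRecursivelyBridgeMirrored (hG i)).2).of_iso e.symm

end Components

/-! ### Reachability and deletion of an edge -/

section Reach

variable {V : Type*} {W : Type*} {G : SimpleGraph V}

lemma reachable_induction {p u : V} (h : G.Reachable p u) {P : V → Prop} (h0 : P p)
    (hs : ∀ u w, G.Reachable p u → P u → G.Adj u w → P w) : P u := by
  rw [reachable_iff_reflTransGen] at h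
  induction h with
  | refl => exact h0
  | tail hpu huw ih => exact hs _ _ ((reachable_iff_reflTransGen _ _).2 hpu) ih huw

/-- The graph with the edge `xy` deleted. -/
def del (G : SimpleGraph V) (x y : V) : SimpleGraph V := G.deleteEdges {s(x, y)}

lemma del_adj {x y a b : V} :
    (del G x y).Adj a b ↔ G.Adj a b ∧ ¬ (a = x ∧ b = y ∨ a = y ∧ b = x) := by
  simp [del]

lemma del_comm (x y : V) : del G x y = del G y x := by
  unfold del
  rw [Sym2.eq_swap]

lemma del_le (x y : V) : del G x y ≤ G := deleteEdges_le _

lemma reachable_del {x y v : V} (h : G.Reachable x v) :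
    (del G x y).Reachable x v ∨ (del G x y).Reachable y v := by
  refine reachable_induction h (P := fun v => (del G x y).Reachable x v ∨ (del G x y).Reachable y v)
    (Or.inl .rfl) fun u w _ ih huw => ?_
  by_cases h_xy : u = x ∧ w = y ∨ u = y ∧ w = x
  · rcases h_xy with ⟨rfl, rfl⟩ | ⟨rfl, rfl⟩
    · exact Or.inr .rfl
    · exact Or.inl .rfl
  · have huw' : (del G x y).Reachable u w := (del_adj.2 ⟨huw, h_xy⟩).reachable
    exact ih.imp (fun h => h.trans huw') fun h => h.trans huw'

lemma not_reachable_del_of_isAcyclic (hG : G.IsAcyclic) {x y : V} (h : G.Adj x y) :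
    ¬ (del G x y).Reachable x y :=
  isBridge_iff.1 (isAcyclic_iff_forall_adj_isBridge.1 hG h)

lemma isAcyclic_del (hG : G.IsAcyclic) (x y : V) : (del G x y).IsAcyclic :=
  hG.anti (del_le x y)

end Reach

/-! ### Flips -/

section Flip

variable {V : Type*} {W : Type*}

/-- No automorphism exchanges the ends of an edge. -/
def FlipFree (F : SimpleGraph V) : Prop :=
  ∀ φ : F ≃g F, ∀ x y, F.Adj x y → φ x = y → φ y ≠ x

lemma FlipFree.of_iso {F : SimpleGraph V} {F' : SimpleGraph W} (e : F ≃g F') (h : FlipFree F) :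
    FlipFree F' := fun φ x y hxy hx hy =>
  h ((e.trans φ).trans e.symm) (e.symm x) (e.symm y) (e.symm.map_rel_iff.2 hxy) (by simp [hx])
    (by simp [hy])

/-- A local automorphism of the component of `x`, extended by the identity. -/
lemma exists_iso_of_local [Finite V] {G : SimpleGraph V} {x : V} (f : V → V)
    (hx : G.Reachable x (f x))
    (hinj : ∀ u w, G.Reachable x u → G.Reachable x w → f u = f w → u = w)
    (hadj : ∀ u w, G.Reachable x u → G.Reachable x w → (G.Adj u w ↔ G.Adj (f u) (f w))) :
    ∃ g : G ≃g G, (∀ u, G.Reachable x u → g u = f u) ∧ ∀ u, ¬ G.Reachable x u → g u = u := by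
  classical
  have hf (u : V) (hu : G.Reachable x u) : G.Reachable x (f u) :=
    reachable_induction hu (P := fun u => G.Reachable x (f u)) hx fun a b ha hfa hab =>
      hfa.trans ((hadj a b ha (ha.trans hab.reachable)).1 hab).reachable
  let g : V → V := fun u => if G.Reachable x u then f u else u
  have hg_in (u : V) (hu : G.Reachable x u) : g u = f u := if_pos hu
  have hg_out (u : V) (hu : ¬ G.Reachable x u) : g u = u := if_neg hu
  have hg : Function.Injective g := by
    intro u w huw
    by_cases hu : G.Reachable x u <;> by_cases hw : G.Reachable x w
    · rw [hg_in u hu, hg_in w hw] at huw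
      exact hinj u w hu hw huw
    · rw [hg_in u hu, hg_out w hw] at huw
      exact absurd (huw ▸ hf u hu) hw
    · rw [hg_out u hu, hg_in w hw] at huw
      exact absurd (huw ▸ hf w hw) hu
    · rwa [hg_out u hu, hg_out w hw] at huw
  refine ⟨⟨Equiv.ofBijective g (Finite.injective_iff_bijective.1 hg), fun {u w} => ?_⟩, hg_in,
    hg_out⟩
  rw [Equiv.ofBijective_apply, Equiv.ofBijective_apply]
  by_cases hu : G.Reachable x u <;> by_cases hw : G.Reachable x w
  · rw [hg_in u hu, hg_in w hw]
    exact (hadj u w hu hw).symm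
  · rw [hg_in u hu, hg_out w hw]
    exact ⟨fun h => absurd ((hf u hu).trans h.reachable) hw,
      fun h => absurd (hu.trans h.reachable) hw⟩
  · rw [hg_out u hu, hg_in w hw]
    exact ⟨fun h => absurd ((hf w hw).trans h.symm.reachable) hu,
      fun h => absurd (hw.trans h.symm.reachable) hu⟩
  · rw [hg_out u hu, hg_out w hw]

lemma sum_reachable_inl {G : SimpleGraph V} {H : SimpleGraph W} {u : V} {x : V ⊕ W}
    (h : (G ⊕g H).Reachable (.inl u) x) : ∃ v, x = .inl v ∧ G.Reachable u v := by
  refine reachable_induction h (P := fun x => ∃ v, x = .inl v ∧ G.Reachable u v) ⟨u, rfl, .rfl⟩ ?_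
  rintro _ (b | b) _ ⟨v, rfl, hv⟩ hab
  · exact ⟨b, rfl, hv.trans (sum_adj_inl.1 hab).reachable⟩
  · simp at hab

lemma sum_reachable_inl_inl {G : SimpleGraph V} {H : SimpleGraph W} {u v : V} :
    (G ⊕g H).Reachable (.inl u) (.inl v) ↔ G.Reachable u v := by
  refine ⟨fun h => ?_, fun h => h.map (Embedding.sumInl (G := G) (H := H)).toHom⟩
  obtain ⟨w, hw, huw⟩ := sum_reachable_inl h
  cases hw
  exact huw

lemma not_sum_reachable {G : SimpleGraph V} {H : SimpleGraph W} {u : V} {v : W} :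
    ¬ (G ⊕g H).Reachable (.inl u) (.inr v) := by
  intro h
  obtain ⟨_, hw, -⟩ := sum_reachable_inl h
  cases hw

lemma not_flipFree_of_flip_inl [Finite V] {G : SimpleGraph V} {H : SimpleGraph W}
    (φ : G ⊕g H ≃g G ⊕g H) {x y : V} (hxy : G.Adj x y) (hφx : φ (.inl x) = .inl y)
    (hφy : φ (.inl y) = .inl x) : ¬ FlipFree G := by
  let f : V → V := fun v => Sum.elim id (fun _ => v) (φ (.inl v))
  have hf (v : V) (hv : G.Reachable x v) : φ (.inl v) = .inl (f v) := by
    have hφv : (G ⊕g H).Reachable (φ (.inl x)) (φ (.inl v)) :=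
      (Iso.reachable_iff (φ := φ)).2 (sum_reachable_inl_inl.2 hv)
    rw [hφx] at hφv
    obtain ⟨w, hw, -⟩ := sum_reachable_inl hφv
    simp [f, hw]
  have hx : f x = y := by simp [f, hφx]
  have hy : f y = x := by simp [f, hφy]
  have hinj (u w : V) (hu : G.Reachable x u) (hw : G.Reachable x w) (huw : f u = f w) : u = w :=
    Sum.inl_injective (φ.injective (by rw [hf u hu, hf w hw, huw]))
  have hadj (u w : V) (hu : G.Reachable x u) (hw : G.Reachable x w) :
      G.Adj u w ↔ G.Adj (f u) (f w) := by
    rw [← sum_adj_inl (G := G) (H := H), ← sum_adj_inl (G := G) (H := H) (v := f u),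
      ← hf u hu, ← hf w hw]
    exact φ.map_rel_iff.symm
  obtain ⟨g, hg, -⟩ := exists_iso_of_local f (by rw [hx]; exact hxy.reachable) hinj hadj
  exact fun h => h g x y hxy (by rw [hg x .rfl, hx]) (by rw [hg y hxy.reachable, hy])

lemma FlipFree.sum [Finite V] [Finite W] {G : SimpleGraph V} {H : SimpleGraph W}
    (hG : FlipFree G) (hH : FlipFree H) : FlipFree (G ⊕g H) := by
  rintro φ (x | x) (y | y) hxy hφx hφy
  · exact not_flipFree_of_flip_inl φ (sum_adj_inl.1 hxy) hφx hφy hG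
  · exact absurd hxy (by simp)
  · exact absurd hxy (by simp)
  · exact not_flipFree_of_flip_inl ((Iso.sumComm.trans φ).trans Iso.sumComm) (sum_adj_inr.1 hxy)
      (by simp [hφx]) (by simp [hφy]) hH

lemma FlipFree.left_of_sum {G : SimpleGraph V} {H : SimpleGraph W} (h : FlipFree (G ⊕g H)) :
    FlipFree G := fun φ x y hxy hφx hφy =>
  h (Iso.sumCongr φ Iso.refl) (.inl x) (.inl y) (sum_adj_inl.2 hxy) (by simp [hφx])
    (by simp [hφy])

lemma FlipFree.right_of_sum {G : SimpleGraph V} {H : SimpleGraph W} (h : FlipFree (G ⊕g H)) :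
    FlipFree H :=
  (h.of_iso Iso.sumComm).left_of_sum

end Flip

/-! ### Sums over spanning subgraphs modulo 2 -/

section Parity

variable {V : Type*} {W : Type*} [Finite V] [Finite W]

/-- The finite set of spanning subgraphs of `G`. -/
noncomputable def spanningSubgraphs (G : SimpleGraph V) : Finset (SimpleGraph V) :=
  (Set.toFinite {F | F ≤ G}).toFinset

@[simp] lemma mem_spanningSubgraphs {G F : SimpleGraph V} :
    F ∈ spanningSubgraphs G ↔ F ≤ G := by
  simp [spanningSubgraphs]

/-- Every isomorphism invariant modulo `2` that vanishes at graphs that are not flip-free has the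
same sum over the spanning subgraphs of `G` as over those of `R`. -/
def ParityEq (G R : SimpleGraph V) : Prop :=
  ∀ M : SimpleGraph V → ZMod 2, (∀ F F' : SimpleGraph V, Nonempty (F ≃g F') → M F = M F') →
    (∀ F, ¬ FlipFree F → M F = 0) → ∑ F ∈ spanningSubgraphs G, M F = ∑ F ∈ spanningSubgraphs R, M F

lemma ParityEq.refl (G : SimpleGraph V) : ParityEq G G := fun _ _ _ => rfl

lemma ParityEq.trans {G R S : SimpleGraph V} (hGR : ParityEq G R) (hRS : ParityEq R S) :
    ParityEq G S := fun M hM hM' => (hGR M hM hM').trans (hRS M hM hM')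

lemma sum_spanningSubgraphs_comap {A : Type*} [AddCommMonoid A] (e : V ≃ W)
    (G : SimpleGraph W) (M : SimpleGraph V → A) :
    ∑ F ∈ spanningSubgraphs (G.comap e), M F = ∑ F ∈ spanningSubgraphs G, M (F.comap e) := by
  have h_left (F : SimpleGraph V) : (F.comap e.symm).comap e = F := by
    ext a b
    simp
  have h_right (F : SimpleGraph W) : (F.comap e).comap e.symm = F := by
    ext a b
    simp
  refine Finset.sum_bij' (fun F _ => F.comap e.symm) (fun F _ => F.comap e) ?_ ?_
    (fun F _ => h_left F) (fun F _ => h_right F) (fun F _ => by rw [h_left])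
  · intro F hF
    rw [mem_spanningSubgraphs] at hF ⊢
    rw [← h_right G]
    exact fun a b hab => hF hab
  · intro F hF
    rw [mem_spanningSubgraphs] at hF ⊢
    exact fun a b hab => hF hab

lemma ParityEq.comap (e : V ≃ W) {G R : SimpleGraph W} (h : ParityEq G R) :
    ParityEq (G.comap e) (R.comap e) := by
  intro M hM hM'
  rw [sum_spanningSubgraphs_comap, sum_spanningSubgraphs_comap]
  refine h (fun F => M (F.comap e)) ?_ fun F hF => hM' _ fun h => hF (h.of_iso (Iso.comap e F))
  rintro F F' ⟨φ⟩
  exact hM _ _ ⟨((Iso.comap e F).trans φ).trans (Iso.comap e F').symm⟩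

lemma sum_le_sum_iff {V W : Type*} {F G : SimpleGraph V} {F' G' : SimpleGraph W} :
    F ⊕g F' ≤ G ⊕g G' ↔ F ≤ G ∧ F' ≤ G' := by
  refine ⟨fun h => ⟨fun a b hab => sum_adj_inl.1 (h (sum_adj_inl.2 hab)),
    fun a b hab => sum_adj_inr.1 (h (sum_adj_inr.2 hab))⟩, ?_⟩
  rintro ⟨hF, hF'⟩ (a | a) (b | b) hab
  · exact hF hab
  · exact absurd hab (by simp)
  · exact absurd hab (by simp)
  · exact hF' hab

lemma comap_inl_sum_comap_inr {V W : Type*} {G : SimpleGraph V} {H : SimpleGraph W}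
    {F : SimpleGraph (V ⊕ W)} (hF : F ≤ G ⊕g H) : F.comap Sum.inl ⊕g F.comap Sum.inr = F := by
  ext (a | a) (b | b)
  · simp
  · simpa using fun h => by simpa using hF h
  · simpa using fun h => by simpa using hF h
  · simp

lemma sum_spanningSubgraphs_sum {A : Type*} [AddCommMonoid A]
    (G : SimpleGraph V) (H : SimpleGraph W) (M : SimpleGraph (V ⊕ W) → A) :
    ∑ F ∈ spanningSubgraphs (G ⊕g H), M F =
      ∑ F ∈ spanningSubgraphs G, ∑ F' ∈ spanningSubgraphs H, M (F ⊕g F') := by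
  rw [← Finset.sum_product']
  refine Finset.sum_bij' (fun F _ => (F.comap Sum.inl, F.comap Sum.inr))
    (fun P _ => P.1 ⊕g P.2) ?_ ?_ ?_ ?_ ?_
  · intro F hF
    rw [mem_spanningSubgraphs] at hF
    rw [← comap_inl_sum_comap_inr hF, sum_le_sum_iff] at hF
    exact mem_product.2 ⟨mem_spanningSubgraphs.2 hF.1, mem_spanningSubgraphs.2 hF.2⟩
  · rintro ⟨F, F'⟩ hF
    rw [Finset.mem_product, mem_spanningSubgraphs, mem_spanningSubgraphs] at hF
    exact mem_spanningSubgraphs.2 (sum_le_sum_iff.2 hF)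
  · exact fun F hF => comap_inl_sum_comap_inr (mem_spanningSubgraphs.1 hF)
  · rintro ⟨F, F'⟩ _
    ext a b <;> simp
  · intro F hF
    rw [comap_inl_sum_comap_inr (mem_spanningSubgraphs.1 hF)]

lemma ParityEq.sum {G R : SimpleGraph V} {H S : SimpleGraph W}
    (hGR : ParityEq G R) (hHS : ParityEq H S) : ParityEq (G ⊕g H) (R ⊕g S) := by
  intro M hM hM'
  have h_right (F : SimpleGraph V) :
      ∑ F' ∈ spanningSubgraphs H, M (F ⊕g F') = ∑ F' ∈ spanningSubgraphs S, M (F ⊕g F') := by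
    refine hHS (fun F' => M (F ⊕g F')) ?_ fun F' hF' => hM' _ fun h => hF' h.right_of_sum
    rintro F₁ F₂ ⟨φ⟩
    exact hM _ _ ⟨Iso.sumCongr Iso.refl φ⟩
  have h_left (F' : SimpleGraph W) :
      ∑ F ∈ spanningSubgraphs G, M (F ⊕g F') = ∑ F ∈ spanningSubgraphs R, M (F ⊕g F') := by
    refine hGR (fun F => M (F ⊕g F')) ?_ fun F hF => hM' _ fun h => hF h.left_of_sum
    rintro F₁ F₂ ⟨φ⟩
    exact hM _ _ ⟨Iso.sumCongr φ Iso.refl⟩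
  simp only [sum_spanningSubgraphs_sum, h_right]
  rw [Finset.sum_comm, Finset.sum_comm (s := spanningSubgraphs R)]
  exact sum_congr rfl fun F' _ => h_left F'

end Parity

/-! ### Mirrored graphs -/

section Mirror

variable {W : Type*}

/-- Two copies of `K` with an edge between the two copies of `r`: the undirected graph underlying
`Digraph.bridgeMirror`. -/
def mirror (K : SimpleGraph W) (r : W) : SimpleGraph (W ⊕ W) where
  Adj
    | .inl x, .inl y => K.Adj x y
    | .inr x, .inr y => K.Adj x y
    | .inl x, .inr y => x = r ∧ y = r
    | .inr x, .inl y => x = r ∧ y = r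
  symm := ⟨by
    rintro (x | x) (y | y) h
    · exact SimpleGraph.Adj.symm (G := K) h
    · exact h.symm
    · exact h.symm
    · exact SimpleGraph.Adj.symm (G := K) h⟩
  loopless := ⟨by
    rintro (x | x) h
    · exact K.irrefl h
    · exact K.irrefl h⟩

variable {K : SimpleGraph W} {r : W}

@[simp] lemma mirror_inl_inl {x y : W} : (mirror K r).Adj (.inl x) (.inl y) ↔ K.Adj x y := Iff.rfl

@[simp] lemma mirror_inr_inr {x y : W} : (mirror K r).Adj (.inr x) (.inr y) ↔ K.Adj x y := Iff.rfl

@[simp] lemma mirror_inl_inr {x y : W} :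
    (mirror K r).Adj (.inl x) (.inr y) ↔ x = r ∧ y = r := Iff.rfl

@[simp] lemma mirror_inr_inl {x y : W} :
    (mirror K r).Adj (.inr x) (.inl y) ↔ x = r ∧ y = r := Iff.rfl

lemma sum_le_mirror : K ⊕g K ≤ mirror K r := by
  rintro (a | a) (b | b) hab
  · exact mirror_inl_inl.2 (sum_adj_inl.1 hab)
  · exact absurd hab (by simp)
  · exact absurd hab (by simp)
  · exact mirror_inr_inr.2 (sum_adj_inr.1 hab)

lemma le_sum_of_le_mirror {F : SimpleGraph (W ⊕ W)} (h : F ≤ mirror K r)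
    (hF : ¬ F.Adj (.inl r) (.inr r)) : F ≤ K ⊕g K := by
  rintro (a | a) (b | b) hab
  · exact sum_adj_inl.2 (h hab)
  · obtain ⟨rfl, rfl⟩ := h hab
    exact absurd hab hF
  · obtain ⟨rfl, rfl⟩ := h hab
    exact absurd hab.symm hF
  · exact sum_adj_inr.2 (h hab)

/-- The image of a graph under the exchange of two halves of its vertex set, which is an
involution on the spanning subgraphs of a mirrored graph. -/
abbrev reflect (F : SimpleGraph (W ⊕ W)) : SimpleGraph (W ⊕ W) := F.comap (Equiv.sumComm W W)

lemma reflect_reflect (F : SimpleGraph (W ⊕ W)) : reflect (reflect F) = F := by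
  ext a b
  simp

lemma reflect_mirror : reflect (mirror K r) = mirror K r := by
  ext (a | a) (b | b) <;> rfl

lemma reflect_le_mirror {F : SimpleGraph (W ⊕ W)} (h : F ≤ mirror K r) :
    reflect F ≤ mirror K r := by
  rw [← reflect_mirror]
  exact fun a b hab => h hab

lemma not_flipFree_of_reflect {F : SimpleGraph (W ⊕ W)} (h : reflect F = F)
    (hF : F.Adj (.inl r) (.inr r)) : ¬ FlipFree F := by
  have hφ (a b : W ⊕ W) : F.Adj (Equiv.sumComm W W a) (Equiv.sumComm W W b) ↔ F.Adj a b := by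
    conv_rhs => rw [← h]
    rfl
  exact fun h_free => h_free ⟨Equiv.sumComm W W, hφ _ _⟩ _ _ hF rfl rfl

open Classical in
lemma filter_not_bridge_spanningSubgraphs [Finite W] (K : SimpleGraph W) (r : W) :
    {F ∈ spanningSubgraphs (mirror K r) | ¬ F.Adj (.inl r) (.inr r)} =
      spanningSubgraphs (K ⊕g K) := by
  ext F
  rw [Finset.mem_filter, mem_spanningSubgraphs, mem_spanningSubgraphs]
  exact ⟨fun h => le_sum_of_le_mirror h.1 h.2,
    fun h => ⟨h.trans sum_le_mirror, fun h' => absurd (h h') (by simp)⟩⟩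

/-- The subgraphs that contain the bridge cancel in pairs under reflection, and the subgraphs fixed
by reflection flip the bridge. -/
lemma parityEq_mirror [Finite W] (K : SimpleGraph W) (r : W) :
    ParityEq (mirror K r) (K ⊕g K) := by
  classical
  intro M hM hM'
  rw [← sum_filter_add_sum_filter_not _ fun F : SimpleGraph (W ⊕ W) => F.Adj (.inl r) (.inr r),
    filter_not_bridge_spanningSubgraphs, Finset.sum_involution fun F _ => reflect F, zero_add]
  · intro F _
    rw [hM (reflect F) F ⟨Iso.comap (Equiv.sumComm W W) F⟩]
    exact CharTwo.add_self_eq_zero _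
  · intro F hF hMF h
    exact hMF (hM' F (not_flipFree_of_reflect h (mem_filter.1 hF).2))
  · intro F hF
    rw [Finset.mem_filter, mem_spanningSubgraphs] at hF ⊢
    exact ⟨reflect_le_mirror hF.1, hF.2.symm⟩
  · intro F _
    exact reflect_reflect F

end Mirror

/-! ### Component sizes -/

section CompCard

variable {V : Type*} {W : Type*} {G G' : SimpleGraph V} {p p' : V}

/-- The number of vertices in the component of `p`. -/
noncomputable def compCard (G : SimpleGraph V) (p : V) : ℕ := {w | G.Reachable p w}.ncard

lemma compCard_pos [Finite V] (G : SimpleGraph V) (p : V) : 0 < compCard G p :=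
  (Set.ncard_pos (Set.toFinite _)).2 ⟨p, .rfl⟩

lemma compCard_le [Finite V] (h : ∀ w, G.Reachable p w → G'.Reachable p' w) :
    compCard G p ≤ compCard G' p' :=
  Set.ncard_le_ncard (fun w hw => h w hw) (Set.toFinite _)

lemma compCard_lt [Finite V] (h : ∀ w, G.Reachable p w → G'.Reachable p' w) {z : V}
    (hz : G'.Reachable p' z) (hz' : ¬ G.Reachable p z) : compCard G p < compCard G' p' :=
  Set.ncard_lt_ncard ⟨fun w hw => h w hw, fun h' => hz' (h' hz)⟩ (Set.toFinite _)

lemma compCard_congr (h : ∀ w, G.Reachable p w ↔ G'.Reachable p' w) :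
    compCard G p = compCard G' p' :=
  congrArg Set.ncard (Set.ext h)

lemma compCard_eq_of_reachable (h : G.Reachable p p') : compCard G p = compCard G p' :=
  compCard_congr fun _ => ⟨fun h' => h.symm.trans h', fun h' => h.trans h'⟩

lemma compCard_eq_of_connected (hG : G.Connected) (p : V) : compCard G p = Nat.card V := by
  rw [← Set.ncard_univ]
  exact congrArg Set.ncard (Set.eq_univ_of_forall (hG.preconnected p))

lemma compCard_bot (p : V) : compCard (⊥ : SimpleGraph V) p = 1 := by
  simp only [compCard, reachable_bot, Set.ofPred_eq_eq_singleton', Set.ncard_singleton]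

lemma compCard_apply_iso {H : SimpleGraph W} (e : G ≃g H) (p : V) :
    compCard H (e p) = compCard G p :=
  (Nat.card_congr (e.toEquiv.subtypeEquiv fun _ => (Iso.reachable_iff (φ := e)).symm)).symm

lemma compCard_comap (e : V ≃ W) (R : SimpleGraph W) (p : V) :
    compCard (R.comap e) p = compCard R (e p) :=
  (compCard_apply_iso (Iso.comap e R) p).symm

lemma compCard_inl {H : SimpleGraph W} (p : V) :
    compCard (G ⊕g H) (.inl p) = compCard G p := by
  have h_image : {w | (G ⊕g H).Reachable (.inl p) w} = Sum.inl '' {w | G.Reachable p w} := by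
    ext w
    constructor
    · intro hw
      obtain ⟨u, rfl, hu⟩ := sum_reachable_inl hw
      exact ⟨u, hu, rfl⟩
    · rintro ⟨u, hu, rfl⟩
      exact sum_reachable_inl_inl.2 hu
  rw [compCard, h_image, Set.ncard_image_of_injective _ Sum.inl_injective, compCard]

lemma compCard_inr {H : SimpleGraph W} (p : W) :
    compCard (G ⊕g H) (.inr p) = compCard H p := by
  rw [← compCard_inl (G := H) (H := G)]
  exact (compCard_apply_iso (Iso.sumComm (G := G) (H := H)) (.inr p)).symm

end CompCard

/-! ### Mirrored trees -/

section MirrorTree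

variable {V : Type u} {W : Type v}

lemma adj_iff_del_adj_or {G : SimpleGraph V} {x y a b : V} (hxy : G.Adj x y) :
    G.Adj a b ↔ (del G x y).Adj a b ∨ (a = x ∧ b = y ∨ a = y ∧ b = x) := by
  rw [del_adj]
  constructor
  · tauto
  · rintro (h | ⟨rfl, rfl⟩ | ⟨rfl, rfl⟩)
    · exact h.1
    · exact hxy
    · exact hxy.symm

lemma del_adj_apply_iff {G : SimpleGraph V} {H : SimpleGraph W} (φ : G ≃g H) (x y a b : V) :
    (del H (φ x) (φ y)).Adj (φ a) (φ b) ↔ (del G x y).Adj a b := by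
  simp only [del_adj, φ.map_adj_iff, φ.injective.eq_iff]

/-- An isomorphism remains one after an edge and its image are deleted. -/
def delIso {G : SimpleGraph V} {H : SimpleGraph W} (φ : G ≃g H) (x y : V) :
    del G x y ≃g del H (φ x) (φ y) where
  toEquiv := φ.toEquiv
  map_rel_iff' := del_adj_apply_iff φ x y _ _

lemma mem_supp_iff_reachable {G : SimpleGraph V} {x v : V} :
    v ∈ (G.connectedComponentMk x).supp ↔ G.Reachable x v := by
  rw [ConnectedComponent.mem_supp_iff, ConnectedComponent.eq]
  exact reachable_comm

lemma isTree_induce_supp {G : SimpleGraph V} (hG : G.IsAcyclic)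
    (c : G.ConnectedComponent) : (G.induce c.supp).IsTree :=
  ⟨c.connected_toSimpleGraph, hG.induce _⟩

lemma exists_iso_sum {G : SimpleGraph V} {x y : V} (hxy : ¬ G.Reachable x y)
    (h : ∀ v, G.Reachable x v ∨ G.Reachable y v) :
    ∃ e : G.induce (G.connectedComponentMk x).supp ⊕g
        G.induce (G.connectedComponentMk y).supp ≃g G,
      (∀ a, e (.inl a) = a.1) ∧ ∀ a, e (.inr a) = a.1 := by
  let f : (G.connectedComponentMk x).supp ⊕ (G.connectedComponentMk y).supp → V :=
    Sum.elim Subtype.val Subtype.val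
  have h_not (a : (G.connectedComponentMk x).supp) (b : (G.connectedComponentMk y).supp) :
      ¬ G.Reachable a.1 b.1 := fun hab =>
    hxy (((mem_supp_iff_reachable.1 a.2).trans hab).trans (mem_supp_iff_reachable.1 b.2).symm)
  have hf : Function.Bijective f := by
    constructor
    · rintro (a | a) (b | b) hab
      · exact congrArg _ (Subtype.ext hab)
      · exact absurd ((show a.1 = b.1 from hab) ▸ .rfl) (h_not a b)
      · exact absurd ((show a.1 = b.1 from hab) ▸ .rfl) (h_not b a)
      · exact congrArg _ (Subtype.ext hab)
    · intro v
      rcases h v with h | h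
      · exact ⟨.inl ⟨v, mem_supp_iff_reachable.2 h⟩, rfl⟩
      · exact ⟨.inr ⟨v, mem_supp_iff_reachable.2 h⟩, rfl⟩
  refine ⟨⟨Equiv.ofBijective f hf, ?_⟩, fun _ => rfl, fun _ => rfl⟩
  rintro (a | a) (b | b)
  · rfl
  · exact iff_of_false (fun hab => h_not a b hab.reachable) (by simp)
  · exact iff_of_false (fun hab => h_not b a hab.reachable.symm) (by simp)
  · rfl

variable {K : SimpleGraph W} {r : W}

lemma mirror_del : del (mirror K r) (.inl r) (.inr r) = K ⊕g K := by
  ext (a | a) (b | b) <;> simp [del_adj]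

/-- Two copies of `K` in `G` joined by an edge form a mirror. -/
def mirrorIso {G : SimpleGraph V} {x y : V} (ψ : K ⊕g K ≃g del G x y) (hx : ψ (.inl r) = x)
    (hy : ψ (.inr r) = y) (hxy : G.Adj x y) : mirror K r ≃g G where
  toEquiv := ψ.toEquiv
  map_rel_iff' := by
    intro a b
    have h_mirror : (mirror K r).Adj (.inl r) (.inr r) := by simp
    have h_adj : (del G x y).Adj (ψ a) (ψ b) ↔ (K ⊕g K).Adj a b := ψ.map_adj_iff
    have h_left (c : W ⊕ W) : ψ c = x ↔ c = .inl r := by rw [← ψ.injective.eq_iff, hx]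
    have h_right (c : W ⊕ W) : ψ c = y ↔ c = .inr r := by rw [← ψ.injective.eq_iff, hy]
    rw [adj_iff_del_adj_or h_mirror, adj_iff_del_adj_or hxy, mirror_del]
    simp only [RelIso.coe_fn_toEquiv, h_adj, h_left, h_right]

/-- The two sides of a flipped edge are exchanged by the flip. -/
lemma exists_mirror_iso [Finite V] {G : SimpleGraph V} (hG : G.IsTree) (h : ¬ FlipFree G) :
    ∃ (W : Type u) (_ : Finite W) (K : SimpleGraph W) (r : W),
      K.IsTree ∧ Nonempty (mirror K r ≃g G) := by
  unfold FlipFree at h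
  push Not at h
  obtain ⟨φ, x, y, hxy, hφx, hφy⟩ := h
  have h_adj (a b : V) : (del G x y).Adj (φ a) (φ b) ↔ (del G x y).Adj a b := by
    have h := del_adj_apply_iff φ x y a b
    rwa [hφx, hφy, del_comm] at h
  let φ' : del G x y ≃g del G x y := ⟨φ.toEquiv, h_adj _ _⟩
  have h_supp (v : V) : v ∈ ((del G x y).connectedComponentMk x).supp ↔
      φ' v ∈ ((del G x y).connectedComponentMk y).supp := by
    rw [mem_supp_iff_reachable, mem_supp_iff_reachable, ← Iso.reachable_iff (φ := φ')]
    exact iff_of_eq (congrArg (fun z => (del G x y).Reachable z (φ' v)) hφx)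
  let α : (del G x y).induce ((del G x y).connectedComponentMk x).supp ≃g
      (del G x y).induce ((del G x y).connectedComponentMk y).supp :=
    ⟨φ'.toEquiv.subtypeEquiv h_supp, φ'.map_rel_iff⟩
  obtain ⟨e, hel, her⟩ := exists_iso_sum (not_reachable_del_of_isAcyclic hG.isAcyclic hxy)
    fun v => reachable_del (hG.connected.preconnected x v)
  refine ⟨_, inferInstance, _, ⟨x, mem_supp_iff_reachable.2 .rfl⟩,
    isTree_induce_supp (isAcyclic_del hG.isAcyclic x y) _,
    ⟨mirrorIso ((Iso.sumCongr Iso.refl α).trans e) ?_ ?_ hxy⟩⟩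
  · exact hel _
  · exact (her _).trans hφx

/-- The automorphism of a mirrored graph that exchanges the two halves. -/
@[simps!]
def mirrorSwap (K : SimpleGraph W) (r : W) : mirror K r ≃g mirror K r where
  toEquiv := Equiv.sumComm W W
  map_rel_iff' := by
    rintro (a | a) (b | b) <;> simp

lemma not_flipFree_mirror : ¬ FlipFree (mirror K r) := fun h =>
  h (mirrorSwap K r) (.inl r) (.inr r) (by simp) rfl rfl

/-- Deleting an edge of the left half leaves the whole right half and a vertex of the left half
connected, which is too large for the image of a half. -/
lemma mirror_iso_not_inl [Finite W] (hK : K.Connected) (φ : mirror K r ≃g mirror K r) {a b : W}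
    (ha : φ (.inl r) = .inl a) (hb : φ (.inr r) = .inl b) : False := by
  let D := del (mirror K r) (.inl a) (.inl b)
  have h_card (z : W ⊕ W) : compCard D z = Nat.card W := by
    have h_iso : compCard (del (mirror K r) (φ (.inl r)) (φ (.inr r))) (φ (φ.symm z)) =
        compCard (del (mirror K r) (.inl r) (.inr r)) (φ.symm z) :=
      compCard_apply_iso (delIso φ (.inl r) (.inr r)) (φ.symm z)
    rw [mirror_del, ha, hb, φ.apply_symm_apply] at h_iso
    rw [h_iso]
    rcases φ.symm z with u | u
    · rw [compCard_inl, compCard_eq_of_connected hK]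
    · rw [compCard_inr, compCard_eq_of_connected hK]
  have h_bridge : D.Adj (.inl r) (.inr r) := by simp [D, del_adj]
  have h_right : (⊥ : SimpleGraph W) ⊕g K ≤ D := by
    rintro (u | u) (v | v) huv
    · exact absurd huv (by simp)
    · exact absurd huv (by simp)
    · exact absurd huv (by simp)
    · simpa [D, del_adj] using huv
  have h_lt : compCard ((⊥ : SimpleGraph W) ⊕g K) (.inr r) < compCard D (.inr r) :=
    compCard_lt (fun w hw => hw.mono h_right) h_bridge.symm.reachable
      fun h => not_sum_reachable h.symm
  rw [h_card, compCard_inr, compCard_eq_of_connected hK] at h_lt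
  exact lt_irrefl _ h_lt

lemma mirror_iso_inl [Finite W] (hK : K.Connected) (φ : mirror K r ≃g mirror K r) :
    (φ (.inl r) = .inl r ∧ φ (.inr r) = .inr r) ∨
      (φ (.inl r) = .inr r ∧ φ (.inr r) = .inl r) := by
  have h : (mirror K r).Adj (φ (.inl r)) (φ (.inr r)) := φ.map_adj_iff.2 (by simp)
  rcases ha : φ (.inl r) with a | a <;> rcases hb : φ (.inr r) with b | b
  · exact (mirror_iso_not_inl hK φ ha hb).elim
  · rw [ha, hb, mirror_inl_inr] at h
    simp [h]
  · rw [ha, hb, mirror_inr_inl] at h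
    simp [h]
  · exact (mirror_iso_not_inl hK (φ.trans (mirrorSwap K r)) (a := a) (b := b) (by simp [ha])
      (by simp [hb])).elim

/-- Automorphisms fixing `p` are trivial on the component of `p`. -/
def RigidAt (G : SimpleGraph V) (p : V) : Prop :=
  ∀ φ : G ≃g G, φ p = p → ∀ u, G.Reachable p u → φ u = u

lemma sum_iso_fix_inl [Finite W] (hK : K.Connected) (hr : RigidAt K r)
    (ψ : K ⊕g K ≃g K ⊕g K) (hψ : ψ (.inl r) = .inl r) (w : W) : ψ (.inl w) = .inl w := by
  have h_left (u : W) : ∃ u', ψ (.inl u) = .inl u' := by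
    have hu : (K ⊕g K).Reachable (ψ (.inl r)) (ψ (.inl u)) :=
      (Iso.reachable_iff (φ := ψ)).2 (sum_reachable_inl_inl.2 (hK.preconnected r u))
    rw [hψ] at hu
    obtain ⟨u', hu', -⟩ := sum_reachable_inl hu
    exact ⟨u', hu'⟩
  choose f hf using h_left
  have hf_inj : Function.Injective f := fun a b hab =>
    Sum.inl_injective (ψ.injective (by rw [hf, hf, hab]))
  let α : K ≃g K := ⟨Equiv.ofBijective f (Finite.injective_iff_bijective.1 hf_inj), fun {a b} => by
    have hab := ψ.map_adj_iff (v := .inl a) (w := .inl b)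
    rwa [hf, hf, sum_adj_inl, sum_adj_inl] at hab⟩
  rw [hf]
  exact congrArg _ (hr α (Sum.inl_injective ((hf r).symm.trans hψ)) w (hK.preconnected r w))

lemma mirror_iso_fix [Finite W] (hK : K.Connected) (hr : RigidAt K r)
    (φ : mirror K r ≃g mirror K r) (hl : φ (.inl r) = .inl r) (hr' : φ (.inr r) = .inr r)
    (w : W ⊕ W) : φ w = w := by
  have hφ (u v : W ⊕ W) : (K ⊕g K).Adj (φ u) (φ v) ↔ (K ⊕g K).Adj u v := by
    have h := del_adj_apply_iff φ (.inl r) (.inr r) u v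
    rwa [hl, hr', mirror_del] at h
  let ψ : K ⊕g K ≃g K ⊕g K := ⟨φ.toEquiv, hφ _ _⟩
  rcases w with w | w
  · exact sum_iso_fix_inl hK hr ψ hl w
  · have h := sum_iso_fix_inl hK hr ((Iso.sumComm.trans ψ).trans Iso.sumComm)
      (congrArg Sum.swap hr') w
    exact (Sum.swap_swap _).symm.trans (congrArg Sum.swap h)

lemma rigidAt_mirror [Finite W] (hK : K.Connected) (hr : RigidAt K r) (v : W ⊕ W) :
    RigidAt (mirror K r) v := by
  intro φ hv w _
  rcases mirror_iso_inl hK φ with ⟨hl, hr'⟩ | ⟨hl, hr'⟩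
  · exact mirror_iso_fix hK hr φ hl hr' w
  · have h_swap := mirror_iso_fix hK hr (φ.trans (mirrorSwap K r)) (by simp [hl]) (by simp [hr']) v
    rw [RelIso.trans_apply, hv] at h_swap
    rcases v with v | v <;> simp at h_swap

end MirrorTree

/-! ### Reduction to flip-free graphs -/

section Reduction

variable {V : Type*} {W : Type*}

/-- `R` is a flip-free spanning subgraph of `G` that has the parities of `G`. -/
structure IsParityReduction [Finite V] (G R : SimpleGraph V) : Prop where
  le : R ≤ G
  flipFree : FlipFree R
  parityEq : ParityEq G R

lemma IsParityReduction.refl [Finite V] {G : SimpleGraph V} (h : FlipFree G) :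
    IsParityReduction G G := ⟨le_rfl, h, ParityEq.refl G⟩

lemma IsParityReduction.sum [Finite V] [Finite W] {G R : SimpleGraph V} {H S : SimpleGraph W}
    (hG : IsParityReduction G R) (hH : IsParityReduction H S) :
    IsParityReduction (G ⊕g H) (R ⊕g S) :=
  ⟨sum_le_sum_iff.2 ⟨hG.le, hH.le⟩, hG.flipFree.sum hH.flipFree, hG.parityEq.sum hH.parityEq⟩

lemma IsParityReduction.mirror [Finite V] {K R : SimpleGraph V} (h : IsParityReduction K R)
    (r : V) : IsParityReduction (mirror K r) (R ⊕g R) where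
  le := (h.sum h).le.trans sum_le_mirror
  flipFree := (h.sum h).flipFree
  parityEq := (parityEq_mirror K r).trans (h.sum h).parityEq

lemma comap_symm_eq {G : SimpleGraph V} {G' : SimpleGraph W} (e : G ≃g G') :
    G.comap e.symm = G' := by
  ext a b
  exact e.symm.map_adj_iff

lemma IsParityReduction.of_iso [Finite V] [Finite W] {G R : SimpleGraph V} {G' : SimpleGraph W}
    (h : IsParityReduction G R) (e : G ≃g G') : IsParityReduction G' (R.comap e.symm) where
  le := (SimpleGraph.comap_monotone _ h.le).trans (comap_symm_eq e).le
  flipFree := h.flipFree.of_iso (Iso.comap e.symm.toEquiv R).symm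
  parityEq := by
    have h_comap := h.parityEq.comap e.symm.toEquiv
    rwa [show G.comap e.symm.toEquiv = G' from comap_symm_eq e] at h_comap

/-- `R` arises from the tree `G` by halving mirrored trees `i` times, until no flip is left. -/
structure IsTreeReduction [Finite V] (G R : SimpleGraph V) (i : ℕ) : Prop
    extends IsParityReduction G R where
  compCard_mul : ∀ v, compCard R v * 2 ^ i = Nat.card V
  eq_of_zero : i = 0 → R = G
  not_flipFree : i ≠ 0 → ¬ FlipFree G
  rigidAt : R = ⊥ → ∀ v, RigidAt G v

lemma isTreeReduction_refl [Finite V] {G : SimpleGraph V} (hG : G.Connected) (h : FlipFree G) :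
    IsTreeReduction G G 0 where
  toIsParityReduction := .refl h
  compCard_mul v := by rw [compCard_eq_of_connected hG, pow_zero, mul_one]
  eq_of_zero _ := rfl
  not_flipFree h_ne := absurd rfl h_ne
  rigidAt h_bot v φ _ u _ := by
    have h_eq (x y : V) : x = y := by
      have h_reach := hG.preconnected x y
      rwa [h_bot, reachable_bot] at h_reach
    exact h_eq _ _

lemma eq_bot_of_sum_eq_bot {R : SimpleGraph V} {S : SimpleGraph W} (h : R ⊕g S = ⊥) : R = ⊥ := by
  ext a b
  rw [← sum_adj_inl (H := S), h]
  simp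

lemma IsTreeReduction.mirror [Finite V] {K R : SimpleGraph V} {i : ℕ} (hK : K.Connected)
    (h : IsTreeReduction K R i) (r : V) : IsTreeReduction (mirror K r) (R ⊕g R) (i + 1) where
  toIsParityReduction := h.toIsParityReduction.mirror r
  compCard_mul v := by
    have h_card : compCard (R ⊕g R) v * 2 ^ i = Nat.card V := by
      rcases v with v | v
      · rw [compCard_inl, h.compCard_mul]
      · rw [compCard_inr, h.compCard_mul]
    rw [pow_succ, ← mul_assoc, h_card, Nat.card_sum, mul_two]
  eq_of_zero h_zero := absurd h_zero i.succ_ne_zero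
  not_flipFree _ := not_flipFree_mirror
  rigidAt h_bot := rigidAt_mirror hK (h.rigidAt (eq_bot_of_sum_eq_bot h_bot) r)

lemma RigidAt.of_iso {G : SimpleGraph V} {G' : SimpleGraph W} {v : V} (h : RigidAt G v)
    (e : G ≃g G') : RigidAt G' (e v) := by
  intro φ hφ u hu
  have h_reach : G.Reachable v (e.symm u) := by
    rwa [← Iso.reachable_iff (φ := e), e.apply_symm_apply]
  have h_fix := h ((e.trans φ).trans e.symm) (by simp [hφ]) (e.symm u) h_reach
  simpa using h_fix

lemma IsTreeReduction.of_iso [Finite V] [Finite W] {G R : SimpleGraph V} {G' : SimpleGraph W}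
    {i : ℕ} (h : IsTreeReduction G R i) (e : G ≃g G') :
    IsTreeReduction G' (R.comap e.symm) i where
  toIsParityReduction := h.toIsParityReduction.of_iso e
  compCard_mul v := by
    rw [← Nat.card_congr e.toEquiv, ← h.compCard_mul (e.symm v)]
    exact congrArg (· * 2 ^ i) (compCard_comap e.symm.toEquiv R v)
  eq_of_zero h_zero := by rw [h.eq_of_zero h_zero, comap_symm_eq]
  not_flipFree h_ne h_free := h.not_flipFree h_ne (h_free.of_iso e.symm)
  rigidAt h_bot v := by
    have hR : R = ⊥ := by
      ext a b
      have h_adj : (R.comap e.symm).Adj (e a) (e b) ↔ R.Adj a b := by simp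
      rw [← h_adj, h_bot, SimpleGraph.bot_adj, SimpleGraph.bot_adj]
    rw [← e.apply_symm_apply v]
    exact (h.rigidAt hR _).of_iso e

lemma exists_isTreeReduction {V : Type u} [Finite V] {G : SimpleGraph V} (hG : G.IsTree) :
    ∃ R i, IsTreeReduction G R i := by
  induction hn : Nat.card V using Nat.strong_induction_on generalizing V with
  | _ n ih =>
    subst hn
    by_cases h_free : FlipFree G
    · exact ⟨G, 0, isTreeReduction_refl hG.connected h_free⟩
    · obtain ⟨W, _, K, r, hK, ⟨e⟩⟩ := exists_mirror_iso hG h_free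
      have : Nonempty W := ⟨r⟩
      have h_card : Nat.card W < Nat.card V := by
        rw [← Nat.card_congr e.toEquiv, Nat.card_sum]
        exact Nat.lt_add_of_pos_left Nat.card_pos
      obtain ⟨R, i, hR⟩ := ih (Nat.card W) h_card hK rfl
      exact ⟨_, i + 1, (hR.mirror hK.connected r).of_iso e⟩

/-- Some automorphism exchanges the ends of an edge in the component of `p`. -/
def HasFlip (G : SimpleGraph V) (p : V) : Prop :=
  ∃ φ : G ≃g G, ∃ u w, G.Adj u w ∧ G.Reachable p u ∧ φ u = w ∧ φ w = u

/-- `R` is the union of tree reductions of the two sides of `T` without the edge `ab`, where `i`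
halvings are made on the side of `a` and `j` on the side of `b`. -/
structure IsDelReduction [Finite V] (T : SimpleGraph V) (a b : V) (R : SimpleGraph V) (i j : ℕ) :
    Prop extends IsParityReduction (del T a b) R where
  left : ∀ v, (del T a b).Reachable a v → compCard R v * 2 ^ i = compCard (del T a b) a
  right : ∀ v, (del T a b).Reachable b v → compCard R v * 2 ^ j = compCard (del T a b) b
  adj_of_zero : j = 0 → ∀ u w, (del T a b).Reachable b u → (del T a b).Adj u w → R.Adj u w
  hasFlip : j ≠ 0 → HasFlip (del T a b) b

lemma card_supp (G : SimpleGraph V) (x : V) :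
    Nat.card (G.connectedComponentMk x).supp = compCard G x :=
  Nat.card_congr (Equiv.subtypeEquivRight fun _ => mem_supp_iff_reachable)

lemma exists_isDelReduction [Finite V] {T : SimpleGraph V} {a b : V} (hT : T.IsTree)
    (hab : T.Adj a b) : ∃ R i j, IsDelReduction T a b R i j := by
  have h_tree (c) := isTree_induce_supp (isAcyclic_del hT.isAcyclic a b) c
  obtain ⟨e, he_left, he_right⟩ := exists_iso_sum (not_reachable_del_of_isAcyclic hT.isAcyclic hab)
    fun v => reachable_del (hT.connected.preconnected a v)
  obtain ⟨A, i, hA⟩ := exists_isTreeReduction (h_tree ((del T a b).connectedComponentMk a))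
  obtain ⟨B, j, hB⟩ := exists_isTreeReduction (h_tree ((del T a b).connectedComponentMk b))
  have h_left (v) (h : (del T a b).Reachable a v) :
      e.symm v = .inl ⟨v, mem_supp_iff_reachable.2 h⟩ := e.symm_apply_eq.2 (he_left ⟨v, _⟩).symm
  have h_right (v) (h : (del T a b).Reachable b v) :
      e.symm v = .inr ⟨v, mem_supp_iff_reachable.2 h⟩ := e.symm_apply_eq.2 (he_right ⟨v, _⟩).symm
  have h_card (v) : compCard ((A ⊕g B).comap e.symm) v = compCard (A ⊕g B) (e.symm v) :=
    compCard_comap e.symm.toEquiv _ v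
  refine ⟨_, i, j, (hA.toIsParityReduction.sum hB.toIsParityReduction).of_iso e, ?_, ?_, ?_, ?_⟩
  · intro v hv
    rw [h_card, h_left v hv, compCard_inl, hA.compCard_mul, card_supp]
  · intro v hv
    rw [h_card, h_right v hv, compCard_inr, hB.compCard_mul, card_supp]
  · intro h_zero u w hu huw
    rw [comap_adj, h_right u hu, h_right w (hu.trans huw.reachable), sum_adj_inr,
      hB.eq_of_zero h_zero]
    exact huw
  · intro h_ne
    have h_flip := hB.not_flipFree h_ne
    unfold FlipFree at h_flip
    push Not at h_flip
    obtain ⟨φ, u, w, huw, hφu, hφw⟩ := h_flip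
    have h_apply (z : ((del T a b).connectedComponentMk b).supp) :
        (e.symm.trans (Iso.sumCongr Iso.refl φ)).trans e z = φ z := by
      have hz := h_right z (mem_supp_iff_reachable.1 z.2)
      simp only [RelIso.trans_apply, hz]
      exact he_right (φ z)
    exact ⟨_, u, w, huw, mem_supp_iff_reachable.1 u.2, (h_apply u).trans (congrArg _ hφu),
      (h_apply w).trans (congrArg _ hφw)⟩

end Reduction

/-! ### Rooted isomorphisms and branches -/

section RootedIso

variable {V : Type*} {G G' G'' : SimpleGraph V} {p p' p'' : V} {φ ψ : Equiv.Perm V}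

/-- `φ` restricts to an isomorphism from the component of `p` in `G` onto the component of `p'` in
`G'` that sends `p` to `p'`. Its values outside the component of `p` are irrelevant. -/
structure IsRootedIso (G : SimpleGraph V) (p : V) (G' : SimpleGraph V) (p' : V)
    (φ : Equiv.Perm V) : Prop where
  map_root : φ p = p'
  adj_iff : ∀ u w, G.Reachable p u → (G.Adj u w ↔ G'.Adj (φ u) (φ w))

/-- The component of `p` in `G` and the component of `p'` in `G'` are isomorphic as rooted
graphs. -/
def RootedIso (G : SimpleGraph V) (p : V) (G' : SimpleGraph V) (p' : V) : Prop :=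
  ∃ φ : Equiv.Perm V, IsRootedIso G p G' p' φ

lemma IsRootedIso.reachable (h : IsRootedIso G p G' p' φ) {u : V} (hu : G.Reachable p u) :
    G'.Reachable p' (φ u) := by
  refine reachable_induction hu (P := fun u => G'.Reachable p' (φ u)) (by rw [h.map_root]) ?_
  intro u w hu ih huw
  exact ih.trans ((h.adj_iff u w hu).1 huw).reachable

lemma IsRootedIso.symm (h : IsRootedIso G p G' p' φ) : IsRootedIso G' p' G p φ.symm := by
  have h_root : φ.symm p' = p := by rw [← h.map_root]; exact φ.symm_apply_apply p
  have h_reach (u : V) (hu : G'.Reachable p' u) : G.Reachable p (φ.symm u) := by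
    refine reachable_induction hu (P := fun u => G.Reachable p (φ.symm u)) (by rw [h_root]) ?_
    intro u w _ ih huw
    refine ih.trans ((h.adj_iff _ (φ.symm w) ih).2 ?_).reachable
    simpa using huw
  refine ⟨h_root, fun u w hu => ?_⟩
  rw [h.adj_iff _ _ (h_reach u hu), Equiv.apply_symm_apply, Equiv.apply_symm_apply]

lemma IsRootedIso.trans (h : IsRootedIso G p G' p' φ) (h' : IsRootedIso G' p' G'' p'' ψ) :
    IsRootedIso G p G'' p'' (ψ * φ) := by
  refine ⟨by rw [Equiv.Perm.mul_apply, h.map_root, h'.map_root], fun u w hu => ?_⟩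
  rw [h.adj_iff u w hu, h'.adj_iff _ _ (h.reachable hu), Equiv.Perm.mul_apply,
    Equiv.Perm.mul_apply]

lemma IsRootedIso.change_root (h : IsRootedIso G p G' p' φ) {y : V} (hy : G.Reachable p y) :
    IsRootedIso G y G' (φ y) φ :=
  ⟨rfl, fun u w hu => h.adj_iff u w (hy.trans hu)⟩

lemma isRootedIso_of_iso (e : G ≃g G') (p : V) : IsRootedIso G p G' (e p) e.toEquiv :=
  ⟨rfl, fun _ _ _ => e.map_adj_iff.symm⟩

lemma IsRootedIso.compCard_eq (h : IsRootedIso G p G' p' φ) : compCard G p = compCard G' p' := by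
  have h_image : φ '' {w | G.Reachable p w} = {w | G'.Reachable p' w} := by
    ext w
    constructor
    · rintro ⟨u, hu, rfl⟩
      exact h.reachable hu
    · exact fun hw => ⟨φ.symm w, h.symm.reachable hw, φ.apply_symm_apply w⟩
  rw [compCard, compCard, ← h_image, Set.ncard_image_of_injective _ φ.injective]

lemma RootedIso.refl (G : SimpleGraph V) (p : V) : RootedIso G p G p :=
  ⟨1, rfl, fun _ _ _ => Iff.rfl⟩

lemma RootedIso.symm (h : RootedIso G p G' p') : RootedIso G' p' G p :=
  let ⟨_, h⟩ := h
  ⟨_, h.symm⟩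

lemma RootedIso.trans (h : RootedIso G p G' p') (h' : RootedIso G' p' G'' p'') :
    RootedIso G p G'' p'' :=
  let ⟨_, h⟩ := h
  let ⟨_, h'⟩ := h'
  ⟨_, h.trans h'⟩

lemma rootedIso_of_adj_iff (h : ∀ u w, G.Reachable p u → (G.Adj u w ↔ G'.Adj u w)) :
    RootedIso G p G' p :=
  ⟨1, rfl, h⟩

lemma RootedIso.compCard_eq (h : RootedIso G p G' p') : compCard G p = compCard G' p' :=
  let ⟨_, h⟩ := h
  h.compCard_eq

/-- The graph `G` with all edges at `p` deleted. The component in `cut G p` of a neighbour `y` of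
`p` is the branch of `G` at `p` that contains `y`. -/
def cut (G : SimpleGraph V) (p : V) : SimpleGraph V where
  Adj a b := G.Adj a b ∧ a ≠ p ∧ b ≠ p
  symm := ⟨fun _ _ h => ⟨h.1.symm, h.2.2, h.2.1⟩⟩
  loopless := ⟨fun _ h => G.irrefl h.1⟩

lemma cut_adj {a b : V} : (cut G p).Adj a b ↔ G.Adj a b ∧ a ≠ p ∧ b ≠ p := Iff.rfl

lemma cut_le : cut G p ≤ G := fun _ _ h => h.1

lemma cut_le_del (y : V) : cut G p ≤ del G p y := fun _ _ h =>
  del_adj.2 ⟨h.1, fun h' => h'.elim (fun h' => h.2.1 h'.1) fun h' => h.2.2 h'.2⟩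

lemma cut_del (a b : V) : cut (del G a b) p = del (cut G p) a b := by
  ext u w
  simp only [cut_adj, del_adj]
  tauto

lemma ne_of_cut_reachable {y u : V} (hy : y ≠ p) (h : (cut G p).Reachable y u) : u ≠ p :=
  reachable_induction h (P := fun u => u ≠ p) hy fun _ _ _ _ h => h.2.2

lemma not_cut_reachable {y : V} (hy : G.Adj p y) : ¬ (cut G p).Reachable y p := fun h =>
  ne_of_cut_reachable hy.ne' h rfl

lemma compCard_cut_lt [Finite V] {y : V} (hy : G.Adj p y) :
    compCard (cut G p) y < compCard G p :=
  compCard_lt (fun _ hw => hy.reachable.trans (hw.mono cut_le)) .rfl (not_cut_reachable hy)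

lemma IsRootedIso.isRootedIso_cut (h : IsRootedIso G p G' p' φ) {x y : V} (hx : G.Reachable p x)
    (hy : G.Adj x y) : IsRootedIso (cut G x) y (cut G' (φ x)) (φ y) φ := by
  refine ⟨rfl, fun u w hu => ?_⟩
  rw [cut_adj, cut_adj, h.adj_iff u w ((hx.trans hy.reachable).trans (hu.mono cut_le)),
    φ.injective.ne_iff, φ.injective.ne_iff]

lemma IsRootedIso.isRootedIso_del (h : IsRootedIso G p G' p' φ) {x y z : V}
    (hz : G.Reachable p z) : IsRootedIso (del G x y) z (del G' (φ x) (φ y)) (φ z) φ := by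
  refine ⟨rfl, fun u w hu => ?_⟩
  rw [del_adj, del_adj, h.adj_iff u w (hz.trans (hu.mono (del_le x y)))]
  simp only [φ.injective.eq_iff]

lemma exists_cut_reachable {u : V} (h : G.Reachable p u) (hu : u ≠ p) :
    ∃ y, G.Adj p y ∧ (cut G p).Reachable y u := by
  refine (reachable_induction h (P := fun u => u = p ∨ ∃ y, G.Adj p y ∧ (cut G p).Reachable y u)
    (Or.inl rfl) ?_).resolve_left hu
  intro a b _ ih hab
  by_cases hb : b = p
  · exact Or.inl hb
  by_cases ha : a = p
  · exact Or.inr ⟨b, ha ▸ hab, .rfl⟩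
  · obtain ⟨y, hy, hya⟩ := ih.resolve_left ha
    exact Or.inr ⟨y, hy, hya.trans (Adj.reachable ⟨hab, ha, hb⟩)⟩

lemma eq_of_cut_reachable (hG : G.IsAcyclic) {y y' : V} (hy : G.Adj p y) (hy' : G.Adj p y')
    (h : (cut G p).Reachable y y') : y = y' := by
  by_contra hne
  have h_adj : (del G p y).Adj p y' :=
    del_adj.2 ⟨hy', fun h' => h'.elim (fun h' => hne h'.2.symm) fun h' => hy.ne h'.1⟩
  exact not_reachable_del_of_isAcyclic hG hy
    (h_adj.reachable.trans (h.mono (cut_le_del y)).symm)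

lemma cut_reachable_of_del (hG : G.IsAcyclic) {y u : V} (hy : G.Adj p y)
    (h : (del G p y).Reachable y u) : (cut G p).Reachable y u := by
  refine reachable_induction h (P := fun u => (cut G p).Reachable y u) .rfl fun a b ha ih hab => ?_
  refine ih.trans (Adj.reachable ⟨del_le _ _ hab, ?_, ?_⟩)
  · rintro rfl
    exact not_reachable_del_of_isAcyclic hG hy ha.symm
  · rintro rfl
    exact not_reachable_del_of_isAcyclic hG hy (ha.trans hab.reachable).symm

/-- An automorphism of `cut G p` that fixes `p` and preserves the neighbours of `p` is an
automorphism of `G`. -/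
def isoOfCut (g : cut G p ≃g cut G p) (hp : g p = p) (h : ∀ u, G.Adj p (g u) ↔ G.Adj p u) :
    G ≃g G where
  toEquiv := g.toEquiv
  map_rel_iff' := by
    intro a b
    change G.Adj (g a) (g b) ↔ G.Adj a b
    by_cases ha : a = p
    · subst ha
      rw [hp]
      exact h b
    by_cases hb : b = p
    · subst hb
      rw [hp, G.adj_comm, G.adj_comm a]
      exact h a
    have h_ne (c : V) (hc : c ≠ p) : g c ≠ p := fun h' => hc (g.injective (h'.trans hp.symm))
    have h_cut := g.map_adj_iff (v := a) (w := b)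
    rw [cut_adj, cut_adj] at h_cut
    have := h_ne a ha
    have := h_ne b hb
    tauto

lemma RigidAt.rigidAt_cut [Finite V] (hG : G.IsAcyclic) (h : RigidAt G p) {y : V}
    (hy : G.Adj p y) : RigidAt (cut G p) y := by
  intro φ hφ u hu
  obtain ⟨g, hg_in, hg_out⟩ := exists_iso_of_local (G := cut G p) (x := y) φ (by rw [hφ])
    (fun _ _ _ _ h => φ.injective h) fun _ _ _ _ => φ.map_adj_iff.symm
  have hgp : g p = p := hg_out p (not_cut_reachable hy)
  have hgy : g y = y := (hg_in y .rfl).trans hφ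
  have h_nbr (w : V) : G.Adj p (g w) ↔ G.Adj p w := by
    by_cases hw : (cut G p).Reachable y w
    · have hgw : (cut G p).Reachable y (g w) := hgy ▸ (Iso.reachable_iff (φ := g)).2 hw
      constructor <;> intro h_adj
      · rwa [← g.injective (hgy.trans (eq_of_cut_reachable hG hy h_adj hgw))]
      · rwa [← eq_of_cut_reachable hG hy h_adj hw, hgy]
    · rw [hg_out w hw]
  rw [← hg_in u hu]
  exact h (isoOfCut g hgp h_nbr) hgp u (hy.reachable.trans (hu.mono cut_le))

lemma IsRootedIso.exists_involutive {y₁ y₂ : V} (h : IsRootedIso G y₁ G y₂ φ)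
    (hne : ¬ G.Reachable y₁ y₂) :
    ∃ f : V → V, Function.Involutive f ∧ (∀ u, G.Reachable y₁ u → f u = φ u) ∧
      (∀ u, G.Reachable y₂ u → f u = φ.symm u) ∧
      ∀ u, ¬ G.Reachable y₁ u → ¬ G.Reachable y₂ u → f u = u := by
  classical
  let f : V → V := fun u => if G.Reachable y₁ u then φ u else
    if G.Reachable y₂ u then φ.symm u else u
  have hf₁ (u : V) (hu : G.Reachable y₁ u) : f u = φ u := if_pos hu
  have hf₂ (u : V) (hu : G.Reachable y₂ u) : f u = φ.symm u :=
    (if_neg fun hu₁ : G.Reachable y₁ u => hne (hu₁.trans hu.symm)).trans (if_pos hu)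
  have hf_out (u : V) (hu₁ : ¬ G.Reachable y₁ u) (hu₂ : ¬ G.Reachable y₂ u) : f u = u :=
    (if_neg hu₁).trans (if_neg hu₂)
  refine ⟨f, fun u => ?_, hf₁, hf₂, hf_out⟩
  by_cases hu₁ : G.Reachable y₁ u
  · rw [hf₁ u hu₁, hf₂ _ (h.reachable hu₁), Equiv.symm_apply_apply]
  by_cases hu₂ : G.Reachable y₂ u
  · rw [hf₂ u hu₂, hf₁ _ (h.symm.reachable hu₂), Equiv.apply_symm_apply]
  · rw [hf_out u hu₁ hu₂, hf_out u hu₁ hu₂]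

lemma RootedIso.exists_swap {y₁ y₂ : V} (h : RootedIso G y₁ G y₂) (hne : ¬ G.Reachable y₁ y₂) :
    ∃ g : G ≃g G, g y₁ = y₂ ∧ Function.Involutive g ∧
      ∀ u, ¬ G.Reachable y₁ u → ¬ G.Reachable y₂ u → g u = u := by
  obtain ⟨φ, hφ⟩ := h
  obtain ⟨f, hf, hf₁, hf₂, hf_out⟩ := hφ.exists_involutive hne
  have h_adj (u w : V) (huw : G.Adj u w) : G.Adj (f u) (f w) := by
    by_cases hu₁ : G.Reachable y₁ u
    · rw [hf₁ u hu₁, hf₁ w (hu₁.trans huw.reachable)]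
      exact (hφ.adj_iff u w hu₁).1 huw
    by_cases hu₂ : G.Reachable y₂ u
    · rw [hf₂ u hu₂, hf₂ w (hu₂.trans huw.reachable)]
      exact (hφ.symm.adj_iff u w hu₂).1 huw
    · rwa [hf_out u hu₁ hu₂, hf_out w (fun h => hu₁ (h.trans huw.symm.reachable))
        fun h => hu₂ (h.trans huw.symm.reachable)]
  refine ⟨⟨hf.toPerm, fun {u w} => ⟨fun huw => ?_, h_adj u w⟩⟩, ?_, hf, hf_out⟩
  · have := h_adj _ _ huw
    rwa [hf.coe_toPerm, hf u, hf w] at this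
  · exact (hf₁ _ .rfl).trans hφ.map_root

lemma RigidAt.eq_of_rootedIso (hG : G.IsAcyclic) (h : RigidAt G p) {y₁ y₂ : V}
    (hy₁ : G.Adj p y₁) (hy₂ : G.Adj p y₂) (h_iso : RootedIso (cut G p) y₁ (cut G p) y₂) :
    y₁ = y₂ := by
  by_contra hne
  obtain ⟨g, hg, hg_inv, hg_out⟩ :=
    h_iso.exists_swap fun h' => hne (eq_of_cut_reachable hG hy₁ hy₂ h')
  have hgp : g p = p := hg_out p (not_cut_reachable hy₁) (not_cut_reachable hy₂)
  have h_nbr (u : V) (hu : G.Adj p u) : G.Adj p (g u) := by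
    by_cases hu₁ : (cut G p).Reachable y₁ u
    · rwa [← eq_of_cut_reachable hG hy₁ hu hu₁, hg]
    by_cases hu₂ : (cut G p).Reachable y₂ u
    · rwa [← eq_of_cut_reachable hG hy₂ hu hu₂, ← hg, hg_inv]
    · rwa [hg_out u hu₁ hu₂]
  have h_fix : g y₁ = y₁ :=
    h (isoOfCut g hgp fun u => ⟨fun hu => hg_inv u ▸ h_nbr _ hu, h_nbr u⟩) hgp y₁ hy₁.reachable
  exact hne (h_fix.symm.trans hg)

/-- The neighbours `y` of `p` whose branch has the property `Q` of rooted graphs. -/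
def branches (G : SimpleGraph V) (p : V) (Q : SimpleGraph V → V → Prop) : Set V :=
  {y | G.Adj p y ∧ Q (cut G p) y}

/-- A property of rooted graphs that depends only on the isomorphism type of the component of the
root. -/
def IsInvariantProperty (Q : SimpleGraph V → V → Prop) : Prop :=
  ∀ ⦃G p G' p'⦄, RootedIso G p G' p' → (Q G p ↔ Q G' p')

lemma isInvariantProperty_rootedIso (G : SimpleGraph V) (p : V) :
    IsInvariantProperty fun H q => RootedIso H q G p := fun _ _ _ _ h =>
  ⟨fun h' => h.symm.trans h', fun h' => h.trans h'⟩

variable {Q : SimpleGraph V → V → Prop}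

lemma RootedIso.ncard_branches_eq (hQ : IsInvariantProperty Q) (h : RootedIso G p G' p') :
    (branches G p Q).ncard = (branches G' p' Q).ncard := by
  obtain ⟨φ, hφ⟩ := h
  have h_mem (y : V) : φ y ∈ branches G' p' Q ↔ y ∈ branches G p Q := by
    rw [branches, branches, Set.mem_ofPred_eq, Set.mem_ofPred_eq, ← hφ.map_root,
      ← hφ.adj_iff p y .rfl]
    exact and_congr_right fun hy => (hQ ⟨φ, hφ.isRootedIso_cut .rfl hy⟩).symm
  have h_preimage : φ ⁻¹' branches G' p' Q = branches G p Q := Set.ext h_mem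
  rw [← h_preimage, Set.ncard_preimage_of_injective_subset_range φ.injective
    (by rw [φ.surjective.range_eq]; exact Set.subset_univ _)]

/-- `y` is the neighbour of `p` such that the edge `ab` lies in the branch of `y` or joins `p` to
it. -/
def IsBranchOf (G : SimpleGraph V) (p a b y : V) : Prop :=
  G.Adj p y ∧ (s(a, b) = s(p, y) ∨ ((cut G p).Adj a b ∧ (cut G p).Reachable y a))

lemma exists_isBranchOf {a b : V} (hab : G.Adj a b) (ha : G.Reachable p a) :
    ∃ y, IsBranchOf G p a b y := by
  by_cases hap : a = p
  · subst hap
    exact ⟨b, hab, Or.inl rfl⟩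
  by_cases hbp : b = p
  · subst hbp
    exact ⟨a, hab.symm, Or.inl Sym2.eq_swap⟩
  · obtain ⟨y, hy, hya⟩ := exists_cut_reachable ha hap
    exact ⟨y, hy, Or.inr ⟨⟨hab, hap, hbp⟩, hya⟩⟩

lemma IsBranchOf.del_adj_iff {a b y z : V} (h : IsBranchOf G p a b y) (hne : z ≠ y) :
    (del G a b).Adj p z ↔ G.Adj p z := by
  rw [del_adj, and_iff_left_iff_imp, ← Sym2.eq_iff]
  rintro - h_eq
  rcases h.2 with h_root | ⟨h_branch, -⟩
  · exact hne (Sym2.congr_right.1 (h_eq.trans h_root))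
  · rcases Sym2.eq_iff.1 h_eq with ⟨h_eq, -⟩ | ⟨h_eq, -⟩
    · exact h_branch.2.1 h_eq.symm
    · exact h_branch.2.2 h_eq.symm

lemma IsBranchOf.rootedIso_cut_del (hG : G.IsAcyclic) {a b y z : V} (h : IsBranchOf G p a b y)
    (hz : G.Adj p z) (hne : z ≠ y) : RootedIso (cut (del G a b) p) z (cut G p) z := by
  rw [cut_del]
  refine rootedIso_of_adj_iff fun u w hu => ?_
  have hzu := hu.mono (del_le a b)
  rw [del_adj, and_iff_left_iff_imp, ← Sym2.eq_iff]
  intro huw h_eq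
  rcases h.2 with h_root | ⟨h_branch, hya⟩
  · rcases Sym2.eq_iff.1 (h_eq.trans h_root) with ⟨rfl, -⟩ | ⟨-, rfl⟩
    · exact huw.2.1 rfl
    · exact huw.2.2 rfl
  · refine hne (eq_of_cut_reachable hG hz h.1 (hzu.trans ?_))
    rcases Sym2.eq_iff.1 h_eq with ⟨rfl, -⟩ | ⟨rfl, -⟩
    · exact hya.symm
    · exact (hya.trans h_branch.reachable).symm

lemma IsBranchOf.mem_branches_del_iff (hG : G.IsAcyclic) (hQ : IsInvariantProperty Q)
    {a b y z : V} (h : IsBranchOf G p a b y) (hne : z ≠ y) :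
    z ∈ branches (del G a b) p Q ↔ z ∈ branches G p Q := by
  rw [branches, branches, Set.mem_ofPred_eq, Set.mem_ofPred_eq, h.del_adj_iff hne]
  exact and_congr_right fun hz => hQ (h.rootedIso_cut_del hG hz hne)

lemma IsBranchOf.not_mem_branches_del [Finite V] (hG : G.IsAcyclic) {a b y : V}
    (h : IsBranchOf G p a b y) :
    y ∉ branches (del G a b) p fun H q => RootedIso H q (cut G p) y := by
  rintro ⟨h_adj, h_iso⟩
  rcases h.2 with h_root | ⟨h_branch, hya⟩
  · rw [del_adj, ← Sym2.eq_iff] at h_adj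
    exact h_adj.2 h_root.symm
  · have h_card := h_iso.compCard_eq
    rw [cut_del] at h_card
    have h_split := not_reachable_del_of_isAcyclic (hG.anti cut_le) h_branch
    have h_le (w : V) (hw : (del (cut G p) a b).Reachable y w) : (cut G p).Reachable y w :=
      hw.mono (del_le a b)
    by_cases ha : (del (cut G p) a b).Reachable y a
    · exact (compCard_lt h_le (hya.trans h_branch.reachable)
        fun hb => h_split (ha.symm.trans hb)).ne h_card
    · exact (compCard_lt h_le hya ha).ne h_card

lemma mem_iff_of_ncard_eq {α : Type*} [Finite α] {s t : Set α} {y : α} (h : s.ncard = t.ncard)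
    (hst : ∀ z ≠ y, z ∈ s ↔ z ∈ t) : y ∈ s ↔ y ∈ t := by
  constructor <;> intro hy <;> by_contra hy'
  · refine (Set.ncard_lt_ncard ⟨fun z hz => ?_, fun h => hy' (h hy)⟩ (Set.toFinite _)).ne' h
    exact (hst z fun h => hy' (h ▸ hz)).2 hz
  · refine (Set.ncard_lt_ncard ⟨fun z hz => ?_, fun h => hy' (h hy)⟩ (Set.toFinite _)).ne h
    exact (hst z fun h => hy' (h ▸ hz)).1 hz

lemma IsBranchOf.mem_branches_iff [Finite V] (hG : G.IsAcyclic) (hQ : IsInvariantProperty Q)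
    {a b c d y : V} (hab : IsBranchOf G p a b y) (hcd : IsBranchOf G p c d y)
    (h : RootedIso (del G a b) p (del G c d) p) :
    y ∈ branches (del G a b) p Q ↔ y ∈ branches (del G c d) p Q :=
  mem_iff_of_ncard_eq (h.ncard_branches_eq hQ) fun _ hz =>
    (hab.mem_branches_del_iff hG hQ hz).trans (hcd.mem_branches_del_iff hG hQ hz).symm

lemma IsBranchOf.eq_of_rootedIso_del [Finite V] (hG : G.IsAcyclic) (hr : RigidAt G p)
    {a b c d y z : V} (hab : IsBranchOf G p a b y) (hcd : IsBranchOf G p c d z)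
    (h : RootedIso (del G a b) p (del G c d) p) : y = z := by
  by_contra hne
  have hQ := isInvariantProperty_rootedIso (cut G p) z
  have h_mem : z ∈ branches (del G a b) p fun H q => RootedIso H q (cut G p) z :=
    (hab.mem_branches_del_iff hG hQ (Ne.symm hne)).2 ⟨hcd.1, .refl _ _⟩
  have h_empty : branches (del G c d) p (fun H q => RootedIso H q (cut G p) z) = ∅ := by
    refine Set.eq_empty_of_forall_notMem fun w hw => ?_
    have hwz : w ≠ z := fun h => hcd.not_mem_branches_del hG (h ▸ hw)
    obtain ⟨hpw, h_iso⟩ := (hcd.mem_branches_del_iff hG hQ hwz).1 hw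
    exact hwz (hr.eq_of_rootedIso hG hpw hcd.1 h_iso)
  have h_card := h.ncard_branches_eq hQ
  rw [h_empty, Set.ncard_empty, Set.ncard_eq_zero] at h_card
  exact Set.notMem_empty z (h_card ▸ h_mem)

/-- An isomorphism between the deletions matches the branches at `p` that were not affected, so by
rigidity both edges lie in one branch, and one may descend into it. -/
theorem RigidAt.eq_of_rootedIso_del [Finite V] (hG : G.IsAcyclic) (hr : RigidAt G p)
    {a b c d : V} (hab : G.Adj a b) (ha : G.Reachable p a) (hcd : G.Adj c d)
    (hc : G.Reachable p c) (h : RootedIso (del G a b) p (del G c d) p) : s(a, b) = s(c, d) := by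
  induction hn : compCard G p using Nat.strong_induction_on generalizing G p with
  | _ n ih =>
    subst hn
    obtain ⟨y, hy⟩ := exists_isBranchOf hab ha
    obtain ⟨z, hz⟩ := exists_isBranchOf hcd hc
    obtain rfl := hy.eq_of_rootedIso_del hG hr hz h
    have h_adj : (del G a b).Adj p y ↔ (del G c d).Adj p y := by
      simpa [branches] using hy.mem_branches_iff hG (Q := fun _ _ => True)
        (fun _ _ _ _ _ => Iff.rfl) hz h
    rw [del_adj, del_adj, ← Sym2.eq_iff, ← Sym2.eq_iff, and_congr_right_iff, not_iff_not] at h_adj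
    by_cases hab_root : s(a, b) = s(p, y)
    · rw [hab_root, h_adj hy.1 |>.1 hab_root.symm]
    have hcd_root : s(c, d) ≠ s(p, y) := fun h => hab_root ((h_adj hy.1).2 h.symm).symm
    obtain ⟨hab_cut, hya⟩ := hy.2.resolve_left hab_root
    obtain ⟨hcd_cut, hyc⟩ := hz.2.resolve_left hcd_root
    have h_mem : y ∈ branches (del G a b) p fun H q => RootedIso H q (cut (del G a b) p) y := by
      refine ⟨?_, .refl _ _⟩
      rw [del_adj, ← Sym2.eq_iff]
      exact ⟨hy.1, fun h => hab_root h.symm⟩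
    have h_iso := ((hy.mem_branches_iff hG (isInvariantProperty_rootedIso _ y) hz h).1 h_mem).2
    rw [cut_del, cut_del] at h_iso
    exact ih _ (compCard_cut_lt hy.1) (hG.anti cut_le) (hr.rigidAt_cut hG hy.1) hab_cut hya
      hcd_cut hyc h_iso.symm rfl

end RootedIso

/-! ### Recovering a deleted edge -/

section Centroid

variable {V : Type*} {G G' T : SimpleGraph V} {p p' q : V} {φ : Equiv.Perm V}

/-- No branch at `y` has more than half of the vertices of the component of `y`. -/
def IsCentroid (G : SimpleGraph V) (y : V) : Prop :=
  ∀ z, G.Adj y z → 2 * compCard (del G y z) z ≤ compCard G y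

lemma IsRootedIso.isCentroid (h : IsRootedIso G p G' p' φ) {y : V} (hy : G.Reachable p y)
    (hc : IsCentroid G y) : IsCentroid G' (φ y) := by
  intro z' hz'
  obtain ⟨z, rfl⟩ := φ.surjective z'
  have hz : G.Adj y z := (h.adj_iff y z hy).2 hz'
  rw [← (h.change_root hy).compCard_eq,
    ← (h.isRootedIso_del (x := y) (y := z) (hy.trans hz.reachable)).compCard_eq]
  exact hc z hz

lemma compCard_del_add [Finite V] (hG : G.IsAcyclic) {y z : V} (h : G.Adj y z) :
    compCard (del G y z) y + compCard (del G y z) z = compCard G y := by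
  have h_disj : Disjoint {w | (del G y z).Reachable y w} {w | (del G y z).Reachable z w} :=
    Set.disjoint_left.2 fun w (hy : (del G y z).Reachable y w) (hz : (del G y z).Reachable z w) =>
      not_reachable_del_of_isAcyclic hG h (hy.trans hz.symm)
  rw [compCard, compCard, ← Set.ncard_union_eq h_disj (Set.toFinite _) (Set.toFinite _)]
  refine congrArg Set.ncard (Set.ext fun w => ⟨?_, fun hw => reachable_del hw⟩)
  rintro (hw | hw)
  · exact Reachable.mono (del_le y z) hw
  · exact h.reachable.trans (Reachable.mono (del_le y z) hw)

lemma IsCentroid.adj [Finite V] (hG : G.IsAcyclic) {y v : V} (hy : IsCentroid G y)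
    (hv : IsCentroid G v) (hyv : G.Reachable y v) (hne : v ≠ y) :
    G.Adj y v ∧ 2 * compCard (del G y v) v = compCard G y := by
  obtain ⟨z, hz, hzv⟩ := exists_cut_reachable hyv hne
  obtain ⟨z', hz', hz'y⟩ := exists_cut_reachable hyv.symm hne.symm
  have h_split := not_reachable_del_of_isAcyclic hG hz
  have h_ne (c : V) (hc : (del G y z).Reachable y c) : c ≠ v := fun h =>
    h_split (hc.trans (h ▸ (hzv.mono (cut_le_del z)).symm))
  have h_sub (u : V) (hu : (del G y z).Reachable y u) : (del G v z').Reachable z' u := by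
    refine (hz'y.trans ?_).mono (cut_le_del z')
    exact reachable_induction hu (P := fun u => (cut G v).Reachable y u) .rfl fun a b ha ih hab =>
      ih.trans (Adj.reachable ⟨del_le _ _ hab, h_ne a ha, h_ne b (ha.trans hab.reachable)⟩)
  have h_add := compCard_del_add hG hz
  have hy_le := hy z hz
  have hv_le := hv z' hz'
  rw [← compCard_eq_of_reachable hyv] at hv_le
  by_cases hzv' : z = v
  · subst hzv'
    have := compCard_le h_sub
    exact ⟨hz, by omega⟩
  · have h_reach : (del G v z').Reachable z' z :=
      (hz'y.trans (Adj.reachable ⟨hz, hne.symm, hzv'⟩)).mono (cut_le_del z')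
    have := compCard_lt h_sub h_reach h_split
    omega

lemma reachable_del_of_reachable_del (hG : G.IsAcyclic) {x y z u : V} (hyz : G.Adj y z)
    (hzx : z ≠ x) (h : (del G y z).Reachable z u) : (del G x y).Reachable y u := by
  rw [del_comm x y]
  have h_adj : (del G y x).Adj y z :=
    del_adj.2 ⟨hyz, fun h => h.elim (fun h => hzx h.2) fun h => hyz.ne h.2.symm⟩
  exact h_adj.reachable.trans ((cut_reachable_of_del hG hyz h).mono (cut_le_del x))

lemma compCard_del_lt [Finite V] (hG : G.IsAcyclic) {x y z : V} (hyz : G.Adj y z) (hzx : z ≠ x) :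
    compCard (del G y z) z < compCard (del G x y) y :=
  compCard_lt (fun _ => reachable_del_of_reachable_del hG hyz hzx) .rfl fun h =>
    not_reachable_del_of_isAcyclic hG hyz h.symm

lemma reachable_del_del_iff {a b u w : V} (ha : ¬ (del T u w).Reachable w a)
    (hb : ¬ (del T u w).Reachable w b) (v : V) :
    (del (del T a b) u w).Reachable w v ↔ (del T u w).Reachable w v := by
  constructor
  · refine fun h => h.mono fun c d hcd => ?_
    rw [del_adj, del_adj] at hcd
    exact del_adj.2 ⟨hcd.1.1, hcd.2⟩
  · intro h
    refine reachable_induction h (P := fun v => (del (del T a b) u w).Reachable w v) .rfl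
      fun c d hc ih hcd => ih.trans (Adj.reachable ?_)
    rw [del_adj] at hcd
    refine del_adj.2 ⟨del_adj.2 ⟨hcd.1, ?_⟩, hcd.2⟩
    rintro (⟨rfl, -⟩ | ⟨rfl, -⟩)
    · exact ha hc
    · exact hb hc

lemma ne_of_flip (hG : G.IsAcyclic) (φ : G ≃g G) {u w y : V} (huw : G.Adj u w)
    (hu : φ u = w) (hw : φ w = u) (hy : G.Reachable u y) : φ y ≠ y := by
  intro h_fix
  have h_split := not_reachable_del_of_isAcyclic hG huw
  have h_move (z : V) (hz : (del G u w).Reachable z y) : (del G u w).Reachable (φ z) y := by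
    have : (del G (φ u) (φ w)).Reachable (φ z) (φ y) := (delIso φ u w).reachable_iff.2 hz
    rwa [hu, hw, del_comm, h_fix] at this
  rcases reachable_del (y := w) hy with hy | hy
  · exact h_split (hy.trans (hu ▸ h_move u hy).symm)
  · exact h_split ((hw ▸ h_move w hy).trans hy.symm)

/-- The edge `ab` avoids the side of `p` with respect to the edge `qp`, and its deletion leaves `N`
vertices in the component of `p`. -/
structure IsFarEdge (T : SimpleGraph V) (q p : V) (N : ℕ) (a b : V) : Prop where
  adj : T.Adj a b
  left : ¬ (del T q p).Reachable p a
  right : ¬ (del T q p).Reachable p b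
  card : compCard (del T a b) p = N

/-- The dart `x → y` on the side of `p` with respect to `qp` has more than `N / 2` vertices on the
side of `y`, and no dart further away from `q` has. In every component of `p` with `N` vertices
left by a far edge, `y` is then a centroid. -/
structure IsExtremalDart (T : SimpleGraph V) (q p : V) (N : ℕ) (x y : V) : Prop where
  adj : T.Adj x y
  side : ∀ u, (del T x y).Reachable y u → (del T q p).Reachable p u
  lt : N < 2 * compCard (del T x y) y
  le : ∀ z, T.Adj y z → z ≠ x → 2 * compCard (del T y z) z ≤ N

/-- The vertex `v ≠ x` is a neighbour of `y` whose side has `N / 2` vertices. -/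
structure IsHalvingNeighbor (T : SimpleGraph V) (N : ℕ) (x y v : V) : Prop where
  adj : T.Adj y v
  ne : v ≠ x
  card : 2 * compCard (del T y v) v = N

variable {N : ℕ} {a b c d x y v w : V}

lemma exists_isExtremalDart [Finite V] (hT : T.IsAcyclic) (hqp : T.Adj q p)
    (hN : N < 2 * compCard (del T q p) p) : ∃ x y, IsExtremalDart T q p N x y := by
  induction hn : compCard (del T q p) p using Nat.strong_induction_on generalizing q p with
  | _ n ih =>
    subst hn
    by_cases h : ∀ z, T.Adj p z → z ≠ q → 2 * compCard (del T p z) z ≤ N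
    · exact ⟨q, p, hqp, fun _ h => h, hN, h⟩
    · push Not at h
      obtain ⟨z, hz, hzq, hzN⟩ := h
      obtain ⟨x, y, hxy⟩ := ih _ (compCard_del_lt hT hz hzq) hz hzN rfl
      exact ⟨x, y, hxy.adj,
        fun u hu => reachable_del_of_reachable_del hT hz hzq (hxy.side u hu), hxy.lt, hxy.le⟩

lemma IsFarEdge.reachable (h : IsFarEdge T q p N a b) {u : V}
    (hu : (del T q p).Reachable p u) : (del T a b).Reachable p u := by
  refine reachable_induction hu (P := fun u => (del T a b).Reachable p u) .rfl
    fun c d hc ih hcd => ih.trans (Adj.reachable (del_adj.2 ⟨del_le _ _ hcd, ?_⟩))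
  rintro (⟨rfl, -⟩ | ⟨rfl, -⟩)
  · exact h.left hc
  · exact h.right hc

lemma IsFarEdge.compCard_del_del (he : IsFarEdge T q p N a b)
    (h : ∀ u, (del T v w).Reachable w u → (del T q p).Reachable p u) :
    compCard (del (del T a b) v w) w = compCard (del T v w) w :=
  compCard_congr (reachable_del_del_iff (fun h' => he.left (h _ h')) fun h' => he.right (h _ h'))

lemma IsExtremalDart.side_of_adj (hT : T.IsAcyclic) (h : IsExtremalDart T q p N x y)
    (hv : T.Adj y v) (hvx : v ≠ x) (u : V) (hu : (del T y v).Reachable v u) :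
    (del T q p).Reachable p u :=
  h.side u (reachable_del_of_reachable_del hT hv hvx hu)

lemma IsExtremalDart.reachable (h : IsExtremalDart T q p N x y) (he : IsFarEdge T q p N a b) :
    (del T a b).Reachable p y :=
  he.reachable (h.side y .rfl)

lemma IsExtremalDart.adj_del (h : IsExtremalDart T q p N x y) (he : IsFarEdge T q p N a b)
    (hv : T.Adj y v) : (del T a b).Adj y v := by
  refine del_adj.2 ⟨hv, ?_⟩
  rintro (⟨rfl, -⟩ | ⟨rfl, -⟩)
  · exact he.left (h.side _ .rfl)
  · exact he.right (h.side _ .rfl)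

lemma IsExtremalDart.compCard_eq (h : IsExtremalDart T q p N x y) (he : IsFarEdge T q p N a b) :
    compCard (del T a b) y = N :=
  (compCard_eq_of_reachable (h.reachable he)).symm.trans he.card

lemma IsExtremalDart.two_mul_compCard_lt [Finite V] (hT : T.IsAcyclic)
    (h : IsExtremalDart T q p N x y) (he : IsFarEdge T q p N a b) (hx : (del T a b).Adj y x) :
    2 * compCard (del (del T a b) y x) x < N := by
  have h_add := compCard_del_add (isAcyclic_del hT a b) hx
  rw [h.compCard_eq he, del_comm y x, he.compCard_del_del h.side] at h_add
  have := h.lt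
  rw [del_comm y x]
  omega

lemma IsExtremalDart.isCentroid [Finite V] (hT : T.IsAcyclic) (h : IsExtremalDart T q p N x y)
    (he : IsFarEdge T q p N a b) : IsCentroid (del T a b) y := by
  intro z hz
  rw [h.compCard_eq he]
  by_cases hzx : z = x
  · subst hzx
    exact (h.two_mul_compCard_lt hT he hz).le
  · have hz' := del_le _ _ hz
    rw [he.compCard_del_del (h.side_of_adj hT hz' hzx)]
    exact h.le z hz' hzx

lemma IsExtremalDart.isHalvingNeighbor [Finite V] (hT : T.IsAcyclic)
    (h : IsExtremalDart T q p N x y) (he : IsFarEdge T q p N a b)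
    (hv : IsCentroid (del T a b) v) (hyv : (del T a b).Reachable y v) (hne : v ≠ y) :
    IsHalvingNeighbor T N x y v := by
  obtain ⟨h_adj, h_card⟩ := (h.isCentroid hT he).adj (isAcyclic_del hT a b) hv hyv hne
  rw [h.compCard_eq he] at h_card
  have hvx : v ≠ x := by
    rintro rfl
    exact (h.two_mul_compCard_lt hT he h_adj).ne h_card
  have h_adj' := del_le _ _ h_adj
  rw [he.compCard_del_del (h.side_of_adj hT h_adj' hvx)] at h_card
  exact ⟨h_adj', hvx, h_card⟩

lemma IsHalvingNeighbor.compCard_del_del (hT : T.IsAcyclic) (h : IsExtremalDart T q p N x y)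
    (he : IsFarEdge T q p N a b) (hv : IsHalvingNeighbor T N x y v) :
    2 * compCard (del (del T a b) y v) v = N := by
  rw [he.compCard_del_del (h.side_of_adj hT hv.adj hv.ne), hv.card]

lemma IsHalvingNeighbor.unique [Finite V] (hT : T.IsAcyclic) (h : IsExtremalDart T q p N x y)
    (he : IsFarEdge T q p N a b) (hv : IsHalvingNeighbor T N x y v)
    (hw : IsHalvingNeighbor T N x y w) : v = w := by
  by_contra hne
  have hF := isAcyclic_del hT a b
  have h_add := compCard_del_add hF (h.adj_del he hv.adj)
  have h_lt := compCard_del_lt hF (x := v) (h.adj_del he hw.adj) (Ne.symm hne)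
  have hv_card := hv.compCard_del_del hT h he
  have hw_card := hw.compCard_del_del hT h he
  rw [h.compCard_eq he] at h_add
  rw [del_comm v y] at h_lt
  omega

/-- A rooted isomorphism between the components left by two far edges either fixes the centroid `y`
or exchanges the ends of the edge that halves both components. -/
lemma IsExtremalDart.exists_exchange [Finite V] (hT : T.IsAcyclic)
    (h : IsExtremalDart T q p N x y) (he : IsFarEdge T q p N a b) (he' : IsFarEdge T q p N c d)
    (hφ : IsRootedIso (del T a b) p (del T c d) p' φ) (hp : (del T c d).Reachable p p')
    (hy : φ y ≠ y) : IsHalvingNeighbor T N x y (φ y) ∧ φ (φ y) = y := by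
  have hpy := h.reachable he
  have hF := isAcyclic_del hT c d
  have hv : IsHalvingNeighbor T N x y (φ y) :=
    h.isHalvingNeighbor hT he' (hφ.isCentroid hpy (h.isCentroid hT he))
      (((h.reachable he').symm.trans hp).trans (hφ.reachable hpy)) hy
  refine ⟨hv, ?_⟩
  by_contra hne
  have h_adj : (del T a b).Adj y (φ y) := h.adj_del he hv.adj
  have h_adj' : (del T c d).Adj (φ y) (φ (φ y)) := (hφ.adj_iff _ _ hpy).1 h_adj
  have h_card := (hφ.isRootedIso_del (x := y) (y := φ y)
    (hpy.trans h_adj.reachable)).compCard_eq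
  have h_lt := compCard_del_lt hF h_adj' hne
  have := hv.compCard_del_del hT h he
  have := hv.compCard_del_del hT h he'
  omega

lemma IsFarEdge.cut_adj_and_reachable (hT : T.IsTree) (he : IsFarEdge T q p N a b)
    (hv : T.Adj y v) (h_side : ∀ u, (del T y v).Reachable v u → (del T q p).Reachable p u) :
    (cut T v).Adj a b ∧ (cut T v).Reachable y a := by
  have ha : ¬ (del T y v).Reachable v a := fun h => he.left (h_side a h)
  have hb : ¬ (del T y v).Reachable v b := fun h => he.right (h_side b h)
  refine ⟨⟨he.adj, fun h => ha (h ▸ .rfl), fun h => hb (h ▸ .rfl)⟩,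
    cut_reachable_of_del hT.isAcyclic hv.symm ?_⟩
  rw [del_comm v y]
  exact (reachable_del (hT.connected.preconnected y a)).resolve_right ha

lemma IsFarEdge.rootedIso_cut (he : IsFarEdge T q p N a b)
    (h_side : ∀ u, (del T y v).Reachable v u → (del T q p).Reachable p u) :
    RootedIso (cut (del T a b) y) v (cut T y) v := by
  rw [cut_del]
  refine rootedIso_of_adj_iff fun u w hu => ?_
  have hu_side := h_side u ((hu.mono (del_le a b)).mono (cut_le_del v))
  rw [del_adj, and_iff_left_iff_imp]
  rintro - (⟨rfl, -⟩ | ⟨rfl, -⟩)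
  · exact he.left hu_side
  · exact he.right hu_side

/-- The branch of `y` at the halving neighbor `v` is isomorphic to the branch of `v` at `y`, which
no far edge meets; so the deletion of either edge from the branch of `y` gives the same rooted
tree. -/
lemma IsExtremalDart.eq_of_rootedIso_cut [Finite V] (hT : T.IsTree) (hr : ∀ z, RigidAt T z)
    (h : IsExtremalDart T q p N x y) (he : IsFarEdge T q p N a b) (he' : IsFarEdge T q p N c d)
    (hv : IsHalvingNeighbor T N x y v)
    (h_iso : RootedIso (cut (del T a b) v) y (cut T y) v)
    (h_iso' : RootedIso (cut (del T c d) v) y (cut T y) v) : s(a, b) = s(c, d) := by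
  have h_side := h.side_of_adj hT.isAcyclic hv.adj hv.ne
  obtain ⟨hab, hya⟩ := he.cut_adj_and_reachable hT hv.adj h_side
  obtain ⟨hcd, hyc⟩ := he'.cut_adj_and_reachable hT hv.adj h_side
  have h_del := h_iso.trans h_iso'.symm
  rw [cut_del, cut_del] at h_del
  exact ((hr v).rigidAt_cut hT.isAcyclic hv.adj.symm).eq_of_rootedIso_del
    (hT.isAcyclic.anti cut_le) hab hya hcd hyc h_del

lemma IsRootedIso.rootedIso_cut_of_exchange (hφ : IsRootedIso G p G' p' φ)
    (hy : G.Reachable p y) (hyv : G.Adj y v) (hφy : φ y = v) (hφv : φ v = y) :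
    RootedIso (cut G v) y (cut G' y) v := by
  have := hφ.isRootedIso_cut (hy.trans hyv.reachable) hyv.symm
  rw [hφy, hφv] at this
  exact ⟨φ, this⟩

theorem IsFarEdge.eq_of_isRootedIso [Finite V] (hT : T.IsTree) (hr : ∀ z, RigidAt T z)
    (hqp : T.Adj q p) (hN : N < 2 * compCard (del T q p) p) (he : IsFarEdge T q p N a b)
    (he' : IsFarEdge T q p N c d) (hφ : IsRootedIso (del T a b) p (del T c d) p' φ)
    (hp : (del T c d).Reachable p p') : s(a, b) = s(c, d) := by
  have hA := hT.isAcyclic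
  obtain ⟨x, y, h⟩ := exists_isExtremalDart hA hqp hN
  have hpy := h.reachable he
  by_cases hy : φ y = y
  · have h_root := hφ.change_root hpy
    rw [hy] at h_root
    exact (hr y).eq_of_rootedIso_del hA he.adj (hT.connected.preconnected _ _) he'.adj
      (hT.connected.preconnected _ _) ⟨φ, h_root⟩
  · obtain ⟨hv, hφv⟩ := h.exists_exchange hA he he' hφ hp hy
    have h_side := h.side_of_adj hA hv.adj hv.ne
    refine h.eq_of_rootedIso_cut hT hr he he' hv ?_ ?_
    · exact (hφ.rootedIso_cut_of_exchange hpy (h.adj_del he hv.adj) rfl hφv).trans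
        (he'.rootedIso_cut h_side)
    · exact (hφ.symm.rootedIso_cut_of_exchange (hp.symm.trans (h.reachable he'))
        (h.adj_del he' hv.adj) (φ.symm_apply_eq.2 hφv.symm) (φ.symm_apply_apply y)).trans
        (he.rootedIso_cut h_side)

lemma IsExtremalDart.exists_isHalvingNeighbor_of_hasFlip [Finite V] (hT : T.IsAcyclic)
    (h : IsExtremalDart T q p N x y) (he : IsFarEdge T q p N a b) (hf : HasFlip (del T a b) p) :
    ∃ v, IsHalvingNeighbor T N x y v ∧ RootedIso (cut (del T a b) v) y (cut T y) v := by
  obtain ⟨φ, u, w, huw, hpu, hu, hw⟩ := hf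
  have hpy := h.reachable he
  have hy : φ y ≠ y := ne_of_flip (isAcyclic_del hT a b) φ huw hu hw (hpu.symm.trans hpy)
  have hpp : (del T a b).Reachable p (φ p) := by
    have : (del T a b).Reachable (φ p) (φ u) := (Iso.reachable_iff (φ := φ)).2 hpu
    rw [hu] at this
    exact (hpu.trans huw.reachable).trans this.symm
  have hφ := isRootedIso_of_iso φ p
  obtain ⟨hv, hφv⟩ := h.exists_exchange hT he he hφ hpp hy
  exact ⟨_, hv, (hφ.rootedIso_cut_of_exchange hpy (h.adj_del he hv.adj) rfl hφv).trans
    (he.rootedIso_cut (h.side_of_adj hT hv.adj hv.ne))⟩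

theorem IsFarEdge.eq_of_hasFlip [Finite V] (hT : T.IsTree) (hr : ∀ z, RigidAt T z)
    (hqp : T.Adj q p) (hN : N < 2 * compCard (del T q p) p) (he : IsFarEdge T q p N a b)
    (he' : IsFarEdge T q p N c d) (hf : HasFlip (del T a b) p) (hf' : HasFlip (del T c d) p) :
    s(a, b) = s(c, d) := by
  obtain ⟨x, y, h⟩ := exists_isExtremalDart hT.isAcyclic hqp hN
  obtain ⟨v, hv, h_iso⟩ := h.exists_isHalvingNeighbor_of_hasFlip hT.isAcyclic he hf
  obtain ⟨v', hv', h_iso'⟩ := h.exists_isHalvingNeighbor_of_hasFlip hT.isAcyclic he' hf'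
  obtain rfl := hv.unique hT.isAcyclic h he hv'
  exact h.eq_of_rootedIso_cut hT hr he he' hv h_iso h_iso'

end Centroid

section OddDeletion

variable {V : Type*} {T R R' : SimpleGraph V} {p q a b c d : V} {i j i' j' k : ℕ}

/-- The edge `ab` avoids the side of `p` with respect to the edge `qp`, and `b` is its end nearer to
`p`. -/
structure IsFarDart (T : SimpleGraph V) (q p a b : V) : Prop where
  adj : T.Adj a b
  left : ¬ (del T q p).Reachable p a
  right : ¬ (del T q p).Reachable p b
  reachable : (del T a b).Reachable b p

lemma exists_isFarDart (hT : T.Connected) (hab : T.Adj a b) (ha : ¬ (del T q p).Reachable p a)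
    (hb : ¬ (del T q p).Reachable p b) : ∃ x y, s(x, y) = s(a, b) ∧ IsFarDart T q p x y := by
  rcases reachable_del (y := b) (hT.preconnected a p) with h | h
  · exact ⟨b, a, Sym2.eq_swap, hab.symm, hb, ha, del_comm a b ▸ h⟩
  · exact ⟨a, b, rfl, hab, ha, hb, h⟩

lemma IsFarDart.isFarEdge (h : IsFarDart T q p a b) :
    IsFarEdge T q p (compCard (del T a b) b) a b :=
  ⟨h.adj, h.left, h.right, (compCard_eq_of_reachable h.reachable).symm⟩

lemma IsFarDart.compCard_lt [Finite V] (h : IsFarDart T q p a b) (hT : T.IsTree)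
    (hqp : T.Adj q p) (h_half : 2 * compCard (del T q p) p = Nat.card V) :
    compCard (del T a b) a < compCard (del T a b) b := by
  have h_adj : (del T a b).Adj p q := by
    refine del_adj.2 ⟨hqp.symm, ?_⟩
    rintro (⟨rfl, -⟩ | ⟨rfl, -⟩)
    · exact h.left .rfl
    · exact h.right .rfl
  have h_lt := ImpartialDigraph.compCard_lt (fun _ => h.isFarEdge.reachable) h_adj.reachable
    fun h => not_reachable_del_of_isAcyclic hT.isAcyclic hqp h.symm
  have h_add := compCard_del_add hT.isAcyclic h.adj
  rw [h.isFarEdge.card] at h_lt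
  rw [compCard_eq_of_connected hT.connected] at h_add
  omega

lemma eq_of_mul_two_pow_add {a i j k : ℕ} (h : a * 2 ^ i + a * 2 ^ j = 2 ^ k) : i = j := by
  have not_lt_of_add {i j : ℕ} (h : a * 2 ^ i + a * 2 ^ j = 2 ^ k) : ¬ i < j := by
    intro hij
    obtain ⟨d, rfl⟩ := Nat.exists_eq_add_of_lt hij
    have h_dvd : (1 + 2 ^ (d + 1)) ∣ 2 ^ k := ⟨a * 2 ^ i, by rw [← h]; ring⟩
    obtain ⟨m, -, hm⟩ := (Nat.dvd_prime_pow Nat.prime_two).1 h_dvd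
    rcases m with _ | m
    · have : 0 < 2 ^ (d + 1) := by positivity
      omega
    · rw [pow_succ, pow_succ] at hm
      omega
  exact le_antisymm (not_lt.1 (not_lt_of_add (by rwa [add_comm] at h)))
    (not_lt.1 (not_lt_of_add h))

namespace IsDelReduction

variable [Finite V]

lemma compCard_left (h : IsDelReduction T a b R i j) {v : V} (hv : (del T a b).Reachable a v) :
    compCard R v = compCard R a :=
  Nat.eq_of_mul_eq_mul_right (by positivity : 0 < 2 ^ i) ((h.left v hv).trans (h.left a .rfl).symm)

lemma compCard_right (h : IsDelReduction T a b R i j) {v : V} (hv : (del T a b).Reachable b v) :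
    compCard R v = compCard R b :=
  Nat.eq_of_mul_eq_mul_right (by positivity : 0 < 2 ^ j)
    ((h.right v hv).trans (h.right b .rfl).symm)

/-- If both reduced components had size `c`, then `c * 2 ^ i + c * 2 ^ j` would be a power of two,
so that `i = j` and both sides of `ab` would have the same size. -/
lemma compCard_ne (h : IsDelReduction T a b R i j) (hT : T.IsTree) (hab : T.Adj a b)
    (hk : Nat.card V = 2 ^ k) (hlt : compCard (del T a b) a < compCard (del T a b) b) :
    compCard R a ≠ compCard R b := by
  intro h_eq
  have h_left := h.left a .rfl
  have h_right := h.right b .rfl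
  have h_add := compCard_del_add hT.isAcyclic hab
  rw [compCard_eq_of_connected hT.connected, hk, ← h_left, ← h_right, h_eq] at h_add
  rw [h_eq, eq_of_mul_two_pow_add h_add, h_right] at h_left
  exact hlt.ne' h_left

lemma ne_bot (h : IsDelReduction T a b R i j) (hT : T.IsTree) (hab : T.Adj a b)
    (hk : Nat.card V = 2 ^ k) (hlt : compCard (del T a b) a < compCard (del T a b) b) :
    R ≠ ⊥ := by
  rintro rfl
  exact h.compCard_ne hT hab hk hlt (by rw [compCard_bot, compCard_bot])

lemma reachable_left_iff (h : IsDelReduction T a b R i j) (hT : T.IsTree) (hab : T.Adj a b)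
    (hk : Nat.card V = 2 ^ k) (hlt : compCard (del T a b) a < compCard (del T a b) b) {v : V} :
    (del T a b).Reachable a v ↔ compCard R v = compCard R a :=
  ⟨h.compCard_left, fun hv =>
    (reachable_del (hT.connected.preconnected a v)).resolve_right fun h_right =>
      h.compCard_ne hT hab hk hlt (hv.symm.trans (h.compCard_right h_right))⟩

lemma reachable_right_iff (h : IsDelReduction T a b R i j) (hT : T.IsTree) (hab : T.Adj a b)
    (hk : Nat.card V = 2 ^ k) (hlt : compCard (del T a b) a < compCard (del T a b) b) {v : V} :
    (del T a b).Reachable b v ↔ compCard R v = compCard R b :=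
  ⟨h.compCard_right, fun hv =>
    (reachable_del (hT.connected.preconnected a v)).resolve_left fun h_left =>
      h.compCard_ne hT hab hk hlt ((h.compCard_left h_left).symm.trans hv)⟩

end IsDelReduction

lemma ncard_compCard_eq_of_iso (e : R ≃g R') (n : ℕ) :
    {v | compCard R v = n}.ncard = {v | compCard R' v = n}.ncard :=
  Set.ncard_congr (fun v _ => e v) (fun v hv => (compCard_apply_iso e v).trans hv)
    (fun _ _ _ _ h => e.injective h) fun v hv =>
      ⟨e.symm v, (compCard_apply_iso e.symm v).trans hv, e.apply_symm_apply v⟩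

/-- The larger side of the deleted edge can be read off from the component sizes of the
reduction. -/
lemma IsDelReduction.right_eq_of_iso [Finite V] (h : IsDelReduction T a b R i j)
    (h' : IsDelReduction T c d R' i' j') (e : R ≃g R') (hT : T.IsTree) (hk : Nat.card V = 2 ^ k)
    (hab : T.Adj a b) (hlt : compCard (del T a b) a < compCard (del T a b) b)
    (hcd : T.Adj c d) (hlt' : compCard (del T c d) c < compCard (del T c d) d) :
    compCard R b = compCard R' d ∧ compCard (del T a b) b = compCard (del T c d) d ∧ j = j' := by
  have ncard_right : {v | compCard R v = compCard R b}.ncard = compCard (del T a b) b :=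
    congrArg Set.ncard (Set.ext fun _ => (h.reachable_right_iff hT hab hk hlt).symm)
  have ncard_left' : {v | compCard R' v = compCard R' c}.ncard = compCard (del T c d) c :=
    congrArg Set.ncard (Set.ext fun _ => (h'.reachable_left_iff hT hcd hk hlt').symm)
  have ncard_right' : {v | compCard R' v = compCard R' d}.ncard = compCard (del T c d) d :=
    congrArg Set.ncard (Set.ext fun _ => (h'.reachable_right_iff hT hcd hk hlt').symm)
  rw [ncard_compCard_eq_of_iso e] at ncard_right
  have h_add := compCard_del_add hT.isAcyclic hab
  have h_add' := compCard_del_add hT.isAcyclic hcd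
  rw [compCard_eq_of_connected hT.connected] at h_add h_add'
  have h_right : compCard R b = compCard R' d := by
    rw [← compCard_apply_iso e b, ← h'.reachable_right_iff hT hcd hk hlt']
    refine (reachable_del (hT.connected.preconnected c (e b))).resolve_left fun h_left => ?_
    rw [← compCard_apply_iso e b, h'.compCard_left h_left] at ncard_right
    omega
  have h_size : compCard (del T a b) b = compCard (del T c d) d := by
    rw [← ncard_right, ← ncard_right', h_right]
  refine ⟨h_right, h_size, ?_⟩
  have h_pow := h.right b .rfl
  rw [h_size, ← h'.right d .rfl, h_right] at h_pow
  exact Nat.pow_right_injective le_rfl (Nat.eq_of_mul_eq_mul_left (compCard_pos _ _) h_pow)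

lemma HasFlip.of_reachable {G : SimpleGraph V} (h : HasFlip G b) (hbp : G.Reachable b p) :
    HasFlip G p :=
  let ⟨φ, u, w, huw, hbu, hu, hw⟩ := h
  ⟨φ, u, w, huw, hbp.symm.trans hbu, hu, hw⟩

lemma IsDelReduction.isRootedIso_del [Finite V] (h : IsDelReduction T a b R i 0)
    (h' : IsDelReduction T c d R' i' 0) (e : R ≃g R') (hbp : (del T a b).Reachable b p)
    (h_side : ∀ v, (del T a b).Reachable b v → (del T c d).Reachable d (e v)) :
    IsRootedIso (del T a b) p (del T c d) (e p) e.toEquiv :=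
  ⟨rfl, fun u w hu =>
    ⟨fun huw => h'.le (e.map_adj_iff.2 (h.adj_of_zero rfl u w (hbp.trans hu) huw)),
      fun huw => h.le (e.map_adj_iff.1 (h'.adj_of_zero rfl _ _ (h_side u (hbp.trans hu)) huw))⟩⟩

theorem IsDelReduction.eq_of_iso [Finite V] (h : IsDelReduction T a b R i j)
    (h' : IsDelReduction T c d R' i' j') (e : R ≃g R') (hT : T.IsTree)
    (hr : ∀ z, RigidAt T z) (hk : Nat.card V = 2 ^ k) (hqp : T.Adj q p)
    (h_half : 2 * compCard (del T q p) p = Nat.card V) (hab : IsFarDart T q p a b)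
    (hcd : IsFarDart T q p c d) : s(a, b) = s(c, d) := by
  have hlt := hab.compCard_lt hT hqp h_half
  have hlt' := hcd.compCard_lt hT hqp h_half
  obtain ⟨h_right, h_size, rfl⟩ := h.right_eq_of_iso h' e hT hk hab.adj hlt hcd.adj hlt'
  have h_far' : IsFarEdge T q p (compCard (del T a b) b) c d := h_size ▸ hcd.isFarEdge
  have hN : compCard (del T a b) b < 2 * compCard (del T q p) p := by
    have h_add := compCard_del_add hT.isAcyclic hab.adj
    have h_pos := compCard_pos (del T a b) a
    rw [compCard_eq_of_connected hT.connected] at h_add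
    omega
  obtain rfl | hj := eq_or_ne j 0
  · have h_side (v) (hv : (del T a b).Reachable b v) : (del T c d).Reachable d (e v) := by
      rw [h'.reachable_right_iff hT hcd.adj hk hlt', compCard_apply_iso, ← h_right]
      exact h.compCard_right hv
    exact hab.isFarEdge.eq_of_isRootedIso hT hr hqp hN h_far'
      (h.isRootedIso_del h' e hab.reachable h_side)
      (hcd.reachable.symm.trans (h_side p hab.reachable))
  · exact hab.isFarEdge.eq_of_hasFlip hT hr hqp hN h_far'
      ((h.hasFlip hj).of_reachable hab.reachable) ((h'.hasFlip hj).of_reachable hcd.reachable)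

lemma eq_of_le_of_ncard_le [Finite V] {F G : SimpleGraph V} (h : F ≤ G)
    (h_card : G.edgeSet.ncard ≤ F.edgeSet.ncard) : F = G :=
  edgeSet_injective (Set.eq_of_subset_of_ncard_le (edgeSet_subset_edgeSet.2 h) h_card
    (Set.toFinite _))

lemma ncard_edgeSet_eq_of_iso {F G : SimpleGraph V} (e : F ≃g G) :
    F.edgeSet.ncard = G.edgeSet.ncard :=
  Nat.card_congr e.mapEdgeSet

open Classical in
/-- The number of spanning subgraphs of `G` isomorphic to `F`. -/
noncomputable def copies [Finite V] (F G : SimpleGraph V) : ℕ :=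
  #{F' ∈ spanningSubgraphs G | Nonempty (F' ≃g F)}

lemma ParityEq.copies_eq [Finite V] {F G R : SimpleGraph V} (h : ParityEq G R)
    (hF : FlipFree F) : (copies F G : ZMod 2) = copies F R := by
  classical
  have h_sum := h (fun F' => if Nonempty (F' ≃g F) then 1 else 0)
    (fun _ _ ⟨φ⟩ => if_congr ⟨fun ⟨e⟩ => ⟨φ.symm.trans e⟩, fun ⟨e⟩ => ⟨φ.trans e⟩⟩ rfl rfl)
    fun _ hF' => if_neg fun ⟨e⟩ => hF' (hF.of_iso e.symm)
  rwa [Finset.sum_boole, Finset.sum_boole] at h_sum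

lemma copies_self [Finite V] (R : SimpleGraph V) : copies R R = 1 := by
  classical
  refine Finset.card_eq_one.2 ⟨R, Finset.ext fun F => ?_⟩
  rw [Finset.mem_filter, mem_spanningSubgraphs, Finset.mem_singleton]
  constructor
  · rintro ⟨h_le, ⟨φ⟩⟩
    exact eq_of_le_of_ncard_le h_le (ncard_edgeSet_eq_of_iso φ).ge
  · rintro rfl
    exact ⟨le_rfl, ⟨Iso.refl⟩⟩

lemma copies_eq_zero [Finite V] (h_card : R'.edgeSet.ncard ≤ R.edgeSet.ncard)
    (h : IsEmpty (R' ≃g R)) : copies R R' = 0 := by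
  classical
  refine Finset.card_eq_zero.2 (Finset.filter_eq_empty_iff.2 ?_)
  rintro F hF ⟨φ⟩
  obtain rfl := eq_of_le_of_ncard_le (mem_spanningSubgraphs.1 hF)
    (h_card.trans (ncard_edgeSet_eq_of_iso φ).ge)
  exact h.elim φ

/-- Among the pairwise non-isomorphic reductions, one with the most edges is a copy of itself and
of a subgraph of no other. -/
theorem exists_odd_copies [Finite V] {ι : Type*} {B : Finset ι} (hB : B.Nonempty)
    {G R : ι → SimpleGraph V} (hR : ∀ e ∈ B, FlipFree (R e))
    (h_parity : ∀ e ∈ B, ParityEq (G e) (R e))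
    (h_inj : ∀ e ∈ B, ∀ e' ∈ B, Nonempty (R e ≃g R e') → e = e') :
    ∃ e ∈ B, Odd (∑ e' ∈ B, copies (R e) (G e')) := by
  obtain ⟨e, he, h_max⟩ := B.exists_max_image (fun e => (R e).edgeSet.ncard) hB
  have h_zero (e') (he' : e' ∈ B) (hne : e' ≠ e) : (copies (R e) (R e') : ZMod 2) = 0 := by
    rw [copies_eq_zero (h_max e' he') ⟨fun φ => hne (h_inj e' he' e he ⟨φ⟩)⟩, Nat.cast_zero]
  refine ⟨e, he, ZMod.natCast_eq_one_iff_odd.1 ?_⟩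
  rw [Nat.cast_sum, Finset.sum_congr rfl fun e' he' => (h_parity e' he').copies_eq (hR e he),
    Finset.sum_eq_single_of_mem e he h_zero, copies_self, Nat.cast_one]

end OddDeletion

section Orientation

variable {V : Type*}

/-- A set of ordered pairs that orients the edges of `F` and is invariant under automorphisms. -/
structure IsInvariantOrientation (F : SimpleGraph V) (I : Finset (V × V)) : Prop where
  adj_iff : ∀ x y, F.Adj x y ↔ (x, y) ∈ I ∨ (y, x) ∈ I
  asymm : ∀ x y, (x, y) ∈ I → (y, x) ∉ I
  map : ∀ (φ : F ≃g F) x y, (x, y) ∈ I → (φ x, φ y) ∈ I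

/-- In a flip-free graph, reversal acts on the orbits of the darts without fixed points; so an
arbitrary linear order of the orbits selects one dart of each edge. -/
lemma FlipFree.exists_isInvariantOrientation [Finite V] {F : SimpleGraph V} (h : FlipFree F) :
    ∃ I, IsInvariantOrientation F I := by
  classical
  have := Fintype.ofFinite V
  let orbit (p : V × V) : MulAction.orbitRel.Quotient (F ≃g F) (V × V) := Quotient.mk'' p
  have orbit_map (φ : F ≃g F) (x y : V) : orbit (φ x, φ y) = orbit (x, y) :=
    Quotient.sound' ⟨φ, rfl⟩
  have orbit_swap_ne {x y : V} (hxy : F.Adj x y) : orbit (x, y) ≠ orbit (y, x) := fun h_eq => by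
    obtain ⟨φ, hφ⟩ := Quotient.exact' h_eq.symm
    exact h φ x y hxy (congrArg Prod.fst hφ) (congrArg Prod.snd hφ)
  refine ⟨univ.filter fun p => F.Adj p.1 p.2 ∧ WellOrderingRel (orbit p) (orbit p.swap),
    ?_, ?_, ?_⟩ <;> simp only [mem_filter_univ, Prod.swap_prod_mk]
  · intro x y
    constructor
    · intro hxy
      rcases trichotomous_of WellOrderingRel (orbit (x, y)) (orbit (y, x)) with h_lt | h_eq | h_gt
      · exact Or.inl ⟨hxy, h_lt⟩
      · exact absurd h_eq (orbit_swap_ne hxy)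
      · exact Or.inr ⟨hxy.symm, h_gt⟩
    · rintro (h | h)
      · exact h.1
      · exact h.1.symm
  · exact fun x y h h' => asymm_of WellOrderingRel h.2 h'.2
  · intro φ x y
    rw [orbit_map φ x y, orbit_map φ y x, φ.map_adj_iff]
    exact id

variable {F F' T G : SimpleGraph V} {I : Finset (V × V)} {s : V → V → ℤ}

lemma IsInvariantOrientation.map_iff (h : IsInvariantOrientation F I) (φ : F ≃g F) (x y : V) :
    (φ x, φ y) ∈ I ↔ (x, y) ∈ I := by
  refine ⟨fun h' => ?_, h.map φ x y⟩
  have h_symm := h.map φ.symm _ _ h'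
  rwa [φ.symm_apply_apply, φ.symm_apply_apply] at h_symm

open Classical in
/-- The product of the signs of the edges of the copy `F'` of `F`, oriented according to `I`. If
`F'` is not isomorphic to `F`, it is `0`. -/
noncomputable def signProd (F : SimpleGraph V) (I : Finset (V × V)) (s : V → V → ℤ)
    (F' : SimpleGraph V) : ℤ :=
  if h : Nonempty (F ≃g F') then ∏ p ∈ I, s (h.some p.1) (h.some p.2) else 0

lemma IsInvariantOrientation.signProd_eq (h : IsInvariantOrientation F I) (s : V → V → ℤ)
    (e : F ≃g F') : signProd F I s F' = ∏ p ∈ I, s (e p.1) (e p.2) := by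
  have h_iso : Nonempty (F ≃g F') := ⟨e⟩
  rw [signProd, dif_pos h_iso]
  let φ : F ≃g F := h_iso.some.trans e.symm
  have he (x : V) : e (φ x) = h_iso.some x := e.apply_symm_apply _
  refine Finset.prod_equiv (φ.toEquiv.prodCongr φ.toEquiv) (fun p => (h.map_iff φ p.1 p.2).symm)
    fun p _ => ?_
  rw [← he, ← he]
  rfl

lemma signProd_of_isEmpty (I : Finset (V × V)) (s : V → V → ℤ) (h : ¬ Nonempty (F ≃g F')) :
    signProd F I s F' = 0 := dif_neg h

/-- An antisymmetric function that is supported on the edges of `T`, where its values are `1` and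
`-1`. -/
structure IsSign (T : SimpleGraph V) (s : V → V → ℤ) : Prop where
  eq_zero : ∀ x y, ¬ T.Adj x y → s x y = 0
  eq_one_or : ∀ x y, T.Adj x y → s x y = 1 ∨ s x y = -1
  antisymm : ∀ x y, s x y = -s y x

lemma IsInvariantOrientation.signProd_eq_one_or (h : IsInvariantOrientation F I)
    (hs : IsSign T s) (hF : F' ≤ T) (e : F ≃g F') :
    signProd F I s F' = 1 ∨ signProd F I s F' = -1 := by
  rw [h.signProd_eq s e]
  refine Finset.prod_induction _ (fun x => x = 1 ∨ x = -1) ?_ (Or.inl rfl) ?_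
  · rintro a b (rfl | rfl) (rfl | rfl) <;> simp
  · intro p hp
    exact hs.eq_one_or _ _ (hF (e.map_adj_iff.2 ((h.adj_iff _ _).2 (Or.inl hp))))

lemma IsInvariantOrientation.signProd_eq_zero (h : IsInvariantOrientation F I)
    (hs : IsSign T s) (hF : ¬ F' ≤ T) : signProd F I s F' = 0 := by
  by_cases h_iso : Nonempty (F ≃g F')
  · obtain ⟨e⟩ := h_iso
    rw [h.signProd_eq s e, Finset.prod_eq_zero_iff]
    contrapose! hF
    have adj_of_mem (p : V × V) (hp : p ∈ I) : T.Adj (e p.1) (e p.2) :=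
      not_not.1 fun h_adj => hF p hp (hs.eq_zero _ _ h_adj)
    intro a b hab
    rw [← e.apply_symm_apply a, ← e.apply_symm_apply b]
    rcases (h.adj_iff _ _).1 (e.symm.map_adj_iff.2 hab) with h_mem | h_mem
    · exact adj_of_mem _ h_mem
    · exact (adj_of_mem _ h_mem).symm
  · exact signProd_of_isEmpty I s h_iso

lemma comap_perm_symm_eq_iff (π : Equiv.Perm V) :
    F.comap π.symm = F' ↔ ∀ {x y}, F'.Adj (π x) (π y) ↔ F.Adj x y := by
  constructor
  · rintro rfl x y
    rw [comap_adj, π.symm_apply_apply, π.symm_apply_apply]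
  · intro h
    exact comap_symm_eq (⟨π, h⟩ : F ≃g F')

lemma card_filter_comap_perm_eq [Fintype V] [DecidableEq V] [DecidableEq (SimpleGraph V)]
    (e : F ≃g F') : #{π : Equiv.Perm V | F.comap π.symm = F'} = Nat.card (F ≃g F) := by
  rw [← Fintype.card_subtype, ← Nat.card_eq_fintype_card]
  exact Nat.card_congr
    { toFun := fun π => RelIso.trans ⟨π.1, (comap_perm_symm_eq_iff π.1).1 π.2⟩ e.symm
      invFun := fun φ => ⟨(φ.trans e).toEquiv, comap_symm_eq (φ.trans e)⟩
      left_inv := fun π => Subtype.ext (Equiv.ext fun x => e.apply_symm_apply _)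
      right_inv := fun φ => RelIso.ext fun x => e.symm_apply_apply _ }

lemma IsInvariantOrientation.sum_perm [Fintype V] [DecidableEq V]
    (h : IsInvariantOrientation F I) (hs : IsSign T s) :
    ∑ π : Equiv.Perm V, ∏ p ∈ I, s (π p.1) (π p.2) =
      Nat.card (F ≃g F) * ∑ F' ∈ spanningSubgraphs T, signProd F I s F' := by
  classical
  have prod_eq (π : Equiv.Perm V) :
      ∏ p ∈ I, s (π p.1) (π p.2) = signProd F I s (F.comap π.symm) :=
    (h.signProd_eq s ⟨π, (comap_perm_symm_eq_iff π).1 rfl⟩).symm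
  have sum_fiber (F' : SimpleGraph V) :
      ∑ π : Equiv.Perm V with F.comap π.symm = F', ∏ p ∈ I, s (π p.1) (π p.2) =
        Nat.card (F ≃g F) * signProd F I s F' := by
    rw [Finset.sum_congr rfl fun π hπ => (prod_eq π).trans
      (congrArg (signProd F I s) (Finset.mem_filter.1 hπ).2), Finset.sum_const, nsmul_eq_mul]
    by_cases h_iso : Nonempty (F ≃g F')
    · rw [card_filter_comap_perm_eq h_iso.some]
    · rw [signProd_of_isEmpty I s h_iso, mul_zero, mul_zero]
  rw [← Finset.sum_fiberwise (g := fun π : Equiv.Perm V => F.comap π.symm),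
    Finset.sum_congr rfl fun F' _ => sum_fiber F', ← Finset.mul_sum]
  congr 1
  exact (Finset.sum_subset (Finset.subset_univ _) fun F' _ hF' =>
    h.signProd_eq_zero hs (mt mem_spanningSubgraphs.2 hF')).symm

open Classical in
lemma IsInvariantOrientation.sum_signProd [Finite V] (h : IsInvariantOrientation F I)
    (hs : IsSign T s) (hG : G ≤ T) :
    ∑ F' ∈ spanningSubgraphs G, signProd F I s F' =
      copies F G - 2 * (#{F' ∈ spanningSubgraphs G | signProd F I s F' = -1} : ℤ) := by
  have signProd_eq_sub (F') (hF' : F' ∈ spanningSubgraphs G) : signProd F I s F' =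
      (if Nonempty (F' ≃g F) then 1 else 0) - 2 * if signProd F I s F' = -1 then 1 else 0 := by
    by_cases h_iso : Nonempty (F' ≃g F)
    · obtain ⟨e⟩ := h_iso
      rw [if_pos ⟨e⟩]
      rcases h.signProd_eq_one_or hs ((mem_spanningSubgraphs.1 hF').trans hG) e.symm with
        h_sign | h_sign <;> rw [h_sign] <;> norm_num
    · rw [if_neg h_iso, signProd_of_isEmpty I s fun ⟨e⟩ => h_iso ⟨e.symm⟩]
      norm_num
  rw [Finset.sum_congr rfl signProd_eq_sub, Finset.sum_sub_distrib, ← Finset.mul_sum,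
    Finset.sum_boole, Finset.sum_boole, copies]

end Orientation

section SignSums

variable {V : Type*} {H : Digraph V}

lemma isSign_arcSign (hH : H.IsOriented) : IsSign H.toSimpleGraphInclusive (arcSign H) where
  eq_zero x y h := by
    obtain rfl | hxy := eq_or_ne x y
    · exact sub_self _
    · rw [toSimpleGraphInclusive_adj, not_and] at h
      have h_not := not_or.1 (h hxy)
      rw [arcSign, if_neg h_not.1, if_neg h_not.2, sub_self]
  eq_one_or x y h := by
    rw [toSimpleGraphInclusive_adj] at h
    rcases h.2 with hxy | hyx
    · exact Or.inl (by rw [arcSign, if_pos hxy, if_neg (hH x y hxy), sub_zero])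
    · exact Or.inr (by rw [arcSign, if_neg (hH y x hyx), if_pos hyx, zero_sub])
  antisymm := arcSign_antisymm H

/-- The antisymmetric indicator function of a set of ordered pairs. -/
def pairSign [DecidableEq V] (J : Finset (V × V)) (q : V × V) : ℤ :=
  (if q ∈ J then 1 else 0) - if q.swap ∈ J then 1 else 0

lemma one_add_pairSign [DecidableEq V] {J : Finset (V × V)} (hJ : ∀ q ∈ J, q.swap ∉ J)
    (q : V × V) : 1 + pairSign J q = (if q ∈ J then 2 else 1) * if q.swap ∈ J then 0 else 1 := by
  unfold pairSign
  by_cases hq : q ∈ J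
  · simp [hq, hJ q hq]
  · by_cases hq' : q.swap ∈ J <;> simp [hq, hq']

/-- If no pair of `J` is reversed in `A`, then both sides are `2 ^ #(A ∩ J)`; otherwise both are
`0`. -/
lemma prod_pairSign_comm [DecidableEq V] {A J : Finset (V × V)} (hA : ∀ q ∈ A, q.swap ∉ A)
    (hJ : ∀ q ∈ J, q.swap ∉ J) :
    ∏ q ∈ A, (1 + pairSign J q) = ∏ q ∈ J, (1 + pairSign A q) := by
  have prod_swap (A J : Finset (V × V)) : ∏ q ∈ A, (if q.swap ∈ J then (0 : ℤ) else 1) =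
      if ∃ q ∈ A, q.swap ∈ J then 0 else 1 := by
    split_ifs with h
    · obtain ⟨q, hq, hq'⟩ := h
      exact prod_eq_zero hq (if_pos hq')
    · push Not at h
      exact prod_eq_one fun q hq => if_neg (h q hq)
  have exists_swap_comm : (∃ q ∈ A, q.swap ∈ J) ↔ ∃ q ∈ J, q.swap ∈ A :=
    ⟨fun ⟨q, hq, hq'⟩ => ⟨q.swap, hq', q.swap_swap.symm ▸ hq⟩,
      fun ⟨q, hq, hq'⟩ => ⟨q.swap, hq', q.swap_swap.symm ▸ hq⟩⟩
  simp only [one_add_pairSign hA, one_add_pairSign hJ, prod_mul_distrib, prod_ite_mem, prod_swap,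
    exists_swap_comm, inter_comm A J]

lemma homWeight_pairSign [Finite V] [DecidableEq V] (hH : H.IsOriented) {J : Finset (V × V)}
    (hJ : ∀ q ∈ J, q.swap ∉ J) (π : Equiv.Perm V) :
    homWeight H (fun x y => pairSign J (x, y)) π =
      ∏ q ∈ J, (1 + arcSign H (π.symm q.1) (π.symm q.2)) := by
  classical
  have := Fintype.ofFinite V
  let A := (arcs H).map (π.prodCongr π).toEmbedding
  have mem_A (q : V × V) : q ∈ A ↔ H.Adj (π.symm q.1) (π.symm q.2) := by
    rw [mem_map_equiv, mem_arcs]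
    rfl
  have pairSign_A (q : V × V) : arcSign H (π.symm q.1) (π.symm q.2) = pairSign A q :=
    congrArg₂ (fun x y : ℤ => x - y) (if_congr (mem_A q).symm rfl rfl)
      (if_congr (mem_A q.swap).symm rfl rfl)
  have hA (q) (hq : q ∈ A) : q.swap ∉ A := fun hq' =>
    hH _ _ ((mem_A q).1 hq) ((mem_A q.swap).1 hq')
  simp only [pairSign_A]
  rw [← prod_pairSign_comm hA hJ, prod_map, homWeight_eq_prod_arcs]
  rfl

/-- The signs of the arcs of a balanced digraph are uncorrelated under permutations. -/
theorem Balanced.sum_prod_arcSign [Fintype V] [DecidableEq V] (h : Balanced H)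
    (hH : H.IsOriented) {I : Finset (V × V)} (hI : ∀ q ∈ I, q.swap ∉ I) (h_ne : I.Nonempty) :
    ∑ π : Equiv.Perm V, ∏ q ∈ I, arcSign H (π q.1) (π q.2) = 0 := by
  have sum_one_add (J) (hJ : J ⊆ I) :
      ∑ π : Equiv.Perm V, ∏ q ∈ J, (1 + arcSign H (π q.1) (π q.2)) =
        ((Fintype.card V).factorial : ℤ) := by
    have hJ' (q) (hq : q ∈ J) : q.swap ∉ J := fun hq' => hI q (hJ hq) (hJ hq')
    rw [← h.sum_perm (f := fun x y => pairSign J (x, y)) fun x y => (neg_sub _ _).symm,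
      ← Equiv.sum_comp (Equiv.inv (Equiv.Perm V))]
    exact sum_congr rfl fun π _ => (homWeight_pairSign hH hJ' π).symm
  have prod_expand (π : Equiv.Perm V) : ∏ q ∈ I, arcSign H (π q.1) (π q.2) =
      ∑ J ∈ I.powerset, (∏ q ∈ J, (1 + arcSign H (π q.1) (π q.2))) * ∏ q ∈ I \ J, (-1) := by
    rw [← prod_add]
    exact prod_congr rfl fun q _ => by ring
  obtain ⟨q, hq⟩ := h_ne
  calc ∑ π : Equiv.Perm V, ∏ q ∈ I, arcSign H (π q.1) (π q.2)
      = ∑ J ∈ I.powerset, ((Fintype.card V).factorial : ℤ) * ∏ q ∈ I \ J, (-1) := by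
        rw [sum_congr rfl fun π _ => prod_expand π, sum_comm]
        exact sum_congr rfl fun J hJ => by rw [← sum_mul, sum_one_add J (mem_powerset.1 hJ)]
    _ = ((Fintype.card V).factorial : ℤ) * ∏ q ∈ I, (1 + -1) := by
        rw [← mul_sum, prod_add]
        simp only [prod_const_one, one_mul]
    _ = 0 := by rw [prod_eq_zero hq (add_neg_cancel 1), mul_zero]

theorem Balanced.sum_signProd [Finite V] (h : Balanced H) (hH : H.IsOriented)
    {F : SimpleGraph V} {I : Finset (V × V)} (hI : IsInvariantOrientation F I) (hF : F ≠ ⊥) :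
    ∑ F' ∈ spanningSubgraphs H.toSimpleGraphInclusive, signProd F I (arcSign H) F' = 0 := by
  classical
  have := Fintype.ofFinite V
  have h_ne : I.Nonempty := by
    rw [nonempty_iff_ne_empty]
    rintro rfl
    refine hF (eq_bot_iff.2 fun x y hxy => ?_)
    simp [hI.adj_iff] at hxy
  have h_sum := hI.sum_perm (isSign_arcSign hH)
  rw [h.sum_prod_arcSign hH (fun q hq => hI.asymm _ _ hq) h_ne] at h_sum
  have h_aut : (Nat.card (F ≃g F) : ℤ) ≠ 0 := by
    have : Finite (F ≃g F) := Finite.of_injective _ RelIso.toEquiv_injective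
    have : Nonempty (F ≃g F) := ⟨Iso.refl⟩
    exact_mod_cast Nat.card_pos.ne'
  exact (mul_eq_zero.1 h_sum.symm).resolve_left h_aut

theorem Balanced.even_copies [Finite V] (h : Balanced H) (hH : H.IsOriented)
    {F : SimpleGraph V} (hF : FlipFree F) (hF_bot : F ≠ ⊥) :
    Even (copies F H.toSimpleGraphInclusive) := by
  classical
  obtain ⟨I, hI⟩ := hF.exists_isInvariantOrientation
  have h_sum := h.sum_signProd hH hI hF_bot
  rw [hI.sum_signProd (isSign_arcSign hH) le_rfl] at h_sum
  rw [Nat.even_iff]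
  omega

lemma isTournament_of_injective {α : Type*} [LinearOrder α] {f : V → α}
    (hf : Function.Injective f) : (⟨fun x y => f x < f y⟩ : Digraph V).IsTournament :=
  ⟨fun _ => lt_irrefl _, fun _ _ hxy =>
    (hf.ne hxy).lt_or_gt.imp (fun h => ⟨h, h.not_gt⟩) fun h => ⟨h, h.not_gt⟩⟩

lemma Balanced.two_pow_dvd_factorial [Fintype V] (h : Balanced H) (hH : H.IsOriented) :
    2 ^ #(arcs H) ∣ (Fintype.card V).factorial := by
  classical
  let K : Digraph V := ⟨fun x y => Fintype.equivFin V x < Fintype.equivFin V y⟩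
  have hK : K.IsTournament := isTournament_of_injective (Fintype.equivFin V).injective
  have h_dvd : (2 : ℤ) ^ #(arcs H) ∣ ((Fintype.card V).factorial : ℤ) := by
    rw [← h.sum_perm (arcSign_antisymm K)]
    refine dvd_sum fun π _ => ?_
    have := homWeight_arcSign hH hK π.toEmbedding
    rw [Equiv.coe_toEmbedding] at this
    rw [this]
    split_ifs
    · exact dvd_rfl
    · exact dvd_zero _
  exact_mod_cast h_dvd

lemma card_edgeSet_le_card_arcs [Fintype V] (H : Digraph V) :
    Nat.card H.toSimpleGraphInclusive.edgeSet ≤ #(arcs H) := by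
  classical
  have h_sub : H.toSimpleGraphInclusive.edgeSet ⊆
      ((arcs H).image fun p => s(p.1, p.2) : Finset (Sym2 V)) := by
    intro e
    induction e with
    | _ x y =>
      intro hxy
      rw [mem_edgeSet, toSimpleGraphInclusive_adj] at hxy
      rw [mem_coe, mem_image]
      rcases hxy.2 with h | h
      · exact ⟨(x, y), mem_arcs.2 h, rfl⟩
      · exact ⟨(y, x), mem_arcs.2 h, Sym2.eq_swap⟩
  calc Nat.card H.toSimpleGraphInclusive.edgeSet
      ≤ #((arcs H).image fun p => s(p.1, p.2)) := by
        rw [Nat.card_coe_set_eq, ← Set.ncard_coe_finset]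
        exact Set.ncard_le_ncard h_sub (Set.toFinite _)
    _ ≤ #(arcs H) := card_image_le

/-- Each term of `Balanced.sum_perm` for a transitive tournament is divisible by two to the number
of arcs, whereas `n!` is not divisible by `2 ^ n`. -/
theorem Balanced.isTree [Finite V] (h : Balanced H) (hH : H.IsOriented)
    (h_conn : H.toSimpleGraphInclusive.Connected) : H.toSimpleGraphInclusive.IsTree := by
  have := Fintype.ofFinite V
  have := h_conn.nonempty
  have h_lt : #(arcs H) < Fintype.card V := by
    exact_mod_cast (le_emultiplicity_of_pow_dvd (h.two_pow_dvd_factorial hH)).trans_lt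
      (Nat.emultiplicity_two_factorial_lt Fintype.card_ne_zero)
  have h_arcs := card_edgeSet_le_card_arcs H
  have h_edges := h_conn.card_vert_le_card_edgeSet_add_one
  refine isTree_iff_connected_and_card.2 ⟨h_conn, ?_⟩
  rw [Nat.card_eq_fintype_card (α := V)] at h_edges ⊢
  omega

end SignSums

/-! ### Copies in a disjoint union of two equal graphs -/

section CopiesOfSum

variable {W : Type*} [Finite W] {K : SimpleGraph W} {F : SimpleGraph (W ⊕ W)}

lemma sum_spanningSubgraphs_bot {V : Type*} [Finite V] {A : Type*} [AddCommMonoid A]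
    (M : SimpleGraph V → A) : ∑ F ∈ spanningSubgraphs (⊥ : SimpleGraph V), M F = M ⊥ := by
  have h_bot : spanningSubgraphs (⊥ : SimpleGraph V) = {⊥} := by
    ext F
    rw [mem_spanningSubgraphs, mem_singleton, le_bot_iff]
  rw [h_bot, sum_singleton]

lemma nonempty_iso_congr {V V' : Type*} {G G' : SimpleGraph V} {S : SimpleGraph V'}
    (e : G ≃g G') : Nonempty (G ≃g S) ↔ Nonempty (G' ≃g S) :=
  ⟨fun ⟨φ⟩ => ⟨e.symm.trans φ⟩, fun ⟨φ⟩ => ⟨e.trans φ⟩⟩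

lemma not_nonempty_bot_sum_bot_iso {W : Type*} {F : SimpleGraph (W ⊕ W)} (hF : F ≠ ⊥) :
    ¬ Nonempty ((⊥ : SimpleGraph W) ⊕g (⊥ : SimpleGraph W) ≃g F) := by
  rintro ⟨e⟩
  refine hF (SimpleGraph.ext ?_)
  ext a b
  rw [← e.symm.map_adj_iff]
  rcases e.symm a with u | u <;> rcases e.symm b with v | v <;> simp

open Classical in
/-- The number of spanning subgraphs of `K` whose disjoint union with `F₂` is isomorphic to `F`. -/
noncomputable def leftCopies (K : SimpleGraph W) (F : SimpleGraph (W ⊕ W))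
    (F₂ : SimpleGraph W) : ℕ :=
  #{F' ∈ spanningSubgraphs K | Nonempty (F' ⊕g F₂ ≃g F)}

lemma copies_sum_eq : copies F (K ⊕g K) = ∑ F₂ ∈ spanningSubgraphs K, leftCopies K F F₂ := by
  classical
  simp only [copies, leftCopies, card_filter]
  rw [sum_spanningSubgraphs_sum, sum_comm]

open Classical in
lemma ParityEq.leftCopies_eq (hK : ParityEq K ⊥) (hF : FlipFree F) (F₂ : SimpleGraph W) :
    (leftCopies K F F₂ : ZMod 2) =
      if Nonempty ((⊥ : SimpleGraph W) ⊕g F₂ ≃g F) then 1 else 0 := by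
  have h := hK (fun F' => if Nonempty (F' ⊕g F₂ ≃g F) then 1 else 0) ?_ ?_
  · rwa [sum_spanningSubgraphs_bot, sum_boole] at h
  · rintro F₁ F₁' ⟨φ⟩
    exact if_congr (nonempty_iso_congr (Iso.sumCongr φ Iso.refl)) rfl rfl
  · exact fun F' hF' => if_neg fun ⟨e⟩ => hF' (hF.of_iso e.symm).left_of_sum

lemma leftCopies_eq_one {F₂ : SimpleGraph W} (h : Nonempty ((⊥ : SimpleGraph W) ⊕g F₂ ≃g F)) :
    leftCopies K F F₂ = 1 := by
  classical
  rw [leftCopies, card_eq_one]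
  refine ⟨⊥, ?_⟩
  ext F'
  rw [mem_filter, mem_spanningSubgraphs, mem_singleton]
  constructor
  · rintro ⟨-, ⟨e⟩⟩
    obtain ⟨e'⟩ := h
    have h_le : (⊥ : SimpleGraph W) ⊕g F₂ ≤ F' ⊕g F₂ := sum_le_sum_iff.2 ⟨bot_le, le_rfl⟩
    have h_eq := eq_of_le_of_ncard_le h_le (ncard_edgeSet_eq_of_iso (e.trans e'.symm)).le
    ext a b
    rw [← sum_adj_inl (G := F') (H := F₂), ← h_eq, sum_adj_inl]
  · rintro rfl
    exact ⟨bot_le, h⟩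

lemma leftCopies_congr {F₂ F₂' : SimpleGraph W} (φ : F₂ ≃g F₂') :
    leftCopies K F F₂ = leftCopies K F F₂' := by
  classical
  exact congrArg card <| filter_congr fun F' _ =>
    nonempty_iso_congr (Iso.sumCongr Iso.refl φ)

lemma leftCopies_eq_zero (hF : FlipFree F) {F₂ : SimpleGraph W} (hF₂ : ¬ FlipFree F₂) :
    leftCopies K F F₂ = 0 := by
  classical
  rw [leftCopies, card_eq_zero, filter_eq_empty_iff]
  rintro F' _ ⟨e⟩
  exact hF₂ (hF.of_iso e.symm).right_of_sum

open Classical in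
/-- Half of the spanning subgraphs counted by `leftCopies K F F₂`, not counting the empty one. -/
noncomputable def halfLeftCopies (K : SimpleGraph W) (F : SimpleGraph (W ⊕ W))
    (F₂ : SimpleGraph W) : ℕ :=
  if Nonempty ((⊥ : SimpleGraph W) ⊕g F₂ ≃g F) then 0 else leftCopies K F F₂ / 2

open Classical in
lemma leftCopies_eq_add (hK : ParityEq K ⊥) (hF : FlipFree F) (F₂ : SimpleGraph W) :
    leftCopies K F F₂ =
      (if Nonempty (F₂ ⊕g (⊥ : SimpleGraph W) ≃g F) then 1 else 0) +
        2 * halfLeftCopies K F F₂ := by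
  have h_parity := hK.leftCopies_eq hF F₂
  rw [halfLeftCopies, if_congr (nonempty_iso_congr Iso.sumComm) rfl rfl]
  split_ifs with h
  · rw [leftCopies_eq_one h]
  · rw [if_neg h, ZMod.natCast_eq_zero_iff] at h_parity
    omega

lemma sum_halfLeftCopies (hK : ParityEq K ⊥) (hF : FlipFree F) (hF_bot : F ≠ ⊥) :
    ∑ F₂ ∈ spanningSubgraphs K, halfLeftCopies K F F₂ ≡ leftCopies K F ⊥ / 2 [MOD 2] := by
  classical
  have h := hK (fun F₂ => (halfLeftCopies K F F₂ : ZMod 2)) ?_ ?_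
  · rw [sum_spanningSubgraphs_bot, halfLeftCopies,
      if_neg (not_nonempty_bot_sum_bot_iso hF_bot)] at h
    rw [← ZMod.natCast_eq_natCast_iff, ← h, Nat.cast_sum]
  · rintro F₂ F₂' ⟨φ⟩
    have h_iff : Nonempty ((⊥ : SimpleGraph W) ⊕g F₂ ≃g F) ↔
        Nonempty ((⊥ : SimpleGraph W) ⊕g F₂' ≃g F) :=
      nonempty_iso_congr (Iso.sumCongr Iso.refl φ)
    exact congrArg Nat.cast (if_congr h_iff rfl (by rw [leftCopies_congr φ]))
  · intro F₂ hF₂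
    simp only [halfLeftCopies, leftCopies_eq_zero hF hF₂, Nat.zero_div, ite_self, Nat.cast_zero]

theorem four_dvd_copies_sum (hK : ParityEq K ⊥) (hF : FlipFree F) (hF_bot : F ≠ ⊥) :
    4 ∣ copies F (K ⊕g K) := by
  classical
  have h_copies : copies F (K ⊕g K) =
      leftCopies K F ⊥ + 2 * ∑ F₂ ∈ spanningSubgraphs K, halfLeftCopies K F F₂ := by
    rw [copies_sum_eq, sum_congr rfl fun F₂ _ => leftCopies_eq_add hK hF F₂, sum_add_distrib,
      ← mul_sum, ← card_filter]
    rfl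
  have h_even := hK.leftCopies_eq hF ⊥
  rw [if_neg (not_nonempty_bot_sum_bot_iso hF_bot), ZMod.natCast_eq_zero_iff] at h_even
  have h_half := sum_halfLeftCopies hK hF hF_bot
  rw [Nat.ModEq] at h_half
  omega

end CopiesOfSum

/-! ### Signed sums over a mirrored graph modulo 4 -/

section MirrorSign

variable {V : Type*}

open Classical in
/-- The function that is `-1` on the edge `uv` and `1` elsewhere; multiplying a sign function by it
reverses that edge. -/
noncomputable def flipSign (u v x y : V) : ℤ :=
  if (x = u ∧ y = v) ∨ (x = v ∧ y = u) then -1 else 1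

lemma flipSign_comm (u v x y : V) : flipSign u v x y = flipSign v u x y := by
  classical exact if_congr or_comm rfl rfl

lemma flipSign_swap (u v x y : V) : flipSign u v x y = flipSign u v y x := by
  classical exact if_congr (or_comm.trans (or_congr and_comm and_comm)) rfl rfl

lemma IsInvariantOrientation.prod_flipSign_eq_neg_one {F F' : SimpleGraph V} {I : Finset (V × V)}
    (h : IsInvariantOrientation F I) (e : F ≃g F') {u v : V} (huv : (e.symm u, e.symm v) ∈ I) :
    ∏ p ∈ I, flipSign u v (e p.1) (e p.2) = -1 := by
  classical
  rw [prod_eq_single_of_mem _ huv]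
  · simp [flipSign]
  · rintro ⟨x, y⟩ hxy hne
    refine if_neg ?_
    rintro (⟨rfl, rfl⟩ | ⟨rfl, rfl⟩)
    · simp at hne
    · simp only [e.symm_apply_apply] at huv
      exact h.asymm _ _ huv hxy

open Classical in
lemma IsInvariantOrientation.prod_flipSign {F F' : SimpleGraph V} {I : Finset (V × V)}
    (h : IsInvariantOrientation F I) (e : F ≃g F') (u v : V) :
    ∏ p ∈ I, flipSign u v (e p.1) (e p.2) = if F'.Adj u v then -1 else 1 := by
  split_ifs with huv
  · rcases (h.adj_iff _ _).1 (e.symm.map_adj_iff.2 huv) with hI | hI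
    · exact h.prod_flipSign_eq_neg_one e hI
    · simp only [flipSign_comm u v]
      exact h.prod_flipSign_eq_neg_one e hI
  · refine prod_eq_one fun p hp => if_neg ?_
    have h_adj : F'.Adj (e p.1) (e p.2) := e.map_adj_iff.2 ((h.adj_iff _ _).2 (Or.inl hp))
    rintro (⟨hu, hv⟩ | ⟨hv, hu⟩)
    · exact huv (hu ▸ hv ▸ h_adj)
    · exact huv (hu ▸ hv ▸ h_adj.symm)

variable {W : Type*} {K : SimpleGraph W} {r : W} {F F' : SimpleGraph (W ⊕ W)}

/-- The sign function obtained by copying the signs on the left half to the right half. -/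
def mirrorSign (s : W ⊕ W → W ⊕ W → ℤ) : W ⊕ W → W ⊕ W → ℤ
  | .inr a, .inr b => s (.inl a) (.inl b)
  | x, y => s x y

lemma IsSign.mirrorSign {s : W ⊕ W → W ⊕ W → ℤ} (hs : IsSign (mirror K r) s) :
    IsSign (mirror K r) (mirrorSign s) where
  eq_zero := by
    rintro (a | a) (b | b) h
    · exact hs.eq_zero _ _ h
    · exact hs.eq_zero _ _ h
    · exact hs.eq_zero _ _ h
    · exact hs.eq_zero (.inl a) (.inl b) h
  eq_one_or := by
    rintro (a | a) (b | b) h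
    · exact hs.eq_one_or _ _ h
    · exact hs.eq_one_or _ _ h
    · exact hs.eq_one_or _ _ h
    · exact hs.eq_one_or (.inl a) (.inl b) h
  antisymm := by
    rintro (a | a) (b | b)
    · exact hs.antisymm _ _
    · exact hs.antisymm _ _
    · exact hs.antisymm _ _
    · exact hs.antisymm (.inl a) (.inl b)

lemma mirrorSign_swap_of_sum_adj (s : W ⊕ W → W ⊕ W → ℤ) {x y : W ⊕ W}
    (h : (K ⊕g K).Adj x y) : mirrorSign s x.swap y.swap = mirrorSign s x y := by
  rcases x with x | x <;> rcases y with y | y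
  · rfl
  · simp at h
  · simp at h
  · rfl

lemma mirrorSign_swap {s : W ⊕ W → W ⊕ W → ℤ} (hs : IsSign (mirror K r) s) {x y : W ⊕ W}
    (h : (mirror K r).Adj x y) : mirrorSign s x.swap y.swap =
      flipSign (.inl r) (.inr r) x y * mirrorSign s x y := by
  rcases x with x | x <;> rcases y with y | y
  · simp [flipSign, mirrorSign]
  · obtain ⟨rfl, rfl⟩ := h
    simpa [flipSign, mirrorSign] using hs.antisymm (.inr y) (.inl y)
  · obtain ⟨rfl, rfl⟩ := h
    simpa [flipSign, mirrorSign] using hs.antisymm (.inl y) (.inr y)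
  · simp [flipSign, mirrorSign]

/-- The isomorphism onto the reflection of a graph induced by an isomorphism onto that graph. -/
def isoReflect (e : F ≃g F') : F ≃g reflect F' :=
  e.trans (Iso.comap (Equiv.sumComm W W) F').symm

variable {I : Finset ((W ⊕ W) × (W ⊕ W))} {s : W ⊕ W → W ⊕ W → ℤ}

open Classical in
lemma IsInvariantOrientation.signProd_reflect (h : IsInvariantOrientation F I)
    (hs : IsSign (mirror K r) s) (hF' : F' ≤ mirror K r) :
    signProd F I (mirrorSign s) (reflect F') =
      (if F'.Adj (.inl r) (.inr r) then -1 else 1) * signProd F I (mirrorSign s) F' := by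
  by_cases h_iso : Nonempty (F ≃g F')
  · obtain ⟨e⟩ := h_iso
    rw [h.signProd_eq _ e, h.signProd_eq _ (isoReflect e), ← h.prod_flipSign e,
      ← prod_mul_distrib]
    refine prod_congr rfl fun p hp => ?_
    exact mirrorSign_swap hs (hF' (e.map_adj_iff.2 ((h.adj_iff _ _).2 (Or.inl hp))))
  · have h_iso' : ¬ Nonempty (F ≃g reflect F') := fun ⟨e⟩ =>
      h_iso ⟨e.trans (Iso.comap (Equiv.sumComm W W) F')⟩
    rw [signProd_of_isEmpty _ _ h_iso, signProd_of_isEmpty _ _ h_iso', mul_zero]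

/-- Reflection pairs up the edges of a symmetric copy without changing their mirrored signs. -/
lemma IsInvariantOrientation.signProd_eq_one (h : IsInvariantOrientation F I)
    (hs : IsSign (mirror K r) s) (hF' : F' ≤ K ⊕g K) (h_refl : reflect F' = F') (e : F ≃g F') :
    signProd F I (mirrorSign s) F' = 1 := by
  have h_adj (x y : W ⊕ W) : F'.Adj x.swap y.swap ↔ F'.Adj x y := by
    conv_rhs => rw [← h_refl]
    rfl
  let τ : F' ≃g F' := ⟨Equiv.sumComm W W, h_adj _ _⟩
  let φ : F ≃g F := (e.trans τ).trans e.symm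
  have apply_φ (x : W ⊕ W) : e (φ x) = (e x).swap := e.apply_symm_apply (τ (e x))
  have h_edge (p : (W ⊕ W) × (W ⊕ W)) (hp : p ∈ I) : (K ⊕g K).Adj (e p.1) (e p.2) :=
    hF' (e.map_adj_iff.2 ((h.adj_iff _ _).2 (Or.inl hp)))
  rw [h.signProd_eq _ e]
  refine prod_involution (fun p _ => (φ p.1, φ p.2)) ?_ ?_ (fun p hp => h.map φ _ _ hp) ?_
  · intro p hp
    simp only [apply_φ]
    rw [mirrorSign_swap_of_sum_adj s (h_edge p hp)]
    rcases hs.mirrorSign.eq_one_or _ _ (sum_le_mirror (h_edge p hp)) with h_sign | h_sign <;>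
      rw [h_sign] <;> norm_num
  · intro p _ _ h_fix
    have h_swap := congrArg (fun p => e p.1) h_fix
    simp only [apply_φ] at h_swap
    rcases hx : e p.1 with x | x <;> rw [hx] at h_swap <;> simp at h_swap
  · intro p _
    have φ_φ (x : W ⊕ W) : φ (φ x) = x := e.injective (by rw [apply_φ, apply_φ, Sum.swap_swap])
    simp only [φ_φ]

variable [Finite W]

open Classical in
lemma IsInvariantOrientation.sum_signProd_bridge (h : IsInvariantOrientation F I)
    (hs : IsSign (mirror K r) s) :
    ∑ F' ∈ spanningSubgraphs (mirror K r) with F'.Adj (.inl r) (.inr r),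
      signProd F I (mirrorSign s) F' = 0 := by
  have reflect_mem (F' : SimpleGraph (W ⊕ W))
      (hF' : F' ∈ {F' ∈ spanningSubgraphs (mirror K r) | F'.Adj (.inl r) (.inr r)}) :
      reflect F' ∈ {F' ∈ spanningSubgraphs (mirror K r) | F'.Adj (.inl r) (.inr r)} := by
    rw [mem_filter, mem_spanningSubgraphs] at hF' ⊢
    exact ⟨reflect_le_mirror hF'.1, hF'.2.symm⟩
  refine self_eq_neg.1 ?_
  rw [← sum_neg_distrib]
  refine sum_nbij' reflect reflect reflect_mem reflect_mem (fun F' _ => reflect_reflect F')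
    (fun F' _ => reflect_reflect F') fun F' hF' => ?_
  rw [mem_filter, mem_spanningSubgraphs] at hF'
  rw [h.signProd_reflect hs hF'.1, if_pos hF'.2, neg_one_mul, neg_neg]

open Classical in
lemma IsInvariantOrientation.even_card_signProd_eq_neg_one (h : IsInvariantOrientation F I)
    (hs : IsSign (mirror K r) s) :
    Even #{F' ∈ spanningSubgraphs (K ⊕g K) | signProd F I (mirrorSign s) F' = -1} := by
  rw [← ZMod.natCast_eq_zero_iff_even, card_eq_sum_ones, Nat.cast_sum]
  refine sum_involution (fun F' _ => reflect F') (fun _ _ => CharTwo.add_self_eq_zero _) ?_ ?_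
    fun F' _ => reflect_reflect F'
  · intro F' hF' _ h_refl
    rw [mem_filter, mem_spanningSubgraphs] at hF'
    have h_iso : Nonempty (F ≃g F') := by
      by_contra h_iso
      rw [signProd_of_isEmpty _ _ h_iso] at hF'
      exact absurd hF'.2 (by norm_num)
    obtain ⟨e⟩ := h_iso
    rw [h.signProd_eq_one hs hF'.1 h_refl e] at hF'
    exact absurd hF'.2 (by norm_num)
  · intro F' hF'
    rw [← filter_not_bridge_spanningSubgraphs K r, mem_filter, mem_filter,
      mem_spanningSubgraphs] at hF' ⊢
    refine ⟨⟨reflect_le_mirror hF'.1.1, fun h_adj => hF'.1.2 h_adj.symm⟩, ?_⟩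
    rw [h.signProd_reflect hs hF'.1.1, if_neg hF'.1.2, one_mul, hF'.2]

theorem IsInvariantOrientation.four_dvd_sum_signProd_mirrorSign (hK : ParityEq K ⊥)
    (hF : FlipFree F) (hF_bot : F ≠ ⊥) (h : IsInvariantOrientation F I)
    (hs : IsSign (mirror K r) s) :
    (4 : ℤ) ∣ ∑ F' ∈ spanningSubgraphs (mirror K r), signProd F I (mirrorSign s) F' := by
  classical
  rw [← sum_filter_add_sum_filter_not _ fun F' : SimpleGraph (W ⊕ W) => F'.Adj (.inl r) (.inr r),
    h.sum_signProd_bridge hs, zero_add, filter_not_bridge_spanningSubgraphs,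
    h.sum_signProd hs.mirrorSign sum_le_mirror]
  have h_copies := four_dvd_copies_sum hK hF hF_bot
  obtain ⟨c, hc⟩ := h.even_card_signProd_eq_neg_one hs
  omega

end MirrorSign

/-! ### Copies in a mirrored graph with an edge deleted -/

section ParityOfDeletions

variable {W : Type*} {K : SimpleGraph W} {r : W} {F F' : SimpleGraph (W ⊕ W)}
  {I : Finset ((W ⊕ W) × (W ⊕ W))} {s : W ⊕ W → W ⊕ W → ℤ} {B : Finset (W × W)}

/-- `B` contains exactly one orientation of each edge of `K` whose two copies in a mirrored graph
have different signs. -/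
structure IsMismatchSet (K : SimpleGraph W) (s : W ⊕ W → W ⊕ W → ℤ) (B : Finset (W × W)) :
    Prop where
  mem_iff : ∀ a b, K.Adj a b →
    (((a, b) ∈ B ∨ (b, a) ∈ B) ↔ s (.inr a) (.inr b) ≠ s (.inl a) (.inl b))
  asymm : ∀ a b, (a, b) ∈ B → (b, a) ∉ B

lemma IsMismatchSet.prod_flipSign_eq_neg_one (hB : IsMismatchSet K s B) {a b : W}
    (hab : (a, b) ∈ B) :
    ∏ e ∈ B, flipSign (.inr e.1) (.inr e.2) (.inr a : W ⊕ W) (.inr b) = -1 := by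
  classical
  rw [prod_eq_single_of_mem _ hab]
  · exact if_pos (Or.inl ⟨rfl, rfl⟩)
  · rintro ⟨c, d⟩ hcd h_ne
    refine if_neg ?_
    simp only [Sum.inr.injEq]
    rintro (⟨rfl, rfl⟩ | ⟨rfl, rfl⟩)
    · exact h_ne rfl
    · exact hB.asymm _ _ hab hcd

lemma IsMismatchSet.eq_mirrorSign_mul (hB : IsMismatchSet K s B) (hs : IsSign (mirror K r) s)
    {x y : W ⊕ W} (h : (mirror K r).Adj x y) :
    s x y = mirrorSign s x y * ∏ e ∈ B, flipSign (.inr e.1) (.inr e.2) x y := by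
  have prod_eq_one_of
      (h : ∀ e ∈ B, ¬ (x = .inr e.1 ∧ y = .inr e.2 ∨ x = .inr e.2 ∧ y = .inr e.1)) :
      ∏ e ∈ B, flipSign (.inr e.1) (.inr e.2) x y = 1 := prod_eq_one fun e he => if_neg (h e he)
  rcases x with a | a <;> rcases y with b | b
  · rw [prod_eq_one_of (by simp), mul_one]
    rfl
  · rw [prod_eq_one_of (by simp), mul_one]
    rfl
  · rw [prod_eq_one_of (by simp), mul_one]
    rfl
  · by_cases h_mem : (a, b) ∈ B ∨ (b, a) ∈ B
    · have h_ne := (hB.mem_iff a b h).1 h_mem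
      have h_prod : ∏ e ∈ B, flipSign (.inr e.1) (.inr e.2) (.inr a : W ⊕ W) (.inr b) = -1 := by
        rcases h_mem with hab | hba
        · exact hB.prod_flipSign_eq_neg_one hab
        · simp only [flipSign_swap _ _ (.inr a : W ⊕ W)]
          exact hB.prod_flipSign_eq_neg_one hba
      have h_right := hs.eq_one_or (.inr a) (.inr b) h
      have h_left := hs.eq_one_or (.inl a) (.inl b) h
      rw [h_prod, mirrorSign]
      omega
    · rw [prod_eq_one_of, mul_one]
      · exact not_not.1 fun h_ne => h_mem ((hB.mem_iff a b h).2 h_ne)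
      · rintro ⟨c, d⟩ he
        simp only [Sum.inr.injEq]
        rintro (⟨rfl, rfl⟩ | ⟨rfl, rfl⟩)
        · exact h_mem (Or.inl he)
        · exact h_mem (Or.inr he)

lemma prod_neg_one_zmod_four {ι : Type*} (B : Finset ι) (P : ι → Prop) [DecidablePred P] :
    ((∏ e ∈ B, (if P e then -1 else 1) : ℤ) : ZMod 4) = 1 - 2 * #{e ∈ B | P e} := by
  rw [prod_ite, prod_const, prod_const_one, mul_one, Int.cast_pow, Int.cast_neg, Int.cast_one]
  obtain ⟨k, hk | hk⟩ := Nat.even_or_odd' #{e ∈ B | P e}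
  · rw [hk, pow_mul, neg_one_sq, one_pow]
    push_cast
    linear_combination (k : ZMod 4) * (by decide : (4 : ZMod 4) = 0)
  · rw [hk, pow_succ, pow_mul, neg_one_sq, one_pow]
    push_cast
    linear_combination (k : ZMod 4) * (by decide : (4 : ZMod 4) = 0)

open Classical in
/-- The number of copies of `F` in `T` that contain the edge `xy`. -/
noncomputable def copiesThrough [Finite W] (F T : SimpleGraph W) (x y : W) : ℕ :=
  #{F' ∈ spanningSubgraphs T | Nonempty (F' ≃g F) ∧ F'.Adj x y}

lemma copiesThrough_add_copies_del [Finite W] (F T : SimpleGraph W) (x y : W) :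
    copiesThrough F T x y + copies F (del T x y) = copies F T := by
  classical
  have copies_del : copies F (del T x y) =
      #{F' ∈ spanningSubgraphs T | Nonempty (F' ≃g F) ∧ ¬ F'.Adj x y} := by
    refine congrArg card ?_
    ext F'
    rw [mem_filter, mem_filter, mem_spanningSubgraphs, mem_spanningSubgraphs]
    constructor
    · rintro ⟨h_le, h_iso⟩
      exact ⟨h_le.trans (del_le x y), h_iso, fun h => (del_adj.1 (h_le h)).2 (Or.inl ⟨rfl, rfl⟩)⟩
    · rintro ⟨h_le, h_iso, hxy⟩
      refine ⟨fun a b hab => del_adj.2 ⟨h_le hab, ?_⟩, h_iso⟩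
      rintro (⟨rfl, rfl⟩ | ⟨rfl, rfl⟩)
      · exact hxy hab
      · exact hxy hab.symm
  rw [copies_del, copiesThrough, copies, ← filter_filter, ← filter_filter,
    card_filter_add_card_filter_not]

open Classical in
/-- Passing from the mirrored signs to the original ones multiplies by `-1` for each mismatched edge
of the copy, and `± (-1) ^ k = ± 1 - 2 * k` modulo `4`. -/
lemma IsInvariantOrientation.signProd_zmod_four (h : IsInvariantOrientation F I)
    (hs : IsSign (mirror K r) s) (hB : IsMismatchSet K s B) (hF' : F' ≤ mirror K r) :
    ((signProd F I s F' : ℤ) : ZMod 4) = (signProd F I (mirrorSign s) F' : ℤ) -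
      2 * #{e ∈ B | Nonempty (F' ≃g F) ∧ F'.Adj (.inr e.1) (.inr e.2)} := by
  by_cases h_iso : Nonempty (F ≃g F')
  · obtain ⟨e⟩ := h_iso
    have h_prod : signProd F I s F' = signProd F I (mirrorSign s) F' *
        ∏ e ∈ B, if F'.Adj (.inr e.1) (.inr e.2) then -1 else 1 := by
      rw [h.signProd_eq _ e, h.signProd_eq _ e]
      simp only [← h.prod_flipSign e]
      rw [prod_comm, ← prod_mul_distrib]
      exact prod_congr rfl fun p hp => hB.eq_mirrorSign_mul hs
        (hF' (e.map_adj_iff.2 ((h.adj_iff _ _).2 (Or.inl hp))))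
    have h_iso' : Nonempty (F' ≃g F) := ⟨e.symm⟩
    rw [h_prod, Int.cast_mul, prod_neg_one_zmod_four]
    simp only [h_iso', true_and]
    rcases h.signProd_eq_one_or hs.mirrorSign hF' e with h_sign | h_sign <;> rw [h_sign]
    · push_cast
      ring
    · push_cast
      linear_combination (#{e ∈ B | F'.Adj (.inr e.1) (.inr e.2)} : ZMod 4) *
        (by decide : (4 : ZMod 4) = 0)
  · have h_iso' : ¬ Nonempty (F' ≃g F) := fun ⟨e⟩ => h_iso ⟨e.symm⟩
    rw [signProd_of_isEmpty _ _ h_iso, signProd_of_isEmpty _ _ h_iso]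
    simp [h_iso']

variable [Finite W]

lemma IsInvariantOrientation.even_sum_copiesThrough (hK : ParityEq K ⊥) (hF : FlipFree F)
    (hF_bot : F ≠ ⊥) (h : IsInvariantOrientation F I) (hs : IsSign (mirror K r) s)
    (hB : IsMismatchSet K s B)
    (h_sum : ∑ F' ∈ spanningSubgraphs (mirror K r), signProd F I s F' = 0) :
    Even (∑ e ∈ B, copiesThrough F (mirror K r) (.inr e.1) (.inr e.2)) := by
  classical
  have h_mirror : (((∑ F' ∈ spanningSubgraphs (mirror K r), signProd F I (mirrorSign s) F') : ℤ) :
      ZMod 4) = 0 :=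
    (ZMod.intCast_zmod_eq_zero_iff_dvd _ 4).2
      (h.four_dvd_sum_signProd_mirrorSign hK hF hF_bot hs)
  have h_double : ∑ F' ∈ spanningSubgraphs (mirror K r),
        #{e ∈ B | Nonempty (F' ≃g F) ∧ F'.Adj (.inr e.1) (.inr e.2)} =
      ∑ e ∈ B, copiesThrough F (mirror K r) (.inr e.1) (.inr e.2) := by
    simp only [copiesThrough, card_filter]
    exact sum_comm
  have h_zmod := congrArg (Int.cast (R := ZMod 4)) h_sum
  rw [Int.cast_sum, sum_congr rfl fun F' hF' =>
    h.signProd_zmod_four hs hB (mem_spanningSubgraphs.1 hF'), sum_sub_distrib, ← Int.cast_sum,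
    h_mirror, ← mul_sum, ← Nat.cast_sum, h_double, zero_sub, Int.cast_zero, neg_eq_zero] at h_zmod
  have h_dvd : 4 ∣ 2 * ∑ e ∈ B, copiesThrough F (mirror K r) (.inr e.1) (.inr e.2) := by
    rw [← ZMod.natCast_eq_zero_iff, Nat.cast_mul]
    exact h_zmod
  rw [Nat.even_iff]
  omega

theorem IsInvariantOrientation.even_sum_copies_del (hK : ParityEq K ⊥)
    (hF : FlipFree F) (hF_bot : F ≠ ⊥) (h : IsInvariantOrientation F I)
    (hs : IsSign (mirror K r) s) (hB : IsMismatchSet K s B)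
    (h_sum : ∑ F' ∈ spanningSubgraphs (mirror K r), signProd F I s F' = 0)
    (h_even : Even (copies F (mirror K r))) :
    Even (∑ e ∈ B, copies F (del (mirror K r) (.inr e.1) (.inr e.2))) := by
  have h_total : Even (∑ e ∈ B, copiesThrough F (mirror K r) (.inr e.1) (.inr e.2) +
      ∑ e ∈ B, copies F (del (mirror K r) (.inr e.1) (.inr e.2))) := by
    rw [← sum_add_distrib, sum_congr rfl fun e _ => copiesThrough_add_copies_del _ _ _ _,
      sum_const, smul_eq_mul]
    exact h_even.mul_left _
  exact (Nat.even_add.1 h_total).1 (h.even_sum_copiesThrough hK hF hF_bot hs hB h_sum)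

end ParityOfDeletions

/-! ### Balanced orientations of mirrored trees -/

section OddCopies

variable {V : Type*} [Finite V] {T : SimpleGraph V} {p q : V} {k : ℕ}

/-- The reductions of the deletions are pairwise non-isomorphic, so one of them with the most edges
occurs an odd number of times in its own deletion and an even number of times in the others. -/
theorem exists_odd_sum_copies_del (hT : T.IsTree) (hr : ∀ z, RigidAt T z)
    (hk : Nat.card V = 2 ^ k) (hqp : T.Adj q p) (h_half : 2 * compCard (del T q p) p = Nat.card V)
    {ι : Type*} {B : Finset ι} (hB : B.Nonempty) {u v : ι → V}
    (h_adj : ∀ e ∈ B, T.Adj (u e) (v e)) (hu : ∀ e ∈ B, ¬ (del T q p).Reachable p (u e))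
    (hv : ∀ e ∈ B, ¬ (del T q p).Reachable p (v e))
    (h_inj : ∀ e ∈ B, ∀ e' ∈ B, s(u e, v e) = s(u e', v e') → e = e') :
    ∃ F, FlipFree F ∧ F ≠ ⊥ ∧ Odd (∑ e ∈ B, copies F (del T (u e) (v e))) := by
  have h_red (e) (he : e ∈ B) : ∃ x y R i j, s(x, y) = s(u e, v e) ∧ IsFarDart T q p x y ∧
      IsDelReduction T x y R i j := by
    obtain ⟨x, y, h_eq, h_far⟩ := exists_isFarDart hT.connected (h_adj e he) (hu e he) (hv e he)
    obtain ⟨R, i, j, hR⟩ := exists_isDelReduction hT h_far.adj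
    exact ⟨x, y, R, i, j, h_eq, h_far, hR⟩
  have : Nonempty V := ⟨p⟩
  choose! x y R i j h_eq h_far hR using h_red
  obtain ⟨e, he, h_odd⟩ := exists_odd_copies hB (G := fun e => del T (u e) (v e)) (R := R)
    (fun e he => (hR e he).flipFree)
    (fun e he => by
      rw [del, ← h_eq e he]
      exact (hR e he).parityEq)
    fun e he e' he' ⟨φ⟩ => h_inj e he e' he' <| by
      rw [← h_eq e he, ← h_eq e' he']
      exact (hR e he).eq_of_iso (hR e' he') φ hT hr hk hqp h_half (h_far e he) (h_far e' he')
  have h_lt := (h_far e he).compCard_lt hT hqp h_half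
  exact ⟨R e, (hR e he).flipFree, (hR e he).ne_bot hT (h_far e he).adj hk h_lt, h_odd⟩

end OddCopies

section BalancedMirror

variable {W : Type*} {K : SimpleGraph W} {r : W} {H : Digraph (W ⊕ W)}

lemma not_reachable_del_mirror_inr (w : W) :
    ¬ (del (mirror K r) (.inr r) (.inl r)).Reachable (.inl r) (.inr w) := by
  rw [del_comm, mirror_del]
  intro h
  obtain ⟨_, h_eq, -⟩ := sum_reachable_inl h
  cases h_eq

lemma adj_or_adj_of_eq_mirror (hT : H.toSimpleGraphInclusive = mirror K r) {x y : W ⊕ W}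
    (h : (mirror K r).Adj x y) : H.Adj x y ∨ H.Adj y x := by
  rw [← hT, toSimpleGraphInclusive_adj] at h
  exact h.2

lemma mirror_adj_of_adj (hH : H.IsOriented) (hT : H.toSimpleGraphInclusive = mirror K r)
    {x y : W ⊕ W} (h : H.Adj x y) : (mirror K r).Adj x y := by
  rw [← hT, toSimpleGraphInclusive_adj]
  exact ⟨ne_of_adj hH h, Or.inl h⟩

lemma isMismatchSet_arcSign (hH : H.IsOriented) (hT : H.toSimpleGraphInclusive = mirror K r)
    {B : Finset (W × W)}
    (hB : ∀ a b, (a, b) ∈ B ↔ H.Adj (.inr a) (.inr b) ∧ ¬ H.Adj (.inl a) (.inl b)) :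
    IsMismatchSet K (arcSign H) B where
  mem_iff a b hab := by
    have h_left := adj_or_adj_of_eq_mirror hT (x := .inl a) (y := .inl b) hab
    have h_right := adj_or_adj_of_eq_mirror hT (x := .inr a) (y := .inr b) hab
    rw [hB, hB, arcSign, arcSign]
    rcases h_left with h_left | h_left <;> rcases h_right with h_right | h_right <;>
      simp [h_left, h_right, hH _ _ h_left, hH _ _ h_right]
  asymm a b hab hba := hH _ _ ((hB a b).1 hab).1 ((hB b a).1 hba).1

lemma isomorphic_bridgeMirror (hH : H.IsOriented) (hT : H.toSimpleGraphInclusive = mirror K r)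
    (h_iff : ∀ a b, H.Adj (.inl a) (.inl b) ↔ H.Adj (.inr a) (.inr b)) :
    (Digraph.bridgeMirror ⟨fun a b => H.Adj (.inl a) (.inl b)⟩ r).Isomorphic H := by
  rcases adj_or_adj_of_eq_mirror hT (x := .inl r) (y := .inr r) ⟨rfl, rfl⟩ with h_bridge | h_bridge
  · refine ⟨⟨Equiv.refl _, ?_⟩⟩
    rintro (a | a) (b | b)
    · exact Iff.rfl
    · refine ⟨mirror_adj_of_adj hH hT, ?_⟩
      rintro ⟨rfl, rfl⟩
      exact h_bridge
    · refine ⟨fun hab => ?_, False.elim⟩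
      obtain ⟨rfl, rfl⟩ := mirror_adj_of_adj hH hT hab
      exact hH _ _ h_bridge hab
    · exact (h_iff a b).symm
  · refine ⟨⟨Equiv.sumComm W W, ?_⟩⟩
    rintro (a | a) (b | b)
    · exact (h_iff a b).symm
    · refine ⟨mirror_adj_of_adj hH hT, ?_⟩
      rintro ⟨rfl, rfl⟩
      exact h_bridge
    · refine ⟨fun hab => ?_, False.elim⟩
      obtain ⟨rfl, rfl⟩ := mirror_adj_of_adj hH hT hab
      exact hH _ _ h_bridge hab
    · exact Iff.rfl

variable [Finite W]

lemma two_mul_compCard_del_mirror (hK : K.Connected) :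
    2 * compCard (del (mirror K r) (.inr r) (.inl r)) (.inl r) = Nat.card (W ⊕ W) := by
  rw [del_comm, mirror_del, compCard_inl, compCard_eq_of_connected hK, Nat.card_sum, two_mul]

/-- A flip-free reduction of a balanced digraph has an even number of copies in it unless it has no
edges, but it has exactly one copy in itself. -/
lemma Balanced.eq_bot_of_parityEq {V : Type*} [Finite V] {H : Digraph V} (h : Balanced H)
    (hH : H.IsOriented) {R : SimpleGraph V} (hR : FlipFree R)
    (h_parity : ParityEq H.toSimpleGraphInclusive R) : R = ⊥ := by
  by_contra h_ne
  have h_copies := h_parity.copies_eq hR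
  rw [copies_self, (ZMod.natCast_eq_zero_iff_even).2 (h.even_copies hH hR h_ne)] at h_copies
  exact absurd h_copies (by decide)

lemma Balanced.exists_rigidAt_mirror (h : Balanced H) (hH : H.IsOriented)
    (hT : H.toSimpleGraphInclusive = mirror K r) (h_tree : (mirror K r).IsTree) :
    (∀ z, RigidAt (mirror K r) z) ∧ ∃ k, Nat.card (W ⊕ W) = 2 ^ k := by
  obtain ⟨R, k, hR⟩ := exists_isTreeReduction h_tree
  have h_bot : R = ⊥ := h.eq_bot_of_parityEq hH hR.flipFree (hT ▸ hR.parityEq)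
  refine ⟨hR.rigidAt h_bot, k, ?_⟩
  rw [← hR.compCard_mul (.inl r), h_bot, compCard_bot, one_mul]

lemma Balanced.parityEq_bot (h : Balanced H) (hH : H.IsOriented)
    (hT : H.toSimpleGraphInclusive = mirror K r) (hK : K.IsTree) : ParityEq K ⊥ := by
  obtain ⟨R, _, hR⟩ := exists_isTreeReduction hK
  have h_sum : R ⊕g R = ⊥ := h.eq_bot_of_parityEq hH (hR.flipFree.sum hR.flipFree)
    (hT ▸ (parityEq_mirror K r).trans (hR.parityEq.sum hR.parityEq))
  exact eq_bot_of_sum_eq_bot h_sum ▸ hR.parityEq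

/-- If `B` is the set of arcs of the right copy that are reversed in the left copy, the number of
copies of a flip-free `F` in the deletions of the arcs in `B` has even sum for every `F`, but odd
sum for some `F` if `B` is not empty. -/
theorem Balanced.eq_empty_of_mem_iff (h : Balanced H) (hH : H.IsOriented)
    (hT : H.toSimpleGraphInclusive = mirror K r) (hK : K.IsTree) (h_tree : (mirror K r).IsTree)
    {B : Finset (W × W)}
    (hB : ∀ a b, (a, b) ∈ B ↔ H.Adj (.inr a) (.inr b) ∧ ¬ H.Adj (.inl a) (.inl b)) : B = ∅ := by
  by_contra h_ne
  have h_inj (e) (he : e ∈ B) (e') (he' : e' ∈ B)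
      (h_eq : s((.inr e.1 : W ⊕ W), .inr e.2) = s(.inr e'.1, .inr e'.2)) : e = e' := by
    rcases Sym2.eq_iff.1 h_eq with ⟨h_fst, h_snd⟩ | ⟨h_fst, h_snd⟩
    · exact Prod.ext (Sum.inr_injective h_fst) (Sum.inr_injective h_snd)
    · have h_adj := ((hB e.1 e.2).1 he).1
      rw [h_fst, h_snd] at h_adj
      exact absurd h_adj (hH _ _ ((hB e'.1 e'.2).1 he').1)
  obtain ⟨h_rigid, k, hk⟩ := h.exists_rigidAt_mirror hH hT h_tree
  have h_adj (e) (he : e ∈ B) : (mirror K r).Adj (.inr e.1) (.inr e.2) :=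
    mirror_adj_of_adj hH hT ((hB e.1 e.2).1 he).1
  have h_bridge : (mirror K r).Adj (.inr r) (.inl r) := ⟨rfl, rfl⟩
  obtain ⟨F, hF, hF_bot, h_odd⟩ := exists_odd_sum_copies_del h_tree h_rigid hk h_bridge
    (two_mul_compCard_del_mirror hK.connected) (nonempty_iff_ne_empty.2 h_ne) h_adj
    (fun e _ => not_reachable_del_mirror_inr e.1) (fun e _ => not_reachable_del_mirror_inr e.2)
    h_inj
  obtain ⟨I, hI⟩ := hF.exists_isInvariantOrientation
  have h_sum := h.sum_signProd hH hI hF_bot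
  have h_copies := h.even_copies hH hF hF_bot
  have h_sign := isSign_arcSign hH
  rw [hT] at h_sum h_copies h_sign
  exact Nat.not_even_iff_odd.2 h_odd (hI.even_sum_copies_del (h.parityEq_bot hH hT hK) hF hF_bot
    h_sign (isMismatchSet_arcSign hH hT hB) h_sum h_copies)

lemma Balanced.adj_inl_of_adj_inr (h : Balanced H) (hH : H.IsOriented)
    (hT : H.toSimpleGraphInclusive = mirror K r) (hK : K.IsTree) (h_tree : (mirror K r).IsTree)
    {a b : W} (hab : H.Adj (.inr a) (.inr b)) : H.Adj (.inl a) (.inl b) := by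
  classical
  have := Fintype.ofFinite W
  have h_empty := h.eq_empty_of_mem_iff hH hT hK h_tree (B := {e |
    H.Adj (.inr e.1) (.inr e.2) ∧ ¬ H.Adj (.inl e.1) (.inl e.2)}) fun a b => mem_filter_univ _
  by_contra h_not
  exact notMem_empty (a, b) (h_empty ▸ (mem_filter_univ _).2 ⟨hab, h_not⟩)

lemma Balanced.adj_inl_iff_adj_inr (h : Balanced H) (hH : H.IsOriented)
    (hT : H.toSimpleGraphInclusive = mirror K r) (hK : K.IsTree) (h_tree : (mirror K r).IsTree)
    (a b : W) : H.Adj (.inl a) (.inl b) ↔ H.Adj (.inr a) (.inr b) := by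
  refine ⟨fun hab => ?_, h.adj_inl_of_adj_inr hH hT hK h_tree⟩
  have h_adj := mirror_adj_of_adj hH hT hab
  exact (adj_or_adj_of_eq_mirror hT (x := .inr a) (y := .inr b) h_adj).resolve_right fun hba =>
    hH _ _ hab (h.adj_inl_of_adj_inr hH hT hK h_tree hba)

lemma Balanced.exists_bridgeMirror (h : Balanced H) (hH : H.IsOriented)
    (hT : H.toSimpleGraphInclusive = mirror K r) (hK : K.IsTree) (h_tree : (mirror K r).IsTree) :
    ∃ G : Digraph W, G.IsOriented ∧ G.toSimpleGraphInclusive = K ∧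
      (G.bridgeMirror r).Isomorphic H := by
  refine ⟨⟨fun a b => H.Adj (.inl a) (.inl b)⟩, fun a b => hH _ _, ?_,
    isomorphic_bridgeMirror hH hT (h.adj_inl_iff_adj_inr hH hT hK h_tree)⟩
  ext a b
  rw [toSimpleGraphInclusive_adj, ← mirror_inl_inl (r := r), ← hT, toSimpleGraphInclusive_adj,
    Sum.inl_injective.ne_iff]

end BalancedMirror

lemma isRecursivelyBridgeMirrored_of_subsingleton {V : Type u} [Nonempty V] [Subsingleton V]
    {H : Digraph V} (hH : H.IsOriented) : H.IsRecursivelyBridgeMirrored := by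
  obtain ⟨_⟩ : Nonempty (Unique V) := ⟨uniqueOfSubsingleton (Classical.arbitrary V)⟩
  have h_bot : H = ⊥ := by
    ext a b
    exact ⟨fun hab => ne_of_adj hH hab (Subsingleton.elim a b), False.elim⟩
  exact h_bot ▸ .single

lemma Balanced.not_flipFree {V : Type*} [Finite V] [Nontrivial V] {H : Digraph V}
    (h : Balanced H) (hH : H.IsOriented) (h_conn : H.toSimpleGraphInclusive.Connected) :
    ¬ FlipFree H.toSimpleGraphInclusive := fun h_free => by
  obtain ⟨a, b, hab⟩ := exists_pair_ne V
  have h_reach := h_conn.preconnected a b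
  rw [h.eq_bot_of_parityEq hH h_free (.refl _), reachable_bot] at h_reach
  exact hab h_reach

theorem Balanced.isRecursivelyBridgeMirrored {V : Type u} [Finite V] {H : Digraph V}
    (h : Balanced H) (hH : H.IsOriented) (h_conn : H.toSimpleGraphInclusive.Connected) :
    H.IsRecursivelyBridgeMirrored := by
  induction hn : Nat.card V using Nat.strong_induction_on generalizing V with
  | _ n ih =>
    subst hn
    have := h_conn.nonempty
    rcases subsingleton_or_nontrivial V with _ | _
    · exact isRecursivelyBridgeMirrored_of_subsingleton hH
    have h_tree := h.isTree hH h_conn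
    obtain ⟨W, _, K, r, hK, ⟨e⟩⟩ := exists_mirror_iso h_tree (h.not_flipFree hH h_conn)
    let H' : Digraph (W ⊕ W) := ⟨fun x y => H.Adj (e x) (e y)⟩
    let e' : H'.Adj ≃r H.Adj := ⟨e.toEquiv, Iff.rfl⟩
    have hT' : H'.toSimpleGraphInclusive = mirror K r := by
      ext x y
      rw [← e.map_adj_iff, toSimpleGraphInclusive_adj, toSimpleGraphInclusive_adj,
        e.injective.ne_iff]
    have h' : Balanced H' := h.of_iso e'.symm
    obtain ⟨G, hG, rfl, ⟨f⟩⟩ :=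
      h'.exists_bridgeMirror (fun _ _ => hH _ _) hT' hK (e.isTree_iff.2 h_tree)
    have hG_balanced : Balanced G := (h'.of_iso f.symm).of_bridgeMirror
    have h_card : Nat.card W < Nat.card V := by
      have : Nonempty W := ⟨r⟩
      have : 0 < Nat.card W := Nat.card_pos
      rw [← Nat.card_congr e.toEquiv, Nat.card_sum]
      omega
    exact .iso ⟨f.trans e'⟩ (.mirror r (ih _ h_card hG_balanced hG hK.connected rfl))

end ImpartialDigraph

theorem theorem1p3 {V : Type*} [Finite V] (H : Digraph V) (hH : H.IsOriented) :
    H.IsImpartial ↔ H.IsDisjointUnionOfRBM :=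
  ImpartialDigraph.isImpartial_iff_of_connected hH fun hG h_conn h =>
    h.isRecursivelyBridgeMirrored hG h_conn
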